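/- Let $(M,g)$ be a smooth 4-manifold with a smooth Lorentzian metric of signature $(-,+,+,+)$, and $\Sigma=\mathbb R\times S^2$ with points $(u,x)$. Let $(u,x,r)\mapsto\psi(u,x,r)\in M$ be a diffeomorphism from an open neighbourhood of $\Sigma\times\{0\}$ in $\Sigma\times\mathbb R$ onto an open subset of $M$. Put $\Phi=\psi|_{r=0}$, $\mathcal H=\Phi(\Sigma)$, $n=\partial_u$, $\ell=\partial_r$ (the rigging), and let $e_a=d\Phi(\partial_a)$ be the tangent vectors of $\mathcal H$, with $e_1=n$ and $e_M$ $(M=2,3)$ tangent to $S^2$. For a 2-tensor field $h$ near $\mathcal H$ define the hypersurface data $\mathscr D(h)=(\gamma_{ab},\ell_a,\ell^{(2)},Y_{ab})$ on $\Sigma$ by $$\gamma_{ab}=h(e_a,e_b),\quad \ell_a=h(\ell,e_a),\quad \ell^{(2)}=h(\ell,\ell),\quad Y_{ab}=\tfrac12(\mathcal L_\ell h)(e_a,e_b),$$ and $\kappa=-Y_{nn}$, $\Omega_M=-Y_{nM}$, $\Xi_{MN}=Y_{MN}$. Suppose that the data of $g$ satisfy $\gamma_{ab}=\mathrm{diag}(0,q_{MN})$,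 $\ell_a=(1,0,0)$, $\ell^{(2)}=0$ (so $\mathcal H$ is a null hypersurface with null normal $n$), and that $\mathcal H$ is non-expanding: $\Theta_{MN}=\tfrac12\partial_u q_{MN}=0$, so that $q=q_{MN}$ is a $u$-independent metric on $S^2$. Let $D$ be its Levi-Civita connection. A *hypersurface symmetry* is a diffeomorphism $F$ between open subsets of $M$ whose domain contains $\mathcal H$ (for instance a diffeomorphism of $M$), such that $F(\mathcal H)=\mathcal H$ and $(F^*g)(X,X')_p=g(X,X')_p$ for all $p\in\mathcal H$, $X,X'\in T_pM$. A pair $(f,Y)$ is *admissible* if $f:\Sigma\to\mathbb R$ is smooth, $f_u=\partial_uf$ vanishes nowhere, each $f(\cdot,x):\mathbb R\to\mathbb R$ is bijective, and $Y:S^2\to S^2$ is a diffeomorphism with $Y^*q=q$. We say that $F$ *induces* $(f,Y)$ if $F(\Phi(u,x))=\Phi(f(u,x),Y(x))$ for all $(u,x)$. Write $f_M=\partial_Mf$ and $f^M=q^{MN}f_N$. Then: 1. Every hypersurface symmetry induces an admissible pair $(f,Y)$. 2. If $F$ is defined near $\mathcal H$ and induces an admissible pair $(f,Y)$, then $F$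 is a hypersurface symmetry if and only if on $\mathcal H$ $$dF(\ell)=\tfrac1{f_u}\left(\ell-f^M\,\partial_MY^I\,e_I-\tfrac12 f^Mf_M\,n\right),$$ with $\ell,e_I,n$ on the right taken at the image point. 3. Every admissible pair $(f,Y)$ is induced by some hypersurface symmetry, and two hypersurface symmetries that induce the same $(f,Y)$ have the same differential at all points of $\mathcal H$. 4. A hypersurface symmetry that induces $(f,Y)$ preserves the null normal one-form $\boldsymbol n=g(n,\cdot)$ along $\mathcal H$ if and only if $f_u\equiv1$, if and only if $f(u,x)=u+A(x)$ with a smooth $A:S^2\to\mathbb R$. 5. Let $F$ be a hypersurface symmetry that induces $(f,Y)$, and let $\zeta(u,x)=(f(u,x),Y(x))$, $\hat u=1/f_u$, and $\hat V=\frac{f^Mf_M}{2f_u}\partial_u-f^M\partial_M$. Then $\zeta$ is a diffeomorphism of $\Sigma$, and $\mathscr D(F^*g)$ is obtained from $\mathscr D(g)=(\gamma,\ell_a,\ell^{(2)},Y_{ab})$ by the pull-back $\zeta^*$ followed by the change of rigging $\ell\mapsto\hat u(\ell+\hat V)$, i.e. by the map $$\gamma'=\gamma,\quad \ell'_a=\hat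 u(\ell_a+\gamma_{ab}\hat V^b),\quad \ell^{(2)\prime}=\hat u^2\left(\ell^{(2)}+2\ell_a\hat V^a+\gamma_{ab}\hat V^a\hat V^b\right),$$ $$Y'_{ab}=\hat uY_{ab}+\tfrac12(\partial_a\hat u\,\ell_b+\partial_b\hat u\,\ell_a)+\tfrac12(\mathcal L_{\hat u\hat V}\gamma)_{ab}.$$ This is a residual gauge transformation: it leaves $\gamma_{ab},\ell_a,\ell^{(2)}$ unchanged. 6. Explicitly, at $(u,x)$ and in any local coordinates $x^M$ of $S^2$, the data of $F^*g$ are $$\kappa'=\kappa|_\zeta f_u+\partial_u\log|f_u|,\qquad \Omega'_M=Y^I_M\Omega_I|_\zeta+\kappa|_\zeta f_M+\partial_M\log|f_u|,$$ $$\Xi'_{MN}=\tfrac1{f_u}\left(Y^I_MY^J_N\,\Xi_{IJ}|_\zeta-Y^I_M\Omega_I|_\zeta f_N-Y^I_N\Omega_I|_\zeta f_M-\kappa|_\zeta f_Mf_N-D_MD_Nf\right),$$ where $Y^I_M=\partial_MY^I$ (the identity matrix if $Y=\mathrm{id}$). For a supertranslation $f=u+A(x)$, $Y=\mathrm{id}$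 this reads $$\kappa'=\kappa|_\zeta,\quad \Omega'_M=\Omega_M|_\zeta+\kappa|_\zeta A_M,\quad \Xi'_{MN}=\Xi_{MN}|_\zeta-\Omega_M|_\zeta A_N-\Omega_N|_\zeta A_M-\kappa|_\zeta A_MA_N-D_MD_NA.$$ -/

import Mathlib

open Set
open scoped Manifold ContDiff

noncomputable section

namespace NullHyp

/-- Model space of surfaces. -/
abbrev E2 := EuclideanSpace ℝ (Fin 2)

/-- Model space of spacetimes. -/
abbrev E4 := EuclideanSpace ℝ (Fin 4)

instance finrankFact : Fact (Module.finrank ℝ (EuclideanSpace ℝ (Fin 3)) = 2 + 1) := ⟨by simp⟩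

/-- The sphere `S²`, with Mathlib's smooth structure. -/
abbrev S2 := Metric.sphere (0 : EuclideanSpace ℝ (Fin 3)) 1

/-- The abstract manifold `Σ = ℝ × S²`, with points `(u, x)`. -/
abbrev Sig := ℝ × S2

/-- Model with corners of `Σ`. -/
abbrev IS : ModelWithCorners ℝ (ℝ × E2) (ModelProd ℝ E2) := 𝓘(ℝ, ℝ).prod (𝓡 2)

/-- The tangent vector `a ∂_u + v` of `Σ` at `σ = (u, x)`, with `v` tangent to `S²` at `x`. -/
def vec (σ : Sig) (a : ℝ) (v : TangentSpace (𝓡 2) σ.2) : TangentSpace IS σ :=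
  ((a, v) : ℝ × E2)

/-! ### Hypersurface data on the abstract manifold, and their gauge transformations -/

/-- A hypersurface data set `(γ_ab, ℓ_a, ℓ⁽²⁾, Y_ab)`: tensor fields on `Σ`. -/
@[ext] structure HData where
  γ : ∀ σ : Sig, TangentSpace IS σ → TangentSpace IS σ → ℝ
  form : ∀ σ : Sig, TangentSpace IS σ → ℝ
  norm : Sig → ℝ
  Y : ∀ σ : Sig, TangentSpace IS σ → TangentSpace IS σ → ℝ

/-- The Lie derivative `(L_W T)(X, X')` at `σ` of a covariant 2-tensor field `T` on `Σ`, by the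
coordinate formula `W^c ∂_c T_ab + T_cb ∂_a W^c + T_ac ∂_b W^c` in the chart at `σ`. (The
derivative of the chart at `σ` is the identity of `T_σ Σ` at the point `σ` itself.) -/
def lieDeriv (T : ∀ σ : Sig, TangentSpace IS σ → TangentSpace IS σ → ℝ)
    (W : ∀ σ : Sig, TangentSpace IS σ) (σ : Sig) (X X' : TangentSpace IS σ) : ℝ :=
  let φ := extChartAt IS σ
  let y₀ : ℝ × E2 := φ σ
  let That : ℝ × E2 → ℝ × E2 → ℝ × E2 → ℝ := fun y A B =>
    T (φ.symm y) (mfderiv 𝓘(ℝ, ℝ × E2) IS φ.symm y A) (mfderiv 𝓘(ℝ, ℝ × E2) IS φ.symm y B)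
  let What : ℝ × E2 → ℝ × E2 := fun y =>
    mfderiv IS 𝓘(ℝ, ℝ × E2) φ (φ.symm y) (W (φ.symm y))
  fderiv ℝ (fun y => That y X X') y₀ (What y₀)
    + That y₀ (fderiv ℝ What y₀ X) X' + That y₀ X (fderiv ℝ What y₀ X')

/-- Action on the data of a map `ζ : Σ → Σ`, by pull-back. -/
def HData.pull (D : HData) (ζ : Sig → Sig) : HData where
  γ σ X X' := D.γ (ζ σ) (mfderiv IS IS ζ σ X) (mfderiv IS IS ζ σ X')
  form σ X := D.form (ζ σ) (mfderiv IS IS ζ σ X)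
  norm σ := D.norm (ζ σ)
  Y σ X X' := D.Y (ζ σ) (mfderiv IS IS ζ σ X) (mfderiv IS IS ζ σ X')

/-- The differential of a function on `Σ`. -/
def dfun (û : Sig → ℝ) (σ : Sig) (X : TangentSpace IS σ) : ℝ :=
  mfderiv IS 𝓘(ℝ, ℝ) û σ X

/-- Action on the data of the change of rigging `ℓ ↦ û (ℓ + V)`. -/
def HData.rig (D : HData) (û : Sig → ℝ) (V : ∀ σ : Sig, TangentSpace IS σ) : HData where
  γ := D.γ
  form σ X := û σ * (D.form σ X + D.γ σ (V σ) X)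
  norm σ := û σ ^ 2 * (D.norm σ + 2 * D.form σ (V σ) + D.γ σ (V σ) (V σ))
  Y σ X X' := û σ * D.Y σ X X'
    + 1 / 2 * (dfun û σ X * D.form σ X' + dfun û σ X' * D.form σ X)
    + 1 / 2 * lieDeriv D.γ (fun τ => û τ • V τ) σ X X'

/-- A gauge transformation: a diffeomorphism of `Σ`, followed by a change of rigging. -/
def HData.gauge (D : HData) (ζ : Sig → Sig) (û : Sig → ℝ)
    (V : ∀ σ : Sig, TangentSpace IS σ) : HData :=
  (D.pull ζ).rig û V

/-- The gauge conditions `γ = diag(0, q)`, `ℓ_a = δ_a^1`, `ℓ⁽²⁾ = 0`. The first one says that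
`Σ` is null with null normal `n = ∂_u`. -/
structure HData.IsGaugeFixed (D : HData) : Prop where
  γ_n : ∀ σ X, D.γ σ (vec σ 1 0) X = 0
  form_n : ∀ σ, D.form σ (vec σ 1 0) = 1
  form_sph : ∀ σ v, D.form σ (vec σ 0 v) = 0
  norm_zero : ∀ σ, D.norm σ = 0

/-- A residual gauge transformation of `D`: it keeps the metric part of the data. -/
structure HData.IsResidualGauge (D : HData) (ζ : Sig ≃ₘ^∞⟮IS, IS⟯ Sig) (û : Sig → ℝ)
    (V : ∀ σ : Sig, TangentSpace IS σ) : Prop where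
  smooth_u : ContMDiff IS 𝓘(ℝ, ℝ) ∞ û
  u_ne_zero : ∀ σ, û σ ≠ 0
  smooth_V : ContMDiff IS IS.tangent ∞ (fun σ => (⟨σ, V σ⟩ : TangentBundle IS Sig))
  γ_eq : (D.gauge ζ û V).γ = D.γ
  form_eq : (D.gauge ζ û V).form = D.form
  norm_eq : (D.gauge ζ û V).norm = D.norm

/-- The second fundamental form `Θ_MN = ½ ∂_u q_MN`. -/
def HData.Θ (D : HData) (u : ℝ) (x : S2) (v w : TangentSpace (𝓡 2) x) : ℝ :=
  1 / 2 * deriv (fun s : ℝ => D.γ (s, x) (vec (s, x) 0 v) (vec (s, x) 0 w)) u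

/-- The hypersurface is non-expanding: `Θ_MN = 0`. -/
def HData.IsNonExpanding (D : HData) : Prop :=
  ∀ u x v w, D.Θ u x v w = 0

/-- The metric `q_MN` of the section `u = 0`
(of every section, if the hypersurface is non-expanding). -/
def HData.q (D : HData) (x : S2) (v w : TangentSpace (𝓡 2) x) : ℝ :=
  D.γ (0, x) (vec (0, x) 0 v) (vec (0, x) 0 w)

/-- Surface gravity `κ = -Y_nn`. -/
def HData.κ (D : HData) (u : ℝ) (x : S2) : ℝ :=
  -D.Y (u, x) (vec (u, x) 1 0) (vec (u, x) 1 0)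

/-- Hajicek one-form `Ω_M = -Y_nM`. -/
def HData.Ω (D : HData) (u : ℝ) (x : S2) (v : TangentSpace (𝓡 2) x) : ℝ :=
  -D.Y (u, x) (vec (u, x) 1 0) (vec (u, x) 0 v)

/-- Transverse connection `Ξ_MN = Y_MN`. -/
def HData.Ξ (D : HData) (u : ℝ) (x : S2) (v w : TangentSpace (𝓡 2) x) : ℝ :=
  D.Y (u, x) (vec (u, x) 0 v) (vec (u, x) 0 w)

/-! ### Local coordinates on the sphere -/

/-- The partial derivative `∂_M h` at `y` of a function of two variables. -/
def pd (M : Fin 2) (h : E2 → ℝ) (y : E2) : ℝ :=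
  fderiv ℝ h y (EuclideanSpace.single M 1)

/-- The coordinate vector `∂_M` of the chart `c`, at the point with coordinates `y`. -/
def cvec (c : OpenPartialHomeomorph S2 E2) (y : E2) (M : Fin 2) :
    TangentSpace (𝓡 2) (c.symm y) :=
  mfderiv (𝓡 2) (𝓡 2) c.symm y (EuclideanSpace.single M 1 : E2)

/-- The components `q_MN` in the chart `c`. -/
def HData.qMat (D : HData) (c : OpenPartialHomeomorph S2 E2) (y : E2) :
    Matrix (Fin 2) (Fin 2) ℝ :=
  Matrix.of fun M N => D.q (c.symm y) (cvec c y M) (cvec c y N)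

/-- The Christoffel symbols
`Γ^L_MN = ½ q^{LP} (∂_M q_NP + ∂_N q_MP - ∂_P q_MN)` of `q` in the chart `c`. -/
def HData.christoffel (D : HData) (c : OpenPartialHomeomorph S2 E2) (y : E2)
    (L M N : Fin 2) : ℝ :=
  1 / 2 * ∑ P : Fin 2, (D.qMat c y)⁻¹ L P *
    (pd M (fun z => D.qMat c z N P) y + pd N (fun z => D.qMat c z M P) y
      - pd P (fun z => D.qMat c z M N) y)

/-- The components `D_M D_N h = ∂_M ∂_N h - Γ^L_MN ∂_L h` in the chart `c` of the covariant
Hessian of a function `h` on the sphere with the metric `q`. -/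
def HData.hess (D : HData) (h : S2 → ℝ) (c : OpenPartialHomeomorph S2 E2) (y : E2)
    (M N : Fin 2) : ℝ :=
  pd M (pd N (fun z => h (c.symm z))) y
    - ∑ L : Fin 2, D.christoffel c y L M N * pd L (fun z => h (c.symm z)) y

/-! ### Spacetime -/

section Spacetime

variable {M : Type*} [TopologicalSpace M] [ChartedSpace E4 M]

/-- A smooth Lorentzian metric, of signature `(-,+,+,+)`, on a smooth 4-manifold. -/
structure LorentzMetric (M : Type*) [TopologicalSpace M] [ChartedSpace E4 M]
    [IsManifold (𝓡 4) ∞ M] where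
  val : ∀ p : M, TangentSpace (𝓡 4) p →L[ℝ] TangentSpace (𝓡 4) p →L[ℝ] ℝ
  symm : ∀ p X X', val p X X' = val p X' X
  signature : ∀ p, ∃ b : Module.Basis (Fin 4) ℝ (TangentSpace (𝓡 4) p), ∀ i j,
    val p (b i) (b j) = if i = j then (if i = 0 then -1 else 1) else 0
  smooth : ContMDiff (𝓡 4) ((𝓡 4).prod 𝓘(ℝ, E4 →L[ℝ] E4 →L[ℝ] ℝ)) ∞
    (fun p => Bundle.TotalSpace.mk' (E4 →L[ℝ] E4 →L[ℝ] ℝ) p (val p))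

/-- A field of covariant 2-tensors on `M`. -/
abbrev Form2 (M : Type*) [TopologicalSpace M] [ChartedSpace E4 M] :=
  ∀ p : M, TangentSpace (𝓡 4) p → TangentSpace (𝓡 4) p → ℝ

/-- The underlying 2-tensor field of a metric. -/
def LorentzMetric.form [IsManifold (𝓡 4) ∞ M] (g : LorentzMetric M) : Form2 M :=
  fun p X X' => g.val p X X'

/-- The pull-back `F^* h`. -/
def pullback (F : M → M) (h : Form2 M) : Form2 M := fun p X X' =>
  h (F p) (mfderiv (𝓡 4) (𝓡 4) F p X) (mfderiv (𝓡 4) (𝓡 4) F p X')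

/-- A smooth spacetime coordinate system `(u, x, r) ↦ ψ((u, x), r)`, defined on an open
neighbourhood of the hypersurface `{r = 0}`, which is diffeomorphic to `Σ = ℝ × S²`. -/
structure Coords (M : Type*) [TopologicalSpace M] [ChartedSpace E4 M] where
  ψ : PartialDiffeomorph (IS.prod 𝓘(ℝ, ℝ)) (𝓡 4) (Sig × ℝ) M ∞
  zero_mem : ∀ σ : Sig, (σ, (0 : ℝ)) ∈ ψ.source

namespace Coords

/-- The embedding `Φ : Σ → M`. -/
def Φ (C : Coords M) (σ : Sig) : M := C.ψ (σ, 0)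

/-- The hypersurface. -/
def H (C : Coords M) : Set M := range C.Φ

/-- The push-forward `dΦ`. -/
def dΦ (C : Coords M) (σ : Sig) : TangentSpace IS σ →L[ℝ] TangentSpace (𝓡 4) (C.Φ σ) :=
  mfderiv IS (𝓡 4) C.Φ σ

/-- The vector `n = ∂_u` on the hypersurface. -/
def n (C : Coords M) (σ : Sig) : TangentSpace (𝓡 4) (C.Φ σ) := C.dΦ σ (vec σ 1 0)

/-- The rigging `ℓ = ∂_r` on the hypersurface. -/
def rigging (C : Coords M) (σ : Sig) : TangentSpace (𝓡 4) (C.Φ σ) :=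
  mfderiv 𝓘(ℝ, ℝ) (𝓡 4) (fun r : ℝ => C.ψ (σ, r)) 0 (1 : ℝ)

/-- The hypersurface data of a 2-tensor field `h` (a metric): `γ_ab = h(e_a, e_b)`,
`ℓ_a = h(ℓ, e_a)`, `ℓ⁽²⁾ = h(ℓ, ℓ)` and `Y_ab = ½ (L_ℓ h)(e_a, e_b)` on the hypersurface. As
`ℓ = ∂_r`, its flow is `r ↦ r + t`, and the Lie derivative is the `r`-derivative of the pull-back
of `h` along `σ ↦ ψ(σ, r)`. -/
def data (C : Coords M) (h : Form2 M) : HData where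
  γ σ X X' := h (C.Φ σ) (C.dΦ σ X) (C.dΦ σ X')
  form σ X := h (C.Φ σ) (C.rigging σ) (C.dΦ σ X)
  norm σ := h (C.Φ σ) (C.rigging σ) (C.rigging σ)
  Y σ X X' := 1 / 2 * deriv (fun r : ℝ => h (C.ψ (σ, r))
    (mfderiv IS (𝓡 4) (fun τ : Sig => C.ψ (τ, r)) σ X)
    (mfderiv IS (𝓡 4) (fun τ : Sig => C.ψ (τ, r)) σ X')) 0

end Coords

/-- `F`, a diffeomorphism between open subsets of spacetime containing the hypersurface `H`
(such as a diffeomorphism of `M`), is a hypersurface symmetry: `F(H) = H`, and `F^* g = g` on all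
pairs of spacetime vectors at the points of `H`. -/
structure IsHypersurfaceSymmetry (h : Form2 M) (C : Coords M)
    (F : PartialDiffeomorph (𝓡 4) (𝓡 4) M M ∞) : Prop where
  subset_source : C.H ⊆ F.source
  image_eq : F '' C.H = C.H
  metric_eq : ∀ p ∈ C.H, ∀ X X' : TangentSpace (𝓡 4) p, pullback F h p X X' = h p X X'

/-- On the hypersurface, `F` is the map `(u, x) ↦ (f(u, x), Y(x))`. -/
def Induces (C : Coords M) (F : M → M) (f : Sig → ℝ) (Y : S2 → S2) : Prop :=
  ∀ u x, F (C.Φ (u, x)) = C.Φ (f (u, x), Y x)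

end Spacetime

/-- The derivative `f_u`. -/
def fu (f : Sig → ℝ) (σ : Sig) : ℝ := deriv (fun s : ℝ => f (s, σ.2)) σ.1

/-- The differential of `f(u, ·)` at `x`. -/
def dS (f : Sig → ℝ) (u : ℝ) (x : S2) (v : TangentSpace (𝓡 2) x) : ℝ :=
  mfderiv (𝓡 2) 𝓘(ℝ, ℝ) (fun z : S2 => f (u, z)) x v

/-- `f` is smooth and each `f(·, x)` is a bijection of `ℝ` with nowhere vanishing derivative;
`Y` is an isometry of `q`. (So `(u, x) ↦ (f(u, x), Y(x))` is a diffeomorphism of `Σ`.) -/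
structure IsAdmissible (D : HData) (f : Sig → ℝ) (Y : S2 ≃ₘ^∞⟮𝓡 2, 𝓡 2⟯ S2) : Prop where
  smooth : ContMDiff IS 𝓘(ℝ, ℝ) ∞ f
  fu_ne_zero : ∀ σ, fu f σ ≠ 0
  bij : ∀ x, Function.Bijective (fun u : ℝ => f (u, x))
  isometry : ∀ x v w,
    D.q (Y x) (mfderiv (𝓡 2) (𝓡 2) Y x v) (mfderiv (𝓡 2) (𝓡 2) Y x w) = D.q x v w

/-- The transverse derivative of `F` along the hypersurface:
`dF(ℓ) = (1/f_u) (ℓ - f^M Y^I_M e_I - ½ f^M f_M n)`, the right-hand side at the image point;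
`G` is the gradient `f^M` of `f(u, ·)` with respect to `q`. -/
def HasTransverseJet {M : Type*} [TopologicalSpace M] [ChartedSpace E4 M]
    (D : HData) (C : Coords M) (F : M → M) (f : Sig → ℝ) (Y : S2 → S2) : Prop :=
  ∀ (u : ℝ) (x : S2), ∃ G : TangentSpace (𝓡 2) x,
    (∀ v, D.q x G v = dS f u x v) ∧
    (mfderiv (𝓡 4) (𝓡 4) F (C.Φ (u, x)) (C.rigging (u, x)) : E4) =
      (1 / fu f (u, x)) • ((C.rigging (f (u, x), Y x) : E4)
        - C.dΦ (f (u, x), Y x) (vec (f (u, x), Y x) 0 (mfderiv (𝓡 2) (𝓡 2) Y x G))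
        - (1 / 2 * D.q x G G) • C.n (f (u, x), Y x))

end NullHyp

end

/-! Along the hypersurface the tangent space of spacetime is the line of ℓ plus TΣ, with g(ℓ, ℓ) = 0
and g(ℓ, X) the u-component of X (`exists_decomp`, `gram_ell_DΦ`). As g is nondegenerate, the
radical of γ is exactly the line of n (`eq_zero_of_gammaForm`), and non-expansion makes γ the
pull-back of q under Σ → S² (`gammaForm_eq_qForm`). A symmetry F restricts to a map ζ of Σ that
preserves γ, hence its radical. So the sphere component of ζ does not depend on u, and ζ = (f, Y)
with Y an isometry of q.

On TΣ the differential of F is dζ, so only w = dF(ℓ) is left to find. The conditions g(w, dζ X) =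
g(ℓ, X) determine w up to a multiple of n, and g(w, w) = 0 then fixes the multiple, because g(w, n)
= 1/f_u is not zero (`eq_jet`). The solution is `Coords.jet`. Conversely, these products are all
that F^*g = g asks beyond dζ preserving γ (`isHypersurfaceSymmetry_iff_jet`).

For existence, the jet is rewritten as ρℓ + dζ(W), where ρ = 1/f_u and W is `Coords.shift`
(`jet_eq`). In the coordinates (u, x, r), F is ζ × id after a `shear` that fixes {r = 0} and sends
∂_r to W + ρ∂_r there. The inverse function theorem makes the shear a local diffeomorphism, and
compactness of S² makes it injective on a whole neighbourhood of {r = 0} (`exists_isOpen_injOn`).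

For the data, the same identity says that F maps ∂_r - W to ρ∂_r along {r = 0}. Hence the tangential
part of the ∂_r-derivative of F^*g is L_W γ plus the pull-back by ζ of L_{ρℓ} g, and the latter is ρ
L_ℓ g plus the symmetrized product of dρ and g(ℓ, ·). No extension of W off {r = 0} is needed: one
tangential derivative of the identity, with the symmetry of second derivatives, suffices
(`hasDerivAt_bilin_pull`). This is the gauge transformation.

Finally γ(W, ·) = -ρ d_S f, with d_S the differential along the sphere, so L_W γ consists of second
derivatives of f, terms in dρ and Christoffel terms of q. The terms in dρ cancel, and Y'(X, X') = ρ
(Y(dζ X, dζ X') - Hess f(X, X')), where the only Christoffel symbols of Hess f are those of q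
(`data_Y_eq_hess`, `hess_eq`). Its components are the laws for κ, Ω and Ξ, as f_uu/f_u and f_uM/f_u
are derivatives of log |f_u|.

Differentials are recast as maps of the model spaces (`dψ`, `DΦ`, `dmap`, `dspt`, `dslab`), so that
equations between base points can be rewritten without changing types. -/

noncomputable section

namespace NullHyp

/-! ### Inverse function theorem and partial diffeomorphisms of manifolds -/

section Manifold

variable {E F : Type*} [NormedAddCommGroup E] [NormedSpace ℝ E] [NormedAddCommGroup F]
  [NormedSpace ℝ F]

/-- The inverse function theorem, as a statement about local diffeomorphisms. -/
theorem isLocalDiffeomorphAt_of_fderiv [CompleteSpace E] [CompleteSpace F] {f : E → F} {V : Set E}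
    (hV : IsOpen V) (hf : ContDiffOn ℝ ∞ f V) {x : E} (hx : x ∈ V)
    (hb : Function.Bijective (fderiv ℝ f x)) :
    IsLocalDiffeomorphAt 𝓘(ℝ, E) 𝓘(ℝ, F) ∞ f x := by
  let f' : E ≃L[ℝ] F := ContinuousLinearEquiv.ofBijective (fderiv ℝ f x)
    (LinearMap.ker_eq_bot.2 hb.1) (LinearMap.range_eq_top.2 hb.2)
  have hfa : ContDiffAt ℝ ∞ f x := hf.contDiffAt (hV.mem_nhds hx)
  have hfd : HasFDerivAt f (f' : E →L[ℝ] F) x :=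
    (hfa.differentiableAt (by simp)).hasFDerivAt
  let e := hfa.toOpenPartialHomeomorph f hfd (by simp)
  have hxe : x ∈ e.source := hfa.mem_toOpenPartialHomeomorph_source hfd (by simp)
  have hcont : ContinuousOn (fderiv ℝ f) V := hf.continuousOn_fderiv_of_isOpen hV (by simp)
  -- The local inverse is a priori smooth only at the one point f(x). Invertibility of the
  -- derivative is an open condition; restricting to it makes the inverse smooth at every point.
  let W : Set E := V ∩ fderiv ℝ f ⁻¹' range ((↑) : (E ≃L[ℝ] F) → E →L[ℝ] F)
  have hW : IsOpen W := hcont.isOpen_inter_preimage hV ContinuousLinearEquiv.isOpen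
  have hxW : x ∈ W := ⟨hx, f', rfl⟩
  let e' := e.restrOpen W hW
  have hs : e'.source ⊆ W := by
    intro y hy
    exact hy.2
  refine ⟨{ toPartialEquiv := e'.toPartialEquiv
            open_source := e'.open_source
            open_target := e'.open_target
            contMDiffOn_toFun := ?_
            contMDiffOn_invFun := ?_ }, ⟨hxe, hxW⟩, fun y _ => rfl⟩
  · exact (hf.mono (fun y hy => (hs hy).1)).contMDiffOn
  · intro z hz
    have h1 : e'.symm z ∈ W := hs (e'.map_target hz)
    obtain ⟨g', hg'⟩ := h1.2
    have h2 : ContDiffAt ℝ ∞ f (e'.symm z) := hf.contDiffAt (hV.mem_nhds h1.1)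
    have h3 : HasFDerivAt e' (g' : E →L[ℝ] F) (e'.symm z) := by
      rw [hg']
      exact (h2.differentiableAt (by simp)).hasFDerivAt
    exact (e'.contDiffAt_symm hz h3 h2).contMDiffAt.contMDiffWithinAt

variable {H H' : Type*} [TopologicalSpace H] [TopologicalSpace H'] {I : ModelWithCorners ℝ E H}
  {J : ModelWithCorners ℝ F H'} {M N : Type*} [TopologicalSpace M] [ChartedSpace H M]
  [TopologicalSpace N] [ChartedSpace H' N]

/-- An injective local diffeomorphism on an open set is a partial diffeomorphism. -/
theorem exists_partialDiffeomorph_of_injOn [Nonempty M] {f : M → N} {U : Set M} (hU : IsOpen U)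
    (hf : ∀ x ∈ U, IsLocalDiffeomorphAt I J ∞ f x) (hinj : InjOn f U) :
    ∃ φ : PartialDiffeomorph I J M N ∞, φ.source = U ∧ ∀ x, φ x = f x := by
  let e := hinj.toPartialEquiv f U
  have key : ∀ x ∈ U, ∃ φ : PartialDiffeomorph I J M N ∞, x ∈ φ.source ∧ φ.source ⊆ U ∧
      EqOn f φ φ.source := by
    intro x hx
    obtain ⟨P, hP, hPeq⟩ := hf x hx
    exact ⟨{ toPartialEquiv := (P.toOpenPartialHomeomorph.restrOpen U hU).toPartialEquiv
             open_source := (P.toOpenPartialHomeomorph.restrOpen U hU).open_source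
             open_target := (P.toOpenPartialHomeomorph.restrOpen U hU).open_target
             contMDiffOn_toFun := P.contMDiffOn.mono (fun y hy => hy.1)
             contMDiffOn_invFun := P.symm.contMDiffOn.mono (fun y hy => hy.1) },
      ⟨hP, hx⟩, fun y hy => hy.2, fun y hy => hPeq hy.1⟩
  -- By injectivity each local inverse coincides with the global one. This gives at once that the
  -- image is open and that the global inverse is smooth.
  have htar : ∀ x ∈ U, ∀ φ : PartialDiffeomorph I J M N ∞, φ.source ⊆ U → EqOn f φ φ.source →
      φ.target ⊆ f '' U ∧ EqOn e.symm φ.symm φ.target := by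
    intro x _ φ hφ heq
    have h1 : ∀ z ∈ φ.target, φ.symm z ∈ U ∧ f (φ.symm z) = z := fun z hz =>
      ⟨hφ (φ.map_target hz), (heq (φ.map_target hz)).trans (φ.right_inv hz)⟩
    refine ⟨fun z hz => ⟨_, (h1 z hz).1, (h1 z hz).2⟩, fun z hz => ?_⟩
    have h2 : z ∈ e.target := ⟨_, (h1 z hz).1, (h1 z hz).2⟩
    exact hinj (e.map_target h2) (h1 z hz).1 ((e.right_inv h2).trans (h1 z hz).2.symm)
  refine ⟨{ toPartialEquiv := e
            open_source := hU
            open_target := ?_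
            contMDiffOn_toFun := fun x hx => (hf x hx).contMDiffAt.contMDiffWithinAt
            contMDiffOn_invFun := ?_ }, rfl, fun x => rfl⟩
  · refine isOpen_iff_mem_nhds.2 ?_
    rintro z ⟨x, hx, rfl⟩
    obtain ⟨φ, h1, h2, h3⟩ := key x hx
    refine Filter.mem_of_superset (φ.open_target.mem_nhds ?_) (htar x hx φ h2 h3).1
    rw [h3 h1]
    exact φ.map_source h1
  · rintro z ⟨x, hx, rfl⟩
    obtain ⟨φ, h1, h2, h3⟩ := key x hx
    have hz : f x ∈ φ.target := by
      rw [h3 h1]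
      exact φ.map_source h1
    refine ContMDiffAt.contMDiffWithinAt ?_
    have := φ.symm.contMDiffOn.contMDiffAt (φ.open_target.mem_nhds hz)
    exact this.congr_of_eventuallyEq
      (Filter.eventually_of_mem (φ.open_target.mem_nhds hz) (htar x hx φ h2 h3).2)

theorem _root_.PartialDiffeomorph.bijective_mfderiv (φ : PartialDiffeomorph I J M N ∞) {x : M}
    (hx : x ∈ φ.source) : Function.Bijective (mfderiv I J φ x) :=
  ((PartialDiffeomorph.isLocalDiffeomorphAt I J ∞ φ hx).mfderivToContinuousLinearEquiv (by simp)).bijective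

variable [I.Boundaryless] [J.Boundaryless] [IsManifold I ∞ M] [IsManifold J ∞ N]

variable (I) in
/-- The preferred chart at `x`, as a partial diffeomorphism onto an open set of the model space. -/
def chartDiffeo (x : M) : PartialDiffeomorph I 𝓘(ℝ, E) M E ∞ where
  toPartialEquiv := extChartAt I x
  open_source := isOpen_extChartAt_source x
  open_target := isOpen_extChartAt_target x
  contMDiffOn_toFun := by
    rw [extChartAt_source]
    exact contMDiffOn_extChartAt
  contMDiffOn_invFun := contMDiffOn_extChartAt_symm x

/-- The inverse function theorem on manifolds. -/
theorem isLocalDiffeomorphAt_of_mfderiv [CompleteSpace E] [CompleteSpace F] {f : M → N} {U : Set M}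
    (hU : IsOpen U) (hf : ContMDiffOn I J ∞ f U) {x : M} (hx : x ∈ U)
    (hb : Function.Bijective (mfderiv I J f x)) : IsLocalDiffeomorphAt I J ∞ f x := by
  let φ := chartDiffeo I x
  let φ' := chartDiffeo J (f x)
  have hxφ : x ∈ φ.source := mem_extChartAt_source x
  have hxφ' : f x ∈ φ'.source := mem_extChartAt_source (f x)
  let U' : Set M := U ∩ f ⁻¹' φ'.source
  have hU' : IsOpen U' := hf.continuousOn.isOpen_inter_preimage hU φ'.open_source
  let V : Set E := φ.symm.source ∩ φ.symm ⁻¹' U'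
  have hV : IsOpen V := φ.symm.contMDiffOn.continuousOn.isOpen_inter_preimage φ.symm.open_source hU'
  let g : E → F := fun y => φ' (f (φ.symm y))
  have hg : ContMDiffOn 𝓘(ℝ, E) 𝓘(ℝ, F) ∞ g V :=
    φ'.contMDiffOn.comp (hf.comp (φ.symm.contMDiffOn.mono inter_subset_left)
      (fun y hy => hy.2.1)) (fun y hy => hy.2.2)
  have hleft : φ.symm (φ x) = x := φ.left_inv hxφ
  have hxt : φ x ∈ φ.symm.source := φ.map_source hxφ
  have hxV : φ x ∈ V := ⟨hxt, by rw [mem_preimage, hleft]; exact ⟨hx, hxφ'⟩⟩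
  have hgb : Function.Bijective (fderiv ℝ g (φ x)) := by
    have h1 : MDifferentiableAt 𝓘(ℝ, E) I φ.symm (φ x) := φ.symm.mdifferentiableAt (by simp) hxt
    have h2 : MDifferentiableAt I J f (φ.symm (φ x)) := by
      rw [hleft]
      exact (hf.mdifferentiableOn (by simp) x hx).mdifferentiableAt (hU.mem_nhds hx)
    have h3 : MDifferentiableAt J 𝓘(ℝ, F) φ' (f (φ.symm (φ x))) := by
      rw [hleft]
      exact φ'.mdifferentiableAt (by simp) hxφ'
    have h4 : mfderiv 𝓘(ℝ, E) 𝓘(ℝ, F) g (φ x) = _ :=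
      (mfderiv_comp (φ x) (g := φ' ∘ f) (h3.comp (φ.symm (φ x)) h2) h1)
    rw [mfderiv_comp _ h3 h2, hleft] at h4
    rw [← mfderiv_eq_fderiv, h4]
    exact ((φ'.bijective_mfderiv hxφ').comp hb).comp (φ.symm.bijective_mfderiv hxt)
  obtain ⟨G, hG, hGeq⟩ := isLocalDiffeomorphAt_of_fderiv hV hg.contDiffOn hxV hgb
  let P := (φ.trans G).trans φ'.symm
  have hGx : G (φ x) = φ' (f x) := by
    rw [← hGeq hG]
    change φ' (f (φ.symm (φ x))) = _
    rw [hleft]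
  have hPs : IsOpen (P.source ∩ U') := P.open_source.inter hU'
  refine ⟨{ toPartialEquiv := (P.toOpenPartialHomeomorph.restrOpen U' hU').toPartialEquiv
            open_source := (P.toOpenPartialHomeomorph.restrOpen U' hU').open_source
            open_target := (P.toOpenPartialHomeomorph.restrOpen U' hU').open_target
            contMDiffOn_toFun := P.contMDiffOn.mono (fun y hy => hy.1)
            contMDiffOn_invFun := P.symm.contMDiffOn.mono (fun y hy => hy.1) }, ?_, ?_⟩
  · refine ⟨⟨⟨hxφ, hG⟩, ?_⟩, hx, hxφ'⟩
    change G (φ x) ∈ φ'.target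
    rw [hGx]
    exact φ'.map_source hxφ'
  · rintro y ⟨⟨⟨hy1, hy2⟩, hy3⟩, hy4⟩
    change f y = φ'.symm (G (φ y))
    have : g (φ y) = G (φ y) := hGeq hy2
    rw [← this]
    change f y = φ'.symm (φ' (f (φ.symm (φ y))))
    have h1 : φ.symm (φ y) = y := φ.left_inv hy1
    rw [h1]
    exact (φ'.left_inv hy4.2).symm

end Manifold

/-! ### Injectivity near a noncompact hypersurface -/

/-- A map of `(ℝ × X) × ℝ` to itself, `X` compact, that fixes the points of `{r = 0}` and is
locally injective there is injective near `{r = 0}`. -/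
theorem exists_isOpen_injOn {X : Type*} [TopologicalSpace X] [T2Space X] [CompactSpace X]
    {G : (ℝ × X) × ℝ → (ℝ × X) × ℝ} {U : Set ((ℝ × X) × ℝ)} (hU : IsOpen U)
    (hU0 : ∀ σ, (σ, (0 : ℝ)) ∈ U) (h0 : ∀ σ, G (σ, 0) = (σ, 0)) (hG : ContinuousOn G U)
    (hloc : ∀ σ, ∃ W ∈ nhds (σ, (0 : ℝ)), InjOn G W) :
    ∃ V ⊆ U, IsOpen V ∧ (∀ σ, (σ, (0 : ℝ)) ∈ V) ∧ InjOn G V := by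
  -- Compact pieces that exhaust {r = 0}. Their length 3 is chosen so that any point within distance
  -- 1 of [k, k + 1] in the u-coordinate still lies over the piece k.
  let K : ℤ → Set ((ℝ × X) × ℝ) := fun k => ((Icc (k - 1 : ℝ) (k + 2)) ×ˢ univ) ×ˢ {0}
  have hK : ∀ k, IsCompact (K k) := fun k =>
    (isCompact_Icc.prod isCompact_univ).prod isCompact_singleton
  have hcont : ∀ σ, ContinuousAt G (σ, 0) := fun σ => hG.continuousAt (hU.mem_nhds (hU0 σ))
  have hW : ∀ k, ∃ W, IsOpen W ∧ K k ⊆ W ∧ InjOn G W := by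
    intro k
    refine InjOn.exists_isOpen_superset ?_ (hK k) ?_ ?_
    · rintro ⟨σ, r⟩ ⟨_, hr⟩ ⟨τ, s⟩ ⟨_, hs⟩ h
      obtain rfl : r = 0 := hr
      obtain rfl : s = 0 := hs
      simpa [h0] using h
    · rintro ⟨σ, r⟩ ⟨_, hr⟩
      obtain rfl : r = 0 := hr
      exact hcont σ
    · rintro ⟨σ, r⟩ ⟨_, hr⟩
      obtain rfl : r = 0 := hr
      exact hloc σ
  choose W hWo hKW hWi using hW
  -- Two points of S with the same image have u-coordinates less than 1 apart, hence lie over a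
  -- common piece, where G is injective on `W k`. The interior is taken because the conditions are
  -- not all open.
  let S : Set ((ℝ × X) × ℝ) := {p | p ∈ U ∧ |(G p).1.1 - p.1.1| < 1 / 2 ∧
    ∀ k : ℤ, p.1.1 ∈ Icc (k - 1 : ℝ) (k + 2) → p ∈ W k}
  refine ⟨interior S, fun p hp => (interior_subset hp).1, isOpen_interior, ?_, ?_⟩
  · rintro ⟨u, x⟩
    rw [mem_interior_iff_mem_nhds]
    have h1 : ∀ᶠ p in nhds ((u, x), (0 : ℝ)), |(G p).1.1 - p.1.1| < 1 / 2 := by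
      have h2 : ContinuousAt (fun p : (ℝ × X) × ℝ => |(G p).1.1 - p.1.1|) ((u, x), 0) :=
        ((continuousAt_fst.comp (continuousAt_fst.comp (hcont (u, x)))).sub
          (continuousAt_fst.comp continuousAt_fst)).abs
      refine h2.eventually_lt_const ?_
      simp [h0]
    have hu : ContinuousAt (fun p : (ℝ × X) × ℝ => p.1.1) ((u, x), 0) :=
      continuousAt_fst.comp continuousAt_fst
    have h3 : ∀ᶠ p in nhds ((u, x), (0 : ℝ)), p.1.1 ∈ Ioo (u - 1) (u + 1) :=
      hu.eventually (Ioo_mem_nhds (by simp) (by simp))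
    -- Local finiteness: over a unit neighbourhood of u only finitely many pieces impose a
    -- condition. The bound 4 is generous.
    have h4 : ∀ᶠ p in nhds ((u, x), (0 : ℝ)), ∀ k ∈ Finset.Icc (⌊u⌋ - 4) (⌊u⌋ + 4),
        p.1.1 ∈ Icc (k - 1 : ℝ) (k + 2) → p ∈ W k := by
      rw [Filter.eventually_all_finset]
      intro k _
      by_cases hk : u ∈ Icc (k - 1 : ℝ) (k + 2)
      · filter_upwards [(hWo k).mem_nhds (hKW k ⟨⟨hk, mem_univ _⟩, rfl⟩)] with p hp _ using hp
      · filter_upwards [hu.eventually (isClosed_Icc.isOpen_compl.mem_nhds hk)] with p hp hp'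
          using absurd hp' hp
    filter_upwards [h1, h3, h4, hU.mem_nhds (hU0 (u, x))] with p hp1 hp3 hp4 hpU
    refine ⟨hpU, hp1, fun k hk => hp4 k ?_ hk⟩
    have h5 := Int.floor_le u
    have h6 := Int.lt_floor_add_one u
    rw [Finset.mem_Icc]
    constructor
    · have : ((⌊u⌋ - 4 : ℤ) : ℝ) ≤ k := by push_cast; linarith [hk.2, hp3.1]
      exact_mod_cast this
    · have : (k : ℝ) ≤ ((⌊u⌋ + 4 : ℤ) : ℝ) := by push_cast; linarith [hk.1, hp3.2]
      exact_mod_cast this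
  · intro p hp q hq h
    obtain ⟨-, hp1, hp2⟩ := interior_subset hp
    obtain ⟨-, hq1, hq2⟩ := interior_subset hq
    rw [h] at hp1
    rw [abs_lt] at hp1 hq1
    have h5 := Int.floor_le p.1.1
    have h6 := Int.lt_floor_add_one p.1.1
    -- The common piece is the one with k the floor of the u-coordinate of p.
    refine hWi ⌊p.1.1⌋ (hp2 _ ⟨by linarith, by linarith⟩)
      (hq2 _ ⟨by linarith [hp1.1, hq1.2], by linarith [hp1.2, hq1.1]⟩) h

/-! ### Metrics pulled back to a vector space -/

section PullForm

variable {M : Type*} [TopologicalSpace M] [ChartedSpace E4 M] [IsManifold (𝓡 4) ∞ M]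
  {E : Type*} [NormedAddCommGroup E] [NormedSpace ℝ E]

/-- The pull-back of a metric by a map of a vector space to spacetime, as a bilinear form. -/
def pullForm (g : LorentzMetric M) (Ψ : E → M) (y : E) : E →L[ℝ] E →L[ℝ] ℝ :=
  let D : E →L[ℝ] E4 := mfderiv 𝓘(ℝ, E) (𝓡 4) Ψ y
  let B : E4 →L[ℝ] E4 →L[ℝ] ℝ := g.val (Ψ y)
  B.bilinearComp D D

theorem pullForm_apply (g : LorentzMetric M) (Ψ : E → M) (y A A' : E) :
    pullForm g Ψ y A A' =
      g.form (Ψ y) (mfderiv 𝓘(ℝ, E) (𝓡 4) Ψ y A) (mfderiv 𝓘(ℝ, E) (𝓡 4) Ψ y A') := rfl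

/-- In finite dimension it is enough to test on constant vectors A, A'. The field dΨ(A) along Ψ is
the tangent map of Ψ composed with a constant section, so it is smooth, and evaluating the smooth
section g on two such fields is smooth. -/
theorem contDiffOn_pullForm [FiniteDimensional ℝ E] (g : LorentzMetric M) {Ψ : E → M} {U : Set E}
    (hU : IsOpen U) (hΨ : ContMDiffOn 𝓘(ℝ, E) (𝓡 4) ∞ Ψ U) :
    ContDiffOn ℝ ∞ (pullForm g Ψ) U := by
  have hsec : ∀ A : E, ContMDiffOn 𝓘(ℝ, E) (𝓡 4).tangent ∞
      (fun y => Bundle.TotalSpace.mk' E4 (Ψ y) (mfderiv 𝓘(ℝ, E) (𝓡 4) Ψ y A)) U := by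
    intro A
    have h1 : ContMDiff 𝓘(ℝ, E) 𝓘(ℝ, E).tangent ∞
        (fun y : E => (⟨y, A⟩ : TangentBundle 𝓘(ℝ, E) E)) :=
      contMDiff_vectorSpace_iff_contDiff.2 contDiff_const
    have h2 := hΨ.contMDiffOn_tangentMapWithin (m := ∞) (by simp) hU.uniqueMDiffOn
    have h3 := h2.comp (h1.contMDiffOn (s := U)) (fun y hy => hy)
    refine h3.congr (fun y hy => ?_)
    simp only [Function.comp, tangentMapWithin, mfderivWithin_of_isOpen hU hy]
  refine contDiffOn_clm_apply.2 fun A => contDiffOn_clm_apply.2 fun A' => ?_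
  refine ContMDiffOn.contDiffOn fun y hy => ?_
  have : ContMDiffWithinAt 𝓘(ℝ, E) ((𝓡 4).prod 𝓘(ℝ, ℝ)) ∞
      (fun y ↦ Bundle.TotalSpace.mk' ℝ (E := Bundle.Trivial M ℝ) (Ψ y)
        (pullForm g Ψ y A A')) U y := by
    apply ContMDiffWithinAt.clm_bundle_apply₂ (F₁ := E4) (F₂ := E4)
    · exact ContMDiffAt.comp_contMDiffWithinAt y g.smooth.contMDiffAt (hΨ y hy)
    · exact hsec A y hy
    · exact hsec A' y hy
  simp only [Bundle.contMDiffWithinAt_totalSpace] at this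
  exact this.2

end PullForm

/-! ### Differentials of the spacetime coordinates; the splitting by the rigging -/

/-- Model with corners of `Σ × ℝ`. -/
abbrev IN : ModelWithCorners ℝ ((ℝ × E2) × ℝ) (ModelProd (ModelProd ℝ E2) ℝ) := IS.prod 𝓘(ℝ, ℝ)

section Coords

variable {M : Type*} [TopologicalSpace M] [ChartedSpace E4 M]

namespace Coords

variable (C : Coords M)

/-- The differential of the spacetime coordinate system. -/
def dψ (p : Sig × ℝ) : (ℝ × E2) × ℝ →L[ℝ] E4 := mfderiv IN (𝓡 4) C.ψ p

/-- The differential of the embedding of the hypersurface. -/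
def DΦ (σ : Sig) : ℝ × E2 →L[ℝ] E4 := C.dΦ σ

/-- The rigging, as an element of the model space. -/
def ell (σ : Sig) : E4 := C.rigging σ

theorem mdifferentiableAt_ψ {p : Sig × ℝ} (hp : p ∈ C.ψ.source) :
    MDifferentiableAt IN (𝓡 4) C.ψ p :=
  C.ψ.mdifferentiableAt (by simp) hp

theorem bijective_dψ {p : Sig × ℝ} (hp : p ∈ C.ψ.source) : Function.Bijective (C.dψ p) :=
  C.ψ.bijective_mfderiv hp

/-- Stated for every r in the domain, not only r = 0, because the component `Y` of the data
differentiates these slice differentials in r. -/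
theorem mfderiv_ψ_left {σ : Sig} {r : ℝ} (h : (σ, r) ∈ C.ψ.source) (X : TangentSpace IS σ) :
    (mfderiv IS (𝓡 4) (fun τ : Sig => C.ψ (τ, r)) σ X : E4) = C.dψ (σ, r) (X, 0) := by
  have h1 : MDifferentiableAt IS IN (fun τ : Sig => (τ, r)) σ :=
    mdifferentiableAt_id.prodMk mdifferentiableAt_const
  have h2 := mfderiv_comp_apply σ (C.mdifferentiableAt_ψ h) h1 X
  rw [mfderiv_prod_left] at h2
  exact h2

theorem DΦ_apply (σ : Sig) (X : ℝ × E2) : C.DΦ σ X = C.dψ (σ, 0) (X, 0) :=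
  C.mfderiv_ψ_left (C.zero_mem σ) X

theorem ell_eq (σ : Sig) : C.ell σ = C.dψ (σ, 0) (0, 1) := by
  have h1 : MDifferentiableAt 𝓘(ℝ, ℝ) IN (fun r : ℝ => (σ, r)) 0 :=
    mdifferentiableAt_const.prodMk mdifferentiableAt_id
  have h2 := mfderiv_comp_apply (0 : ℝ) (C.mdifferentiableAt_ψ (C.zero_mem σ)) h1 (1 : ℝ)
  rw [mfderiv_prod_right] at h2
  exact h2

theorem contMDiff_Φ : ContMDiff IS (𝓡 4) ∞ C.Φ := fun σ =>
  (C.ψ.contMDiffOn.contMDiffAt (C.ψ.open_source.mem_nhds (C.zero_mem σ))).comp σ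
    (contMDiffAt_id.prodMk contMDiffAt_const)

theorem Φ_injective : Function.Injective C.Φ := fun σ τ h =>
  congrArg Prod.fst (C.ψ.injOn (C.zero_mem σ) (C.zero_mem τ) h)

theorem mdifferentiableAt_Φ (σ : Sig) : MDifferentiableAt IS (𝓡 4) C.Φ σ :=
  (C.contMDiff_Φ σ).mdifferentiableAt (by simp)

theorem Φ_mem_target (σ : Sig) : C.Φ σ ∈ C.ψ.target := C.ψ.map_source (C.zero_mem σ)

theorem ψ_symm_Φ (σ : Sig) : C.ψ.symm (C.Φ σ) = (σ, 0) := C.ψ.left_inv (C.zero_mem σ)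

theorem DΦ_injective (σ : Sig) : Function.Injective (C.DΦ σ) := by
  intro X X' h
  rw [C.DΦ_apply, C.DΦ_apply] at h
  exact congrArg Prod.fst ((C.bijective_dψ (C.zero_mem σ)).1 h)

theorem dψ_zero_apply (σ : Sig) (A : ℝ × E2) (t : ℝ) :
    C.dψ (σ, 0) (A, t) = t • C.ell σ + C.DΦ σ A := by
  rw [C.ell_eq, C.DΦ_apply, ← map_smul, ← map_add]
  simp

/-- Spacetime vectors are sums of a tangent vector of the hypersurface and a multiple of the
rigging. -/
theorem exists_decomp (σ : Sig) (X : E4) :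
    ∃ (t : ℝ) (A : ℝ × E2), X = t • C.ell σ + C.DΦ σ A := by
  obtain ⟨⟨A, t⟩, h⟩ := (C.bijective_dψ (C.zero_mem σ)).2 X
  exact ⟨t, A, h.symm.trans (C.dψ_zero_apply σ A t)⟩

end Coords

end Coords

/-! ### Charts of Σ given by charts of the sphere -/

section Slab

/-- The parametrization of `Σ` by `u` and by coordinates of the sphere. -/
def slab (c : OpenPartialHomeomorph S2 E2) (z : ℝ × E2) : Sig := (z.1, c.symm z.2)

/-- The differential of the parametrization of the sphere by a chart. -/
def dchart (c : OpenPartialHomeomorph S2 E2) (y : E2) : E2 →L[ℝ] E2 :=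
  mfderiv (𝓡 2) (𝓡 2) c.symm y

/-- The differential of `slab c`. -/
def dslab (c : OpenPartialHomeomorph S2 E2) (z : ℝ × E2) : ℝ × E2 →L[ℝ] ℝ × E2 :=
  mfderiv 𝓘(ℝ, ℝ × E2) IS (slab c) z

variable {c : OpenPartialHomeomorph S2 E2}

theorem isOpen_slab (c : OpenPartialHomeomorph S2 E2) : IsOpen ((univ : Set ℝ) ×ˢ c.target) :=
  isOpen_univ.prod c.open_target

theorem contMDiffOn_slab (hc : c ∈ IsManifold.maximalAtlas (𝓡 2) ∞ S2) :
    ContMDiffOn 𝓘(ℝ, ℝ × E2) IS ∞ (slab c) (univ ×ˢ c.target) :=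
  contDiff_fst.contMDiff.contMDiffOn.prodMk
    ((contMDiffOn_symm_of_mem_maximalAtlas hc).comp contDiff_snd.contMDiff.contMDiffOn
      (fun _ hz => hz.2))

theorem mdifferentiableAt_slab (hc : c ∈ IsManifold.maximalAtlas (𝓡 2) ∞ S2) {z : ℝ × E2}
    (hz : z.2 ∈ c.target) : MDifferentiableAt 𝓘(ℝ, ℝ × E2) IS (slab c) z :=
  ((contMDiffOn_slab hc).mdifferentiableOn (by simp) z ⟨mem_univ _, hz⟩).mdifferentiableAt
    ((isOpen_slab c).mem_nhds ⟨mem_univ _, hz⟩)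

theorem dslab_apply (hc : c ∈ IsManifold.maximalAtlas (𝓡 2) ∞ S2) {z : ℝ × E2}
    (hz : z.2 ∈ c.target) (A : ℝ × E2) :
    dslab c z A = (A.1, dchart c z.2 A.2) := by
  have h1 : MDifferentiableAt 𝓘(ℝ, ℝ × E2) 𝓘(ℝ, ℝ) (fun z : ℝ × E2 => z.1) z :=
    differentiableAt_fst.mdifferentiableAt
  have h2 : MDifferentiableAt 𝓘(ℝ, ℝ × E2) 𝓘(ℝ, E2) (fun z : ℝ × E2 => z.2) z :=
    differentiableAt_snd.mdifferentiableAt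
  have h3 : MDifferentiableAt (𝓡 2) (𝓡 2) c.symm z.2 :=
    ((contMDiffOn_symm_of_mem_maximalAtlas hc).mdifferentiableOn (by simp) _ hz).mdifferentiableAt
      (c.open_target.mem_nhds hz)
  have h4 := mfderiv_prodMk (x := z) h1 (h3.comp z h2)
  have h5 : mfderiv 𝓘(ℝ, ℝ × E2) 𝓘(ℝ, ℝ) (fun z : ℝ × E2 => z.1) z A = A.1 := by
    rw [mfderiv_eq_fderiv, fderiv_fst]
    rfl
  have h6 : mfderiv 𝓘(ℝ, ℝ × E2) 𝓘(ℝ, E2) (fun z : ℝ × E2 => z.2) z A = A.2 := by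
    rw [mfderiv_eq_fderiv, fderiv_snd]
    rfl
  have h7 := mfderiv_comp_apply z h3 h2 A
  rw [h6] at h7
  have h8 : mfderiv 𝓘(ℝ, ℝ × E2) IS (slab c) z A =
      (mfderiv 𝓘(ℝ, ℝ × E2) 𝓘(ℝ, ℝ) (fun z : ℝ × E2 => z.1) z A,
       mfderiv 𝓘(ℝ, ℝ × E2) (𝓡 2) (c.symm ∘ fun z : ℝ × E2 => z.2) z A) := by
    exact congrArg (fun L : (ℝ × E2) →L[ℝ] (ℝ × E2) => L A) h4
  exact h8.trans (congrArg₂ Prod.mk h5 h7)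

theorem bijective_dchart (hc : c ∈ IsManifold.maximalAtlas (𝓡 2) ∞ S2) {y : E2}
    (hy : y ∈ c.target) : Function.Bijective (dchart c y) := by
  let P : PartialDiffeomorph (𝓡 2) (𝓡 2) E2 S2 ∞ :=
    { toPartialEquiv := c.symm.toPartialEquiv
      open_source := c.open_target
      open_target := c.open_source
      contMDiffOn_toFun := contMDiffOn_symm_of_mem_maximalAtlas hc
      contMDiffOn_invFun := contMDiffOn_of_mem_maximalAtlas hc }
  exact P.bijective_mfderiv hy

theorem exists_chart (x : S2) : ∃ c ∈ IsManifold.maximalAtlas (𝓡 2) ∞ S2, ∃ y ∈ c.target,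
    c.symm y = x :=
  ⟨chartAt E2 x, IsManifold.chart_mem_maximalAtlas x, chartAt E2 x x, mem_chart_target E2 x,
    (chartAt E2 x).left_inv (mem_chart_source E2 x)⟩

end Slab

theorem _root_.DifferentiableAt.bilin_line {E G : Type*} [NormedAddCommGroup E] [NormedSpace ℝ E]
    [NormedAddCommGroup G] [NormedSpace ℝ G] {B : ℝ × E → G →L[ℝ] G →L[ℝ] ℝ} {s : ℝ}
    {y : E} (h : DifferentiableAt ℝ B (s, y)) (A A' : G) :
    DifferentiableAt ℝ (fun s => B (s, y) A A') s := by
  have h1 : DifferentiableAt ℝ (fun s : ℝ => (s, y)) s :=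
    differentiableAt_id.prodMk (differentiableAt_const _)
  have h3 : DifferentiableAt ℝ (fun s : ℝ => B (s, y)) s :=
    DifferentiableAt.comp (f := fun s : ℝ => (s, y)) (g := B) s h h1
  exact (h3.clm_apply (differentiableAt_const _)).clm_apply (differentiableAt_const _)

/-! ### Linear algebra of gauge-fixed null data -/

section Data

variable {M : Type*} [TopologicalSpace M] [ChartedSpace E4 M] [IsManifold (𝓡 4) ∞ M]

/-- Nondegeneracy, read off from an orthogonal basis whose vectors have norm ±1. -/
theorem LorentzMetric.eq_zero_of_form (g : LorentzMetric M) {p : M} {X : TangentSpace (𝓡 4) p}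
    (h : ∀ X', g.form p X X' = 0) : X = 0 := by
  obtain ⟨b, hb⟩ := g.signature p
  refine b.ext_elem fun i => ?_
  have h1 : g.val p X (b i) = b.repr X i * g.val p (b i) (b i) := by
    conv_lhs => rw [← b.sum_repr X]
    rw [map_sum, sum_apply, Finset.sum_eq_single i]
    · simp
    · intro j _ hj
      simp [hb, hj]
    · simp
  have h2 : g.val p X (b i) = 0 := h (b i)
  rw [h2, hb i i, if_pos rfl] at h1
  have h3 : b.repr X i = 0 := by
    split_ifs at h1
    · linarith
    · linarith
  rw [h3]
  simp

namespace Coords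

variable (C : Coords M) (g : LorentzMetric M)

/-- The metric at a point of the hypersurface. -/
def gram (σ : Sig) : E4 →L[ℝ] E4 →L[ℝ] ℝ := g.val (C.Φ σ)

/-- The first fundamental form, as a bilinear form. -/
def gammaForm (σ : Sig) : (ℝ × E2) →L[ℝ] (ℝ × E2) →L[ℝ] ℝ :=
  (C.gram g σ).bilinearComp (C.DΦ σ) (C.DΦ σ)

/-- The metric `q`, as a bilinear form. -/
def qForm (x : S2) : E2 →L[ℝ] E2 →L[ℝ] ℝ :=
  (C.gammaForm g (0, x)).bilinearComp (ContinuousLinearMap.inr ℝ ℝ E2)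
    (ContinuousLinearMap.inr ℝ ℝ E2)

variable {C g}

theorem gammaForm_symm (σ : Sig) (X X' : ℝ × E2) :
    C.gammaForm g σ X X' = C.gammaForm g σ X' X := g.symm _ _ _

theorem qForm_symm (x : S2) (v w : E2) : C.qForm g x v w = C.qForm g x w v := g.symm _ _ _

theorem gammaForm_eq (hg : (C.data g.form).IsGaugeFixed) (σ : Sig) (X X' : ℝ × E2) :
    C.gammaForm g σ X X' = C.gammaForm g σ (0, X.2) (0, X'.2) := by
  have h0 : ∀ Z : ℝ × E2, C.gammaForm g σ (1, 0) Z = 0 := fun Z => hg.γ_n σ Z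
  have h1 : ∀ Z : ℝ × E2, Z = Z.1 • ((1 : ℝ), (0 : E2)) + (0, Z.2) := fun Z => by
    ext <;> simp
  have h2 : ∀ Z Z' : ℝ × E2, C.gammaForm g σ Z Z' = C.gammaForm g σ (0, Z.2) Z' := fun Z Z' => by
    calc C.gammaForm g σ Z Z' = C.gammaForm g σ (Z.1 • ((1 : ℝ), (0 : E2)) + (0, Z.2)) Z' :=
          congrArg (fun z => C.gammaForm g σ z Z') (h1 Z)
      _ = Z.1 • C.gammaForm g σ (1, 0) Z' + C.gammaForm g σ (0, Z.2) Z' := by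
          rw [map_add, map_smul]
          rfl
      _ = C.gammaForm g σ (0, Z.2) Z' := by rw [h0, smul_zero, zero_add]
  rw [h2, gammaForm_symm, h2, gammaForm_symm]

theorem gram_ell_DΦ (hg : (C.data g.form).IsGaugeFixed) (σ : Sig) (X : ℝ × E2) :
    C.gram g σ (C.ell σ) (C.DΦ σ X) = X.1 := by
  have h0 : C.gram g σ (C.ell σ) (C.DΦ σ (1, 0)) = 1 := hg.form_n σ
  have h1 : C.gram g σ (C.ell σ) (C.DΦ σ (0, X.2)) = 0 := hg.form_sph σ X.2
  have h2 : X = X.1 • ((1 : ℝ), (0 : E2)) + (0, X.2) := by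
    ext <;> simp
  calc C.gram g σ (C.ell σ) (C.DΦ σ X)
      = C.gram g σ (C.ell σ) (C.DΦ σ (X.1 • ((1 : ℝ), (0 : E2)) + (0, X.2))) :=
        congrArg (fun z => C.gram g σ (C.ell σ) (C.DΦ σ z)) h2
    _ = X.1 := by
        rw [map_add, map_smul, map_add, map_smul, h0, h1, smul_eq_mul, mul_one, add_zero]

theorem gram_symm (σ : Sig) (X X' : E4) : C.gram g σ X X' = C.gram g σ X' X := g.symm _ _ _

theorem gram_ell_ell (hg : (C.data g.form).IsGaugeFixed) (σ : Sig) :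
    C.gram g σ (C.ell σ) (C.ell σ) = 0 := hg.norm_zero σ

theorem form_eq (hg : (C.data g.form).IsGaugeFixed) (σ : Sig) (X : TangentSpace IS σ) :
    (C.data g.form).form σ X = X.1 := gram_ell_DΦ hg σ X

/-- The radical of γ is no larger than the line of n. The sphere part of X is orthogonal to TΣ by
hypothesis and to ℓ because ℓ_M = 0, so it is orthogonal to everything and g is nondegenerate. -/
theorem eq_zero_of_gammaForm (hg : (C.data g.form).IsGaugeFixed) {σ : Sig} {X : ℝ × E2}
    (h : ∀ X', C.gammaForm g σ X X' = 0) : X.2 = 0 := by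
  have h1 : C.DΦ σ (0, X.2) = 0 := by
    refine g.eq_zero_of_form (p := C.Φ σ) fun Z => ?_
    change C.gram g σ (C.DΦ σ (0, X.2)) Z = 0
    obtain ⟨t, A, rfl⟩ := C.exists_decomp σ Z
    have h3 : C.gram g σ (C.DΦ σ (0, X.2)) (C.DΦ σ A) = 0 := by
      have h4 : C.gammaForm g σ (0, X.2) A = 0 := by
        rw [gammaForm_eq hg, ← gammaForm_eq hg σ X A, h]
      exact h4
    rw [map_add, map_smul, gram_symm, gram_ell_DΦ hg, h3]
    simp
  have h2 : ((0, X.2) : ℝ × E2) = 0 := C.DΦ_injective σ (by rw [h1, map_zero])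
  exact congrArg Prod.snd h2

theorem eq_zero_of_qForm (hg : (C.data g.form).IsGaugeFixed) {x : S2} {v : E2}
    (h : ∀ w, C.qForm g x v w = 0) : v = 0 :=
  eq_zero_of_gammaForm hg (σ := (0, x)) (X := (0, v)) fun X' => by
    rw [gammaForm_eq hg]
    exact h X'.2

theorem qForm_bijective (hg : (C.data g.form).IsGaugeFixed) (x : S2) :
    Function.Bijective (C.qForm g x) := by
  have h1 : Function.Injective (C.qForm g x) := by
    rw [injective_iff_map_eq_zero]
    intro v hv
    exact eq_zero_of_qForm hg fun w => by rw [hv]; rfl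
  refine ⟨h1, ?_⟩
  have h2 : Module.finrank ℝ E2 = Module.finrank ℝ (E2 →L[ℝ] ℝ) := by
    rw [← (LinearMap.toContinuousLinearMap (𝕜 := ℝ) (E := E2) (F' := ℝ)).finrank_eq,
      Module.finrank_linearMap, Module.finrank_self, mul_one]
  exact (LinearMap.injective_iff_surjective_of_finrank_eq_finrank
    (f := (C.qForm g x : E2 →ₗ[ℝ] E2 →L[ℝ] ℝ)) h2).1 h1

/-- The first fundamental form of `h` in the coordinates of `slab c`. -/
theorem pullForm_slab_apply {c : OpenPartialHomeomorph S2 E2}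
    (hc : c ∈ IsManifold.maximalAtlas (𝓡 2) ∞ S2) {z : ℝ × E2} (hz : z.2 ∈ c.target)
    (A A' : ℝ × E2) :
    pullForm g (fun z => C.Φ (slab c z)) z A A' =
      C.gammaForm g (slab c z) (dslab c z A) (dslab c z A') := by
  have h := fun A => mfderiv_comp_apply z (C.mdifferentiableAt_Φ _) (mdifferentiableAt_slab hc hz) A
  rw [pullForm_apply]
  exact congrArg₂ (fun a b : E4 => C.gram g (slab c z) a b) (h A) (h A')

theorem contDiffOn_pullForm_slab {c : OpenPartialHomeomorph S2 E2}
    (hc : c ∈ IsManifold.maximalAtlas (𝓡 2) ∞ S2) :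
    ContDiffOn ℝ ∞ (pullForm g (fun z => C.Φ (slab c z))) (univ ×ˢ c.target) :=
  contDiffOn_pullForm g (isOpen_slab c) (C.contMDiff_Φ.comp_contMDiffOn (contMDiffOn_slab hc))

/-- Here Θ = 0 enters: γ on fixed sphere vectors has zero u-derivative, so it equals its value at u
= 0. -/
theorem gammaForm_eq_qForm (hg : (C.data g.form).IsGaugeFixed)
    (hne : (C.data g.form).IsNonExpanding) (σ : Sig) (X X' : ℝ × E2) :
    C.gammaForm g σ X X' = C.qForm g σ.2 X.2 X'.2 := by
  obtain ⟨u, x⟩ := σ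
  rw [gammaForm_eq hg]
  generalize X.2 = v
  generalize X'.2 = w
  obtain ⟨c, hc, y, hy, hx⟩ := exists_chart x
  obtain ⟨v', hv'⟩ := (bijective_dchart hc hy).2 v
  obtain ⟨w', hw'⟩ := (bijective_dchart hc hy).2 w
  have h1 : ∀ s : ℝ, C.gammaForm g (s, x) (0, v) (0, w) =
      pullForm g (fun z => C.Φ (slab c z)) (s, y) (0, v') (0, w') := by
    intro s
    have hs : slab c (s, y) = (s, x) := Prod.ext rfl hx
    rw [pullForm_slab_apply (z := (s, y)) hc hy, dslab_apply (z := (s, y)) hc hy,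
      dslab_apply (z := (s, y)) hc hy, hs]
    dsimp only
    rw [hv', hw']
  -- A vanishing `deriv` says nothing about a nondifferentiable function, so smoothness in u is
  -- first established in a chart.
  have hdiff : Differentiable ℝ fun s : ℝ => C.gammaForm g (s, x) (0, v) (0, w) := by
    intro s
    have h2 := ((contDiffOn_pullForm_slab (C := C) (g := g) hc).contDiffAt
      ((isOpen_slab c).mem_nhds (show (s, y) ∈ _ from ⟨mem_univ _, hy⟩))).differentiableAt
      (by simp)
    rw [funext h1]
    exact h2.bilin_line _ _
  refine is_const_of_deriv_eq_zero hdiff (fun s => ?_) u 0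
  have h5 : (1 / 2 : ℝ) * deriv
      (fun s : ℝ => C.gammaForm g (s, x) (0, v) (0, w)) s = 0 := hne s x v w
  linarith

end Coords

end Data

/-! ### Maps of Σ and of the sphere -/

/-- The differential of a map of `Σ`. -/
def dmap (ζ : Sig → Sig) (σ : Sig) : ℝ × E2 →L[ℝ] ℝ × E2 := mfderiv IS IS ζ σ

/-- The differential of a map of the sphere. -/
def dsph (Y : S2 → S2) (x : S2) : E2 →L[ℝ] E2 := mfderiv (𝓡 2) (𝓡 2) Y x

/-- The map `(u, x) ↦ (f(u, x), Y(x))`. -/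
def pairMap (f : Sig → ℝ) (Y : S2 → S2) (σ : Sig) : Sig := (f σ, Y σ.2)

theorem contMDiff_pairMap {f : Sig → ℝ} {Y : S2 → S2} (hf : ContMDiff IS 𝓘(ℝ, ℝ) ∞ f)
    (hY : ContMDiff (𝓡 2) (𝓡 2) ∞ Y) : ContMDiff IS IS ∞ (pairMap f Y) :=
  hf.prodMk (hY.comp contMDiff_snd)

theorem dfun_apply {f : Sig → ℝ} {σ : Sig} (hf : MDifferentiableAt IS 𝓘(ℝ, ℝ) f σ) (X : ℝ × E2) :
    dfun f σ X = fu f σ * X.1 + dS f σ.1 σ.2 X.2 := by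
  have h := mfderiv_prod_eq_add_apply (v := X) hf
  have h1 : mfderiv 𝓘(ℝ, ℝ) 𝓘(ℝ, ℝ) (fun s : ℝ => f (s, σ.2)) σ.1 X.1 = fu f σ * X.1 := by
    have h2 : fderiv ℝ (fun s : ℝ => f (s, σ.2)) σ.1 X.1 =
        X.1 • deriv (fun s : ℝ => f (s, σ.2)) σ.1 := fderiv_eq_smul_deriv _
    rw [mfderiv_eq_fderiv]
    exact h2.trans (mul_comm _ _)
  exact h.trans (congrArg (· + dS f σ.1 σ.2 X.2) h1)

theorem dmap_pairMap {f : Sig → ℝ} {Y : S2 → S2} {σ : Sig}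
    (hf : MDifferentiableAt IS 𝓘(ℝ, ℝ) f σ) (hY : MDifferentiableAt (𝓡 2) (𝓡 2) Y σ.2)
    (X : ℝ × E2) :
    dmap (pairMap f Y) σ X = (fu f σ * X.1 + dS f σ.1 σ.2 X.2, dsph Y σ.2 X.2) := by
  have h2 : MDifferentiableAt IS (𝓡 2) (fun τ : Sig => τ.2) σ := mdifferentiableAt_snd
  have h3 := mfderiv_prodMk hf (hY.comp σ h2)
  have h4 := mfderiv_comp_apply σ hY h2 X
  have h6 : mfderiv IS (𝓡 2) (fun τ : Sig => τ.2) σ X = X.2 :=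
    congrArg (fun L : ℝ × E2 →L[ℝ] E2 => L X) mfderiv_snd
  rw [h6] at h4
  have h5 : dmap (pairMap f Y) σ X =
      (dfun f σ X, mfderiv IS (𝓡 2) (Y ∘ fun τ : Sig => τ.2) σ X) :=
    congrArg (fun L : ℝ × E2 →L[ℝ] ℝ × E2 => L X) h3
  exact h5.trans (congrArg₂ Prod.mk (dfun_apply hf X) h4)

/-- The embedding of the sphere in Euclidean space reduces this to the constancy theorem for
vector-valued functions of a real variable. -/
theorem eq_of_mfderiv_eq_zero {h : ℝ → S2} (hd : MDifferentiable 𝓘(ℝ, ℝ) (𝓡 2) h)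
    (h0 : ∀ s, mfderiv 𝓘(ℝ, ℝ) (𝓡 2) h s (1 : ℝ) = 0) (s t : ℝ) : h s = h t := by
  have hc : ∀ x : S2, MDifferentiableAt (𝓡 2) 𝓘(ℝ, EuclideanSpace ℝ (Fin 3))
      ((↑) : S2 → EuclideanSpace ℝ (Fin 3)) x := fun x =>
    (contMDiff_coe_sphere (n := 2) (m := 1) x).mdifferentiableAt (by simp)
  have h1 : ∀ s, MDifferentiableAt 𝓘(ℝ, ℝ) 𝓘(ℝ, EuclideanSpace ℝ (Fin 3))
      (((↑) : S2 → EuclideanSpace ℝ (Fin 3)) ∘ h) s := fun s => (hc (h s)).comp s (hd s)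
  refine Subtype.ext (is_const_of_deriv_eq_zero
    (f := ((↑) : S2 → EuclideanSpace ℝ (Fin 3)) ∘ h) (fun s => (h1 s).differentiableAt)
    (fun s => ?_) s t)
  have h2 := mfderiv_comp_apply s (hc (h s)) (hd s) (1 : ℝ)
  rw [h0 s, map_zero, mfderiv_eq_fderiv] at h2
  rw [← fderiv_apply_one_eq_deriv]
  exact h2

/-! ### The map of Σ induced by a symmetry -/

section Symmetry

variable {M : Type*} [TopologicalSpace M] [ChartedSpace E4 M]

/-- The differential of a map of spacetime. -/
def dspt (F : M → M) (p : M) : E4 →L[ℝ] E4 := mfderiv (𝓡 4) (𝓡 4) F p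

variable {C : Coords M} {F : PartialDiffeomorph (𝓡 4) (𝓡 4) M M ∞} {ζ : Sig → Sig}

theorem mem_source_of_subset (hs : C.H ⊆ F.source) (σ : Sig) : C.Φ σ ∈ F.source :=
  hs (mem_range_self σ)

/-- This formula gives both the uniqueness and the smoothness of the induced map. -/
theorem eq_of_intertwines (hζ : ∀ σ, F (C.Φ σ) = C.Φ (ζ σ)) :
    ζ = fun σ => (C.ψ.symm (F (C.Φ σ))).1 := by
  funext σ
  rw [hζ, C.ψ_symm_Φ]

theorem contMDiff_of_intertwines (hs : C.H ⊆ F.source) (hζ : ∀ σ, F (C.Φ σ) = C.Φ (ζ σ)) :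
    ContMDiff IS IS ∞ ζ := by
  rw [eq_of_intertwines hζ]
  intro σ
  have h1 : ContMDiffAt (𝓡 4) (𝓡 4) ∞ F (C.Φ σ) :=
    F.contMDiffOn.contMDiffAt (F.open_source.mem_nhds (mem_source_of_subset hs σ))
  have h2 : ContMDiffAt (𝓡 4) IN ∞ C.ψ.symm (F (C.Φ σ)) := by
    rw [hζ]
    exact C.ψ.symm.contMDiffOn.contMDiffAt (C.ψ.open_target.mem_nhds (C.Φ_mem_target _))
  have h3 : ContMDiffAt IS IN ∞ (fun σ => C.ψ.symm (F (C.Φ σ))) σ :=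
    h2.comp σ (h1.comp σ (C.contMDiff_Φ σ))
  exact contMDiffAt_fst.comp σ h3

theorem dspt_DΦ (hs : C.H ⊆ F.source) (hζ : ∀ σ, F (C.Φ σ) = C.Φ (ζ σ)) (σ : Sig) (X : ℝ × E2) :
    dspt F (C.Φ σ) (C.DΦ σ X) = C.DΦ (ζ σ) (dmap ζ σ X) := by
  have h1 := mfderiv_comp_apply σ (F.mdifferentiableAt (by simp) (mem_source_of_subset hs σ))
    (C.mdifferentiableAt_Φ σ) X
  have h2 := mfderiv_comp_apply σ (C.mdifferentiableAt_Φ (ζ σ))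
    ((contMDiff_of_intertwines hs hζ).mdifferentiableAt (x := σ) (by simp)) X
  have h3 : F ∘ C.Φ = C.Φ ∘ ζ := funext hζ
  rw [h3] at h1
  exact h1.symm.trans h2

theorem dspt_bijective (hs : C.H ⊆ F.source) (σ : Sig) :
    Function.Bijective (dspt F (C.Φ σ)) :=
  F.bijective_mfderiv (mem_source_of_subset hs σ)

theorem dmap_bijective (hs : C.H ⊆ F.source) (hζ : ∀ σ, F (C.Φ σ) = C.Φ (ζ σ)) (σ : Sig) :
    Function.Bijective (dmap ζ σ) := by
  have h1 : Function.Injective (dmap ζ σ) := by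
    intro X X' h
    refine C.DΦ_injective σ ((dspt_bijective hs σ).1 ?_)
    rw [dspt_DΦ hs hζ, dspt_DΦ hs hζ, h]
  exact ⟨h1, (LinearMap.injective_iff_surjective (f := (dmap ζ σ : ℝ × E2 →ₗ[ℝ] ℝ × E2))).1 h1⟩

variable [IsManifold (𝓡 4) ∞ M] {g : LorentzMetric M}

/-- Supplies the smooth inverse of the induced maps. The metric condition for the inverse follows
from that for F at the preimage, since the two differentials cancel. -/
theorem IsHypersurfaceSymmetry.symm (hF : IsHypersurfaceSymmetry g.form C F) :
    IsHypersurfaceSymmetry g.form C F.symm := by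
  have h1 : C.H ⊆ F.target := by
    rw [← hF.image_eq]
    rintro _ ⟨p, hp, rfl⟩
    exact F.map_source (hF.subset_source hp)
  have h2 : F.symm '' C.H = C.H := by
    conv_lhs => rw [← hF.image_eq]
    rw [image_image]
    have : ∀ p ∈ C.H, F.symm (F p) = id p := fun p hp => F.left_inv (hF.subset_source hp)
    rw [image_congr this, image_id]
  refine ⟨h1, h2, fun p hp X X' => ?_⟩
  have hp' : F.symm p ∈ C.H := h2 ▸ mem_image_of_mem _ hp
  have h3 : F (F.symm p) = p := F.right_inv (h1 hp)
  have h5 : ∀ X : E4, dspt F (F.symm p) (dspt F.symm p X) = X := by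
    intro X
    have h6 := mfderiv_comp_apply p (F.mdifferentiableAt (by simp) (hF.subset_source hp'))
      (F.symm.mdifferentiableAt (by simp) (h1 hp)) X
    have h7 : F ∘ F.symm =ᶠ[nhds p] id :=
      Filter.eventually_of_mem (F.open_target.mem_nhds (h1 hp)) fun q hq => F.right_inv hq
    rw [h7.mfderiv_eq, mfderiv_id] at h6
    exact h6.symm
  let gv : M → E4 →L[ℝ] E4 →L[ℝ] ℝ := fun p => g.val p
  have key : ∀ X X' : E4, gv (F.symm p) (dspt F.symm p X) (dspt F.symm p X') = gv p X X' := by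
    intro X X'
    have h8 : gv (F (F.symm p)) (dspt F (F.symm p) (dspt F.symm p X))
        (dspt F (F.symm p) (dspt F.symm p X')) =
        gv (F.symm p) (dspt F.symm p X) (dspt F.symm p X') :=
      hF.metric_eq _ hp' (dspt F.symm p X) (dspt F.symm p X')
    rw [h5, h5, h3] at h8
    exact h8.symm
  exact key X X'

theorem isHypersurfaceSymmetry_iff (hs : C.H ⊆ F.source) (hζ : ∀ σ, F (C.Φ σ) = C.Φ (ζ σ))
    (hsurj : Function.Surjective ζ) :
    IsHypersurfaceSymmetry g.form C F ↔ ∀ σ X X',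
      C.gram g (ζ σ) (dspt F (C.Φ σ) X) (dspt F (C.Φ σ) X') = C.gram g σ X X' := by
  let gv : M → E4 →L[ℝ] E4 →L[ℝ] ℝ := fun p => g.val p
  have h1 : ∀ σ, gv (F (C.Φ σ)) = C.gram g (ζ σ) := fun σ => by rw [hζ]; rfl
  constructor
  · intro hF σ X X'
    have h2 : gv (F (C.Φ σ)) (dspt F (C.Φ σ) X) (dspt F (C.Φ σ) X') = C.gram g σ X X' :=
      hF.metric_eq _ (mem_range_self σ) X X'
    rwa [h1] at h2
  · intro h
    refine ⟨hs, ?_, ?_⟩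
    · ext p
      constructor
      · rintro ⟨_, ⟨σ, rfl⟩, rfl⟩
        exact ⟨ζ σ, (hζ σ).symm⟩
      · rintro ⟨τ, rfl⟩
        obtain ⟨σ, rfl⟩ := hsurj τ
        exact ⟨_, mem_range_self σ, hζ σ⟩
    · rintro _ ⟨σ, rfl⟩ X X'
      have h2 : gv (F (C.Φ σ)) (dspt F (C.Φ σ) X) (dspt F (C.Φ σ) X') = C.gram g σ X X' := by
        rw [h1]
        exact h σ X X'
      exact h2

/-- The map of `Σ` that a symmetry induces. -/
theorem IsHypersurfaceSymmetry.exists_map (hF : IsHypersurfaceSymmetry g.form C F) :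
    ∃ ζ : Sig → Sig, (∀ σ, F (C.Φ σ) = C.Φ (ζ σ)) ∧ Function.Bijective ζ := by
  have h1 : ∀ σ, ∃ τ, F (C.Φ σ) = C.Φ τ := fun σ => by
    have : F (C.Φ σ) ∈ C.H := hF.image_eq ▸ mem_image_of_mem _ (mem_range_self σ)
    obtain ⟨τ, hτ⟩ := this
    exact ⟨τ, hτ.symm⟩
  choose ζ hζ using h1
  refine ⟨ζ, hζ, ?_, ?_⟩
  · intro σ τ h
    refine C.Φ_injective (F.injOn (mem_source_of_subset hF.subset_source σ)
      (mem_source_of_subset hF.subset_source τ) ?_)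
    rw [hζ, hζ, h]
  · intro τ
    have : C.Φ τ ∈ F '' C.H := by
      rw [hF.image_eq]
      exact mem_range_self τ
    obtain ⟨_, ⟨σ, rfl⟩, h⟩ := this
    exact ⟨σ, C.Φ_injective ((hζ σ).symm.trans h)⟩

theorem IsHypersurfaceSymmetry.gram_eq (hF : IsHypersurfaceSymmetry g.form C F)
    (hζ : ∀ σ, F (C.Φ σ) = C.Φ (ζ σ)) (σ : Sig) (X X' : E4) :
    C.gram g (ζ σ) (dspt F (C.Φ σ) X) (dspt F (C.Φ σ) X') = C.gram g σ X X' := by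
  obtain ⟨ζ', hζ', hb⟩ := hF.exists_map
  obtain rfl : ζ = ζ' := (eq_of_intertwines hζ).trans (eq_of_intertwines hζ').symm
  exact (isHypersurfaceSymmetry_iff hF.subset_source hζ hb.2).1 hF σ X X'

theorem IsHypersurfaceSymmetry.gammaForm_eq (hF : IsHypersurfaceSymmetry g.form C F)
    (hζ : ∀ σ, F (C.Φ σ) = C.Φ (ζ σ)) (σ : Sig) (X X' : ℝ × E2) :
    C.gammaForm g (ζ σ) (dmap ζ σ X) (dmap ζ σ X') = C.gammaForm g σ X X' := by
  have := hF.gram_eq hζ σ (C.DΦ σ X) (C.DΦ σ X')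
  rw [dspt_DΦ hF.subset_source hζ, dspt_DΦ hF.subset_source hζ] at this
  exact this

/-- dζ is bijective and preserves γ, so dζ(n) is again in the radical of γ, which is the line of n.
Thus the sphere component of ζ is constant along each generator. -/
theorem IsHypersurfaceSymmetry.snd_eq (hg : (C.data g.form).IsGaugeFixed)
    (hF : IsHypersurfaceSymmetry g.form C F) (hζ : ∀ σ, F (C.Φ σ) = C.Φ (ζ σ)) (u s : ℝ) (x : S2) :
    (ζ (u, x)).2 = (ζ (s, x)).2 := by
  have hd := contMDiff_of_intertwines hF.subset_source hζ
  have h1 : ∀ σ, (dmap ζ σ (1, 0)).2 = 0 := by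
    intro σ
    refine Coords.eq_zero_of_gammaForm hg (σ := ζ σ) fun X' => ?_
    obtain ⟨Z, rfl⟩ := (dmap_bijective hF.subset_source hζ σ).2 X'
    rw [hF.gammaForm_eq hζ]
    exact hg.γ_n σ Z
  have hline : ∀ s : ℝ, MDifferentiableAt 𝓘(ℝ, ℝ) IS (fun s : ℝ => (s, x)) s := fun s =>
    mdifferentiableAt_id.prodMk mdifferentiableAt_const
  have hζd : ∀ σ, MDifferentiableAt IS IS ζ σ := fun σ => (hd σ).mdifferentiableAt (by simp)
  have hsnd : ∀ σ : Sig, MDifferentiableAt IS (𝓡 2) (fun τ : Sig => τ.2) σ := fun σ =>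
    mdifferentiableAt_snd
  refine eq_of_mfderiv_eq_zero (h := (fun τ : Sig => τ.2) ∘ (ζ ∘ fun s : ℝ => (s, x)))
    (fun s => (hsnd _).comp s ((hζd _).comp s (hline s))) (fun s => ?_) u s
  have h2 := mfderiv_comp_apply s (hsnd _) ((hζd _).comp s (hline s)) (1 : ℝ)
  have h3 := mfderiv_comp_apply s (hζd _) (hline s) (1 : ℝ)
  have h4 : (mfderiv 𝓘(ℝ, ℝ) IS (fun s : ℝ => (s, x)) s (1 : ℝ) : ℝ × E2) = (1, 0) :=
    congrArg (fun L : ℝ →L[ℝ] ℝ × E2 => L 1) mfderiv_prod_left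
  have h5 : ∀ (σ : Sig) (X : ℝ × E2), (mfderiv IS (𝓡 2) (fun τ : Sig => τ.2) σ X : E2) = X.2 :=
    fun σ X => congrArg (fun L : ℝ × E2 →L[ℝ] E2 => L X) mfderiv_snd
  refine h2.trans ((h5 _ _).trans ?_)
  refine (congrArg Prod.snd (h3 : _ = dmap ζ (s, x)
    (mfderiv 𝓘(ℝ, ℝ) IS (fun s : ℝ => (s, x)) s (1 : ℝ) : ℝ × E2))).trans ?_
  rw [h4]
  exact h1 _

end Symmetry

theorem dS_zero (f : Sig → ℝ) (u : ℝ) (x : S2) : dS f u x (0 : E2) = 0 :=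
  map_zero (mfderiv (𝓡 2) 𝓘(ℝ, ℝ) (fun z : S2 => f (u, z)) x)

/-! ### Induced pairs and the transverse derivative -/

section Symmetry

variable {M : Type*} [TopologicalSpace M] [ChartedSpace E4 M]
  {C : Coords M} {F : PartialDiffeomorph (𝓡 4) (𝓡 4) M M ∞}

theorem Induces.intertwines {F : M → M} {f : Sig → ℝ} {Y : S2 → S2} (h : Induces C F f Y)
    (σ : Sig) : F (C.Φ σ) = C.Φ (pairMap f Y σ) := h σ.1 σ.2

variable [IsManifold (𝓡 4) ∞ M] {g : LorentzMetric M}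

theorem Coords.gram_DΦ_ell (hg : (C.data g.form).IsGaugeFixed) (σ : Sig) (X : ℝ × E2) :
    C.gram g σ (C.DΦ σ X) (C.ell σ) = X.1 :=
  (Coords.gram_symm _ _ _).trans (Coords.gram_ell_DΦ hg σ X)

/-- Y and its inverse are the sphere components of ζ and of the map induced by the inverse of F, on
the section u = 0. Neither map preserves this section, but the sphere components do not depend on u,
so they still invert each other. -/
theorem IsHypersurfaceSymmetry.exists_diffeomorph (hg : (C.data g.form).IsGaugeFixed)
    (hF : IsHypersurfaceSymmetry g.form C F) {ζ : Sig → Sig} (hζ : ∀ σ, F (C.Φ σ) = C.Φ (ζ σ)) :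
    ∃ Y : S2 ≃ₘ^∞⟮𝓡 2, 𝓡 2⟯ S2, ∀ σ, (ζ σ).2 = Y σ.2 := by
  obtain ⟨ζ', hζ', -⟩ := hF.symm.exists_map
  have hd := contMDiff_of_intertwines hF.subset_source hζ
  have hd' := contMDiff_of_intertwines hF.symm.subset_source hζ'
  have hinv : ∀ σ, ζ' (ζ σ) = σ := fun σ => C.Φ_injective (by
    rw [← hζ', ← hζ]
    exact F.left_inv (mem_source_of_subset hF.subset_source σ))
  have hinv' : ∀ σ, ζ (ζ' σ) = σ := fun σ => C.Φ_injective (by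
    rw [← hζ, ← hζ']
    exact F.right_inv (mem_source_of_subset hF.symm.subset_source σ))
  have hsec : ContMDiff (𝓡 2) IS ∞ (fun x : S2 => ((0 : ℝ), x)) :=
    contMDiff_const.prodMk contMDiff_id
  refine ⟨{ toFun := fun x => (ζ (0, x)).2
            invFun := fun x => (ζ' (0, x)).2
            left_inv := fun x => ?_
            right_inv := fun x => ?_
            contMDiff_toFun := contMDiff_snd.comp (hd.comp hsec)
            contMDiff_invFun := contMDiff_snd.comp (hd'.comp hsec) },
    fun σ => hF.snd_eq hg hζ σ.1 0 σ.2⟩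
  · dsimp only
    rw [hF.symm.snd_eq hg hζ' 0 (ζ (0, x)).1]
    exact congrArg Prod.snd (hinv (0, x))
  · dsimp only
    rw [hF.snd_eq hg hζ 0 (ζ' (0, x)).1]
    exact congrArg Prod.snd (hinv' (0, x))

/-- Each property is one of ζ: f_u = 0 would put n in the kernel of dζ, bijectivity of ζ restricts
to each generator because Y is injective, and preservation of γ, which is q on sphere components, is
the isometry property. -/
theorem IsHypersurfaceSymmetry.isAdmissible (hg : (C.data g.form).IsGaugeFixed)
    (hne : (C.data g.form).IsNonExpanding)
    (hF : IsHypersurfaceSymmetry g.form C F) {f : Sig → ℝ} {Y : S2 ≃ₘ^∞⟮𝓡 2, 𝓡 2⟯ S2}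
    (hI : Induces C F f Y) : IsAdmissible (C.data g.form) f Y := by
  have hζ := hI.intertwines
  have hd := contMDiff_of_intertwines hF.subset_source hζ
  have hf : ContMDiff IS 𝓘(ℝ, ℝ) ∞ f := contMDiff_fst.comp hd
  have hY : ∀ x, MDifferentiableAt (𝓡 2) (𝓡 2) Y x := fun x =>
    (Y.contMDiff x).mdifferentiableAt (by simp)
  have hfd : ∀ σ, MDifferentiableAt IS 𝓘(ℝ, ℝ) f σ := fun σ => (hf σ).mdifferentiableAt (by simp)
  obtain ⟨ζ', hζ', hb⟩ := hF.exists_map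
  obtain rfl : pairMap f Y = ζ' := (eq_of_intertwines hζ).trans (eq_of_intertwines hζ').symm
  refine ⟨hf, fun σ h0 => ?_, fun x => ⟨fun u s h => ?_, fun s => ?_⟩, fun x v w => ?_⟩
  · have h1 : dmap (pairMap f Y) σ (1, 0) = 0 := by
      rw [dmap_pairMap (hfd σ) (hY _), h0]
      refine Prod.ext ?_ (map_zero _)
      dsimp only
      rw [dS_zero, mul_one, add_zero]
      rfl
    have h2 := (dmap_bijective hF.subset_source hζ σ).1 (h1.trans (map_zero _).symm)
    simpa using congrArg Prod.fst h2
  · exact congrArg Prod.fst (hb.1 (show pairMap f Y (u, x) = pairMap f Y (s, x) from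
      Prod.ext h rfl))
  · obtain ⟨⟨u, z⟩, h⟩ := hb.2 (s, Y x)
    obtain rfl : z = x := Y.injective (congrArg Prod.snd h)
    exact ⟨u, congrArg Prod.fst h⟩
  · have h1 := hF.gammaForm_eq hζ (0, x) (0, v) (0, w)
    rw [Coords.gammaForm_eq_qForm hg hne, Coords.gammaForm_eq_qForm hg hne,
      dmap_pairMap (hfd _) (hY _), dmap_pairMap (hfd _) (hY _)] at h1
    exact h1

/-- The gradient of `f(u, ·)` with respect to `q`. -/
def Coords.grad (C : Coords M) (g : LorentzMetric M) (f : Sig → ℝ) (σ : Sig) : E2 :=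
  Function.invFun (C.qForm g σ.2) (mfderiv (𝓡 2) 𝓘(ℝ, ℝ) (fun z : S2 => f (σ.1, z)) σ.2)

theorem Coords.qForm_grad (hg : (C.data g.form).IsGaugeFixed) (f : Sig → ℝ) (σ : Sig) (v : E2) :
    C.qForm g σ.2 (C.grad g f σ) v = dS f σ.1 σ.2 v := by
  have h := Function.invFun_eq ((Coords.qForm_bijective hg σ.2).2
    (mfderiv (𝓡 2) 𝓘(ℝ, ℝ) (fun z : S2 => f (σ.1, z)) σ.2))
  exact congrArg (fun L : E2 →L[ℝ] ℝ => L v) h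

theorem Coords.eq_grad (hg : (C.data g.form).IsGaugeFixed) {f : Sig → ℝ} {σ : Sig} {G : E2}
    (h : ∀ v, C.qForm g σ.2 G v = dS f σ.1 σ.2 v) : G = C.grad g f σ :=
  (Coords.qForm_bijective hg σ.2).1 (ContinuousLinearMap.ext fun v =>
    (h v).trans (Coords.qForm_grad hg f σ v).symm)

/-- The prescribed image of the rigging under the differential of a symmetry. -/
def Coords.jet (C : Coords M) (g : LorentzMetric M) (f : Sig → ℝ) (Y : S2 → S2) (σ : Sig) : E4 :=
  (1 / fu f σ) • (C.ell (pairMap f Y σ) - C.DΦ (pairMap f Y σ)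
    (1 / 2 * C.qForm g σ.2 (C.grad g f σ) (C.grad g f σ), dsph Y σ.2 (C.grad g f σ)))

/-- As q is nondegenerate, the gradient exists and is unique, so the existential over G can be
replaced by the chosen `Coords.grad`. -/
theorem hasTransverseJet_iff (hg : (C.data g.form).IsGaugeFixed) {F : M → M} {f : Sig → ℝ}
    {Y : S2 → S2} : HasTransverseJet (C.data g.form) C F f Y ↔
      ∀ σ, dspt F (C.Φ σ) (C.ell σ) = C.jet g f Y σ := by
  have h1 : ∀ (u : ℝ) (x : S2) (G : E2), (1 / fu f (u, x)) • (C.ell (f (u, x), Y x)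
        - C.DΦ (f (u, x), Y x) (0, dsph Y x G)
        - (1 / 2 * C.qForm g x G G) • C.DΦ (f (u, x), Y x) (1, 0)) =
      (1 / fu f (u, x)) • (C.ell (f (u, x), Y x) - C.DΦ (f (u, x), Y x)
        (1 / 2 * C.qForm g x G G, dsph Y x G)) := by
    intro u x G
    rw [sub_sub, ← map_smul, ← map_add]
    simp
  constructor
  · rintro h ⟨u, x⟩
    obtain ⟨G, hG, hjet⟩ := h u x
    obtain rfl := Coords.eq_grad hg (σ := (u, x)) hG
    exact hjet.trans (h1 u x _)
  · intro h u x
    exact ⟨C.grad g f (u, x), Coords.qForm_grad hg f (u, x), (h (u, x)).trans (h1 u x _).symm⟩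

section Admissible

variable {f : Sig → ℝ} {Y : S2 ≃ₘ^∞⟮𝓡 2, 𝓡 2⟯ S2}

theorem IsAdmissible.dmap_apply {D : HData} (hA : IsAdmissible D f Y) (σ : Sig) (X : ℝ × E2) :
    dmap (pairMap f Y) σ X = (fu f σ * X.1 + dS f σ.1 σ.2 X.2, dsph Y σ.2 X.2) :=
  dmap_pairMap ((hA.smooth σ).mdifferentiableAt (by simp))
    ((Y.contMDiff σ.2).mdifferentiableAt (by simp)) X

theorem IsAdmissible.gammaForm_eq (hg : (C.data g.form).IsGaugeFixed)
    (hne : (C.data g.form).IsNonExpanding) (hA : IsAdmissible (C.data g.form) f Y) (σ : Sig)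
    (X X' : ℝ × E2) :
    C.gammaForm g (pairMap f Y σ) (dmap (pairMap f Y) σ X) (dmap (pairMap f Y) σ X') =
      C.gammaForm g σ X X' := by
  rw [Coords.gammaForm_eq_qForm hg hne, Coords.gammaForm_eq_qForm hg hne, hA.dmap_apply,
    hA.dmap_apply]
  exact hA.isometry σ.2 X.2 X'.2

theorem IsAdmissible.bijective {D : HData} (hA : IsAdmissible D f Y) :
    Function.Bijective (pairMap f Y) := by
  constructor
  · rintro ⟨u, x⟩ ⟨s, z⟩ h
    obtain rfl : x = z := Y.injective (congrArg Prod.snd h)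
    obtain rfl : u = s := (hA.bij x).1 (congrArg Prod.fst h)
    rfl
  · rintro ⟨s, z⟩
    obtain ⟨u, hu⟩ := (hA.bij (Y.symm z)).2 s
    exact ⟨(u, Y.symm z), Prod.ext hu (Y.apply_symm_apply z)⟩

/-- The term d_S f(X) in the u-component of dζ X is cancelled by the sphere part of the jet, since Y
is an isometry and q(grad f, ·) = d_S f; what is left is f_u X.1 / f_u. -/
theorem IsAdmissible.gram_jet (hg : (C.data g.form).IsGaugeFixed)
    (hne : (C.data g.form).IsNonExpanding) (hA : IsAdmissible (C.data g.form) f Y) (σ : Sig)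
    (X : ℝ × E2) : C.gram g (pairMap f Y σ) (C.jet g f Y σ)
      (C.DΦ (pairMap f Y σ) (dmap (pairMap f Y) σ X)) = X.1 := by
  have h1 : ∀ a b, C.gram g (pairMap f Y σ) (C.DΦ (pairMap f Y σ) a) (C.DΦ (pairMap f Y σ) b) =
      C.gammaForm g (pairMap f Y σ) a b := fun _ _ => rfl
  have h2 : C.qForm g (Y σ.2) (dsph Y σ.2 (C.grad g f σ)) (dsph Y σ.2 X.2) =
      C.qForm g σ.2 (C.grad g f σ) X.2 := hA.isometry σ.2 _ _
  have h3 := hA.fu_ne_zero σ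
  rw [Coords.jet, map_smul, map_sub, _root_.smul_apply, _root_.sub_apply,
    Coords.gram_ell_DΦ hg, h1, Coords.gammaForm_eq_qForm hg hne, hA.dmap_apply]
  change (1 / fu f σ) • (fu f σ * X.1 + dS f σ.1 σ.2 X.2 -
    C.qForm g (Y σ.2) (dsph Y σ.2 (C.grad g f σ)) (dsph Y σ.2 X.2)) = X.1
  rw [h2, Coords.qForm_grad hg, smul_eq_mul]
  field_simp
  ring

/-- The n-component -½|grad f|² pairs twice with ℓ and cancels the square |grad f|² of the sphere
part. -/
theorem IsAdmissible.gram_jet_jet (hg : (C.data g.form).IsGaugeFixed)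
    (hne : (C.data g.form).IsNonExpanding) (hA : IsAdmissible (C.data g.form) f Y) (σ : Sig) :
    C.gram g (pairMap f Y σ) (C.jet g f Y σ) (C.jet g f Y σ) = 0 := by
  have h1 : ∀ a b, C.gram g (pairMap f Y σ) (C.DΦ (pairMap f Y σ) a) (C.DΦ (pairMap f Y σ) b) =
      C.gammaForm g (pairMap f Y σ) a b := fun _ _ => rfl
  have h2 : C.qForm g (Y σ.2) (dsph Y σ.2 (C.grad g f σ)) (dsph Y σ.2 (C.grad g f σ)) =
      C.qForm g σ.2 (C.grad g f σ) (C.grad g f σ) := hA.isometry σ.2 _ _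
  simp only [Coords.jet, map_smul, map_sub, _root_.smul_apply, _root_.sub_apply,
    Coords.gram_ell_ell hg, Coords.gram_ell_DΦ hg, h1, Coords.gram_DΦ_ell hg,
    Coords.gammaForm_eq_qForm hg hne]
  change (1 / fu f σ) • ((1 / fu f σ) • _ - (1 / fu f σ) • (_ - C.qForm g (Y σ.2) _ _)) = (0 : ℝ)
  rw [h2]
  simp only [smul_eq_mul]
  ring

/-- The difference of two vectors with the same products with TΣ is orthogonal to TΣ, hence a
multiple of n. If both vectors are null, the multiple vanishes because their product with n is
1/f_u. -/
theorem IsAdmissible.eq_jet (hg : (C.data g.form).IsGaugeFixed)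
    (hne : (C.data g.form).IsNonExpanding) (hA : IsAdmissible (C.data g.form) f Y) {σ : Sig}
    {w : E4} (hsurj : Function.Surjective (dmap (pairMap f Y) σ))
    (hw : ∀ X, C.gram g (pairMap f Y σ) w
      (C.DΦ (pairMap f Y σ) (dmap (pairMap f Y) σ X)) = X.1)
    (hww : C.gram g (pairMap f Y σ) w w = 0) : w = C.jet g f Y σ := by
  obtain ⟨t, A, hd⟩ := C.exists_decomp (pairMap f Y σ) (w - C.jet g f Y σ)
  have h1 : ∀ B, t * B.1 + C.gammaForm g (pairMap f Y σ) A B = 0 := by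
    intro B
    obtain ⟨X, rfl⟩ := hsurj B
    have h2 : C.gram g (pairMap f Y σ) (w - C.jet g f Y σ)
        (C.DΦ (pairMap f Y σ) (dmap (pairMap f Y) σ X)) = 0 := by
      rw [map_sub, _root_.sub_apply, hw, hA.gram_jet hg hne, sub_self]
    rw [hd, map_add, map_smul, _root_.add_apply, _root_.smul_apply,
      Coords.gram_ell_DΦ hg] at h2
    exact h2
  -- Pairing with n kills the γ-term and isolates the coefficient of ℓ.
  have ht : t = 0 := by
    have h3 := h1 (1, 0)
    rw [Coords.gammaForm_eq_qForm hg hne] at h3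
    simpa using h3
  have hA2 : A.2 = 0 := Coords.eq_zero_of_gammaForm hg (σ := pairMap f Y σ) fun B => by
    simpa [ht] using h1 B
  have hA' : A = A.1 • ((1 : ℝ), (0 : E2)) := by
    ext <;> simp [hA2]
  have hw' : w = C.jet g f Y σ + A.1 • C.DΦ (pairMap f Y σ) (1, 0) := by
    rw [← map_smul, ← hA', ← sub_eq_iff_eq_add']
    rw [hd, ht, zero_smul, zero_add]
  have h4 : C.gram g (pairMap f Y σ) (C.jet g f Y σ) (C.DΦ (pairMap f Y σ) (1, 0)) =
      1 / fu f σ := by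
    have h5 : dmap (pairMap f Y) σ (1 / fu f σ, 0) = (1, 0) := by
      rw [hA.dmap_apply]
      have := hA.fu_ne_zero σ
      refine Prod.ext ?_ (map_zero _)
      dsimp only
      rw [dS_zero, add_zero, mul_one_div_cancel this]
    rw [← h5, hA.gram_jet hg hne]
  have h6 : C.gram g (pairMap f Y σ) (C.DΦ (pairMap f Y σ) (1, 0))
      (C.DΦ (pairMap f Y σ) (1, 0)) = 0 := hg.γ_n _ _
  -- With w = jet + a n, the equation g(w, w) = 0 becomes 2a/f_u = 0.
  simp only [hw', map_add, map_smul, _root_.add_apply, _root_.smul_apply,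
    hA.gram_jet_jet hg hne, h4, h6, (Coords.gram_symm _ _ _).trans h4] at hww
  have h7 : A.1 = 0 := by
    have h8 := hA.fu_ne_zero σ
    simp only [smul_eq_mul] at hww
    field_simp at hww
    linarith
  rw [hw', h7, zero_smul, add_zero]

/-- Necessity is the uniqueness in `eq_jet`. For sufficiency, both arguments are split along ℓ and
TΣ, and the products of the images are those computed by `gram_jet`, `gram_jet_jet` and the isometry
property. -/
theorem isHypersurfaceSymmetry_iff_jet (hg : (C.data g.form).IsGaugeFixed)
    (hne : (C.data g.form).IsNonExpanding) (hs : C.H ⊆ F.source)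
    (hA : IsAdmissible (C.data g.form) f Y) (hI : Induces C F f Y) :
    IsHypersurfaceSymmetry g.form C F ↔ ∀ σ, dspt F (C.Φ σ) (C.ell σ) = C.jet g f Y σ := by
  have hζ := hI.intertwines
  constructor
  · intro hF σ
    refine hA.eq_jet hg hne (dmap_bijective hs hζ σ).2 (fun X => ?_) ?_
    · rw [← dspt_DΦ hs hζ, hF.gram_eq hζ, Coords.gram_ell_DΦ hg]
    · rw [hF.gram_eq hζ, Coords.gram_ell_ell hg]
  · intro h
    rw [isHypersurfaceSymmetry_iff hs hζ hA.bijective.2]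
    intro σ X X'
    obtain ⟨t, A, rfl⟩ := C.exists_decomp σ X
    obtain ⟨t', A', rfl⟩ := C.exists_decomp σ X'
    have h1 : C.gram g (pairMap f Y σ) (C.DΦ (pairMap f Y σ) (dmap (pairMap f Y) σ A))
        (C.DΦ (pairMap f Y σ) (dmap (pairMap f Y) σ A')) =
        C.gram g σ (C.DΦ σ A) (C.DΦ σ A') := hA.gammaForm_eq hg hne σ A A'
    simp only [map_add, map_smul, h, dspt_DΦ hs hζ, _root_.add_apply,
      _root_.smul_apply, hA.gram_jet_jet hg hne, h1, Coords.gram_ell_ell hg,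
      hA.gram_jet hg hne, Coords.gram_ell_DΦ hg, Coords.gram_DΦ_ell hg,
      (Coords.gram_symm _ _ _).trans (hA.gram_jet hg hne _ _)]

end Admissible

theorem IsHypersurfaceSymmetry.dspt_ell (hg : (C.data g.form).IsGaugeFixed)
    (hne : (C.data g.form).IsNonExpanding) {f : Sig → ℝ} {Y : S2 ≃ₘ^∞⟮𝓡 2, 𝓡 2⟯ S2}
    (hF : IsHypersurfaceSymmetry g.form C F) (hI : Induces C F f Y) (σ : Sig) :
    dspt F (C.Φ σ) (C.ell σ) = C.jet g f Y σ :=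
  (isHypersurfaceSymmetry_iff_jet hg hne hF.subset_source (hF.isAdmissible hg hne hI) hI).1 hF σ

theorem IsHypersurfaceSymmetry.dspt_eq (hg : (C.data g.form).IsGaugeFixed)
    (hne : (C.data g.form).IsNonExpanding) {F₁ F₂ : PartialDiffeomorph (𝓡 4) (𝓡 4) M M ∞}
    {f : Sig → ℝ} {Y : S2 → S2} (hF₁ : IsHypersurfaceSymmetry g.form C F₁)
    (hF₂ : IsHypersurfaceSymmetry g.form C F₂) (hI₁ : Induces C F₁ f Y) (hI₂ : Induces C F₂ f Y)
    (σ : Sig) (X : E4) : dspt F₁ (C.Φ σ) X = dspt F₂ (C.Φ σ) X := by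
  obtain ⟨Y', hY'⟩ := hF₁.exists_diffeomorph hg hI₁.intertwines
  obtain rfl : Y = Y' := funext fun x => hY' (0, x)
  obtain ⟨t, A, rfl⟩ := C.exists_decomp σ X
  rw [map_add, map_add, map_smul, map_smul, hF₁.dspt_ell hg hne hI₁, hF₂.dspt_ell hg hne hI₂,
    dspt_DΦ hF₁.subset_source hI₁.intertwines, dspt_DΦ hF₂.subset_source hI₂.intertwines]

/-- Since dζ(n) = f_u n, invariance of g gives f_u g(n, dF X) = g(n, X) for all X. Testing on X = ℓ,
where g(n, ℓ) = 1, yields the converse direction. -/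
theorem IsHypersurfaceSymmetry.normal_eq_iff (hg : (C.data g.form).IsGaugeFixed)
    (hne : (C.data g.form).IsNonExpanding) {f : Sig → ℝ} {Y : S2 ≃ₘ^∞⟮𝓡 2, 𝓡 2⟯ S2}
    (hF : IsHypersurfaceSymmetry g.form C F) (hI : Induces C F f Y) (σ : Sig) :
    (∀ X, C.gram g (pairMap f Y σ) (C.DΦ (pairMap f Y σ) (1, 0)) (dspt F (C.Φ σ) X) =
      C.gram g σ (C.DΦ σ (1, 0)) X) ↔ fu f σ = 1 := by
  have hA := hF.isAdmissible hg hne hI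
  have h1 : ∀ X, fu f σ *
      C.gram g (pairMap f Y σ) (C.DΦ (pairMap f Y σ) (1, 0)) (dspt F (C.Φ σ) X) =
      C.gram g σ (C.DΦ σ (1, 0)) X := by
    intro X
    have h2 : dmap (pairMap f Y) σ (1, 0) = fu f σ • ((1 : ℝ), (0 : E2)) := by
      rw [hA.dmap_apply, dS_zero, map_zero]
      simp
    rw [← hF.gram_eq hI.intertwines σ, dspt_DΦ hF.subset_source hI.intertwines, h2, map_smul,
      map_smul]
    rfl
  constructor
  · intro h
    have h2 := h1 (C.ell σ)
    rw [h, Coords.gram_symm, Coords.gram_ell_DΦ hg] at h2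
    linarith
  · intro h X
    rw [← h1, h, one_mul]

theorem fu_eq_one_iff {f : Sig → ℝ} (hf : ContMDiff IS 𝓘(ℝ, ℝ) ∞ f) :
    (∀ σ, fu f σ = 1) ↔
      ∃ A : S2 → ℝ, ContMDiff (𝓡 2) 𝓘(ℝ, ℝ) ∞ A ∧ ∀ u x, f (u, x) = u + A x := by
  constructor
  · intro h
    refine ⟨fun x => f (0, x), hf.comp (contMDiff_const.prodMk contMDiff_id), fun u x => ?_⟩
    have hline : ContMDiff 𝓘(ℝ, ℝ) 𝓘(ℝ, ℝ) ∞ (fun s : ℝ => f (s, x)) :=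
      hf.comp (contMDiff_id.prodMk contMDiff_const)
    have hd : Differentiable ℝ (fun s : ℝ => f (s, x)) :=
      hline.contDiff.differentiable (by simp)
    have h1 := is_const_of_deriv_eq_zero (f := fun s : ℝ => f (s, x) - s)
      (hd.sub differentiable_id) (fun s => ?_) u 0
    · simp only [sub_zero] at h1
      linarith
    · have h2 : deriv (fun s : ℝ => f (s, x)) s = 1 := h (s, x)
      have h3 := (hd s).hasDerivAt.sub (hasDerivAt_id s)
      rw [h2, sub_self] at h3
      exact h3.deriv
  · rintro ⟨A, -, hA⟩ ⟨u, x⟩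
    have : (fun s : ℝ => f (s, x)) = fun s => s + A x := funext fun s => hA s x
    rw [fu]
    dsimp only
    rw [this, deriv_add_const, deriv_id'']

end Symmetry

/-! ### The Lie derivative formula for a pulled-back bilinear form -/

section LieFormula

variable {E E' : Type*} [NormedAddCommGroup E] [NormedSpace ℝ E] [NormedAddCommGroup E']
  [NormedSpace ℝ E']

/-- The derivative of the pull-back of a field of bilinear forms, evaluated on fixed vectors. -/
theorem hasFDerivAt_bilin_pull {K K' : Type*} [NormedAddCommGroup K] [NormedSpace ℝ K]
    [NormedAddCommGroup K'] [NormedSpace ℝ K'] {B : K' → K' →L[ℝ] K' →L[ℝ] ℝ} {P : K → K'} {p : K}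
    (hB : DifferentiableAt ℝ B (P p)) (hP : ContDiffAt ℝ 2 P p) (A A' : K) :
    ∃ L : K →L[ℝ] ℝ, HasFDerivAt (fun z => B (P z) (fderiv ℝ P z A) (fderiv ℝ P z A')) L p ∧
      ∀ Z, L Z = fderiv ℝ B (P p) (fderiv ℝ P p Z) (fderiv ℝ P p A) (fderiv ℝ P p A')
        + B (P p) (fderiv ℝ (fderiv ℝ P) p Z A) (fderiv ℝ P p A')
        + B (P p) (fderiv ℝ P p A) (fderiv ℝ (fderiv ℝ P) p Z A') := by
  have h1 : HasFDerivAt P (fderiv ℝ P p) p := (hP.differentiableAt (by simp)).hasFDerivAt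
  have h2 : HasFDerivAt (fderiv ℝ P) (fderiv ℝ (fderiv ℝ P) p) p :=
    ((hP.fderiv_right (m := 1) (by norm_num)).differentiableAt (by simp)).hasFDerivAt
  have h3 : HasFDerivAt (fun z => B (P z)) _ p :=
    HasFDerivAt.comp (g := B) p hB.hasFDerivAt h1
  have h4 := fun A => h2.clm_apply (hasFDerivAt_const A p)
  have h5 := (h3.clm_apply (h4 A)).clm_apply (h4 A')
  refine ⟨_, h5, fun Z => ?_⟩
  simp
  ring

/-- The derivative along `∂_r` of the pull-back by `P` of a field of bilinear forms, at a point of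
`{r = 0}`, when `∂_r` is the sum of a vector field `W` tangent to `{r = 0}` and of a vector field
that `P` maps to `ρ ∂_r`. -/
theorem hasDerivAt_bilin_pull {B : E' × ℝ → (E' × ℝ) →L[ℝ] (E' × ℝ) →L[ℝ] ℝ}
    {P : E × ℝ → E' × ℝ} {y₀ : E} {W : E → E} {ρ : E → ℝ}
    (hB : DifferentiableAt ℝ B (P (y₀, 0))) (hP : ContDiffAt ℝ 2 P (y₀, 0))
    (hW : DifferentiableAt ℝ W y₀) (hρ : DifferentiableAt ℝ ρ y₀)
    (hZ : ∀ᶠ y in nhds y₀, fderiv ℝ P (y, 0) (-W y, 1) = (0, ρ y)) (X X' : E) :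
    HasDerivAt
      (fun r => B (P (y₀, r)) (fderiv ℝ P (y₀, r) (X, 0)) (fderiv ℝ P (y₀, r) (X', 0)))
      (fderiv ℝ
          (fun y => B (P (y, 0)) (fderiv ℝ P (y, 0) (X, 0)) (fderiv ℝ P (y, 0) (X', 0))) y₀ (W y₀)
        + B (P (y₀, 0)) (fderiv ℝ P (y₀, 0) (fderiv ℝ W y₀ X, 0)) (fderiv ℝ P (y₀, 0) (X', 0))
        + B (P (y₀, 0)) (fderiv ℝ P (y₀, 0) (X, 0)) (fderiv ℝ P (y₀, 0) (fderiv ℝ W y₀ X', 0))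
        + ρ y₀ * fderiv ℝ B (P (y₀, 0)) (0, 1) (fderiv ℝ P (y₀, 0) (X, 0))
            (fderiv ℝ P (y₀, 0) (X', 0))
        + fderiv ℝ ρ y₀ X * B (P (y₀, 0)) (0, 1) (fderiv ℝ P (y₀, 0) (X', 0))
        + fderiv ℝ ρ y₀ X' * B (P (y₀, 0)) (fderiv ℝ P (y₀, 0) (X, 0)) (0, 1)) 0 := by
  obtain ⟨L, hL, hLZ⟩ := hasFDerivAt_bilin_pull hB hP (X, 0) (X', 0)
  have hr : HasFDerivAt (fun r : ℝ => (y₀, r)) (ContinuousLinearMap.inr ℝ E ℝ) 0 :=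
    hasFDerivAt_prodMk_right y₀ 0
  have hy : HasFDerivAt (fun y : E => (y, (0 : ℝ))) (ContinuousLinearMap.inl ℝ E ℝ) y₀ :=
    hasFDerivAt_prodMk_left y₀ 0
  have h1 := (HasFDerivAt.comp (g := fun z => B (P z) (fderiv ℝ P z (X, 0)) (fderiv ℝ P z (X', 0)))
    (0 : ℝ) hL hr).hasDerivAt
  have h2 := (HasFDerivAt.comp (g := fun z => B (P z) (fderiv ℝ P z (X, 0)) (fderiv ℝ P z (X', 0)))
    y₀ hL hy).fderiv
  have h3 : fderiv ℝ (fun y => B (P (y, 0)) (fderiv ℝ P (y, 0) (X, 0))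
      (fderiv ℝ P (y, 0) (X', 0))) y₀ (W y₀) = L (W y₀, 0) := by
    have := congrArg (fun T : E →L[ℝ] ℝ => T (W y₀)) h2
    exact this
  have hD2 : HasFDerivAt (fderiv ℝ P) (fderiv ℝ (fderiv ℝ P) (y₀, 0)) (y₀, 0) :=
    ((hP.fderiv_right (m := 1) (by norm_num)).differentiableAt (by simp)).hasFDerivAt
  have hsymm : IsSymmSndFDerivAt ℝ P (y₀, 0) := hP.isSymmSndFDerivAt (by simp)
  -- The second derivative in the direction (-W, 1) involves ∂_r. By symmetry it is the derivative
  -- in the tangential direction X, where the relation `hZ`, known only on {r = 0}, may be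
  -- differentiated.
  have hsec : ∀ X : E, fderiv ℝ (fderiv ℝ P) (y₀, 0) (-W y₀, 1) (X, 0) =
      (0, fderiv ℝ ρ y₀ X) + fderiv ℝ P (y₀, 0) (fderiv ℝ W y₀ X, 0) := by
    intro X
    rw [hsymm.eq]
    have h4 : HasFDerivAt (fun y => fderiv ℝ P (y, 0)) _ y₀ :=
      HasFDerivAt.comp (g := fderiv ℝ P) y₀ hD2 hy
    have h5 : HasFDerivAt (fun y => (-W y, (1 : ℝ))) ((-fderiv ℝ W y₀).prod (0 : E →L[ℝ] ℝ)) y₀ :=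
      hW.hasFDerivAt.neg.prodMk (hasFDerivAt_const (1 : ℝ) y₀)
    have h6 := h4.clm_apply h5
    have h7 : HasFDerivAt (fun y => ((0 : E'), ρ y)) ((0 : E →L[ℝ] E').prod (fderiv ℝ ρ y₀)) y₀ :=
      (hasFDerivAt_const (0 : E') y₀).prodMk hρ.hasFDerivAt
    have h8 := congrArg (fun T : E →L[ℝ] E' × ℝ => T X)
      (h6.unique (h7.congr_of_eventuallyEq hZ))
    have h9 : fderiv ℝ P (y₀, 0) (-(fderiv ℝ W y₀ X), 0) +
        fderiv ℝ (fderiv ℝ P) (y₀, 0) (X, 0) (-W y₀, 1) = (0, fderiv ℝ ρ y₀ X) := h8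
    have h10 : ((-(fderiv ℝ W y₀ X), 0) : E × ℝ) = -(fderiv ℝ W y₀ X, 0) := by simp
    rw [h10, map_neg] at h9
    rw [← h9]
    abel
  convert! h1 using 1
  -- Splits ∂_r into the field that P maps to ρ∂_r and the tangential field W.
  have h11 : (ContinuousLinearMap.inr ℝ E ℝ) 1 = (-W y₀, (1 : ℝ)) + (W y₀, 0) := by simp
  have h12 : ((0, ρ y₀) : E' × ℝ) = ρ y₀ • (0, 1) := by simp
  have h13 : ∀ X : E, ((0, fderiv ℝ ρ y₀ X) : E' × ℝ) = fderiv ℝ ρ y₀ X • (0, 1) := by simp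
  rw [ContinuousLinearMap.comp_apply, h11, map_add, hLZ (-W y₀, 1), hsec, hsec, hZ.self_of_nhds, h3,
    h12, h13, h13]
  simp only [map_add, map_smul, _root_.add_apply, _root_.smul_apply, smul_eq_mul]
  ring

end LieFormula

/-! ### Spacetime charts adapted to the hypersurface -/

section Charts

variable {c : OpenPartialHomeomorph S2 E2}

/-- The coordinates `((u, y), r)` of `Σ × ℝ` that a chart of the sphere gives. -/
def slabExt (hc : c ∈ IsManifold.maximalAtlas (𝓡 2) ∞ S2) :
    PartialDiffeomorph 𝓘(ℝ, (ℝ × E2) × ℝ) IN ((ℝ × E2) × ℝ) (Sig × ℝ) ∞ where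
  toFun p := (slab c p.1, p.2)
  invFun q := ((q.1.1, c q.1.2), q.2)
  source := {p | p.1.2 ∈ c.target}
  target := {q | q.1.2 ∈ c.source}
  map_source' _ hp := c.map_target hp
  map_target' _ hq := c.map_source hq
  left_inv' p hp := Prod.ext (Prod.ext rfl (c.right_inv hp)) rfl
  right_inv' q hq := Prod.ext (Prod.ext rfl (c.left_inv hq)) rfl
  open_source := c.open_target.preimage (continuous_snd.comp continuous_fst)
  open_target := c.open_source.preimage (continuous_snd.comp continuous_fst)
  contMDiffOn_toFun := ((contMDiffOn_slab hc).comp contDiff_fst.contMDiff.contMDiffOn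
    (fun _ hp => ⟨mem_univ _, hp⟩)).prodMk contDiff_snd.contMDiff.contMDiffOn
  contMDiffOn_invFun := by
    have h1 : ContMDiffOn IN 𝓘(ℝ, E2) ∞ (fun q : Sig × ℝ => c q.1.2) {q | q.1.2 ∈ c.source} :=
      (contMDiffOn_of_mem_maximalAtlas hc).comp
        (contMDiff_snd.comp contMDiff_fst).contMDiffOn (fun _ hq => hq)
    have h2 : ContMDiffOn IN 𝓘(ℝ, ℝ) ∞ (fun q : Sig × ℝ => q.1.1) {q | q.1.2 ∈ c.source} :=
      (contMDiff_fst.comp contMDiff_fst).contMDiffOn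
    have h3 : ContMDiffOn IN 𝓘(ℝ, ℝ) ∞ (fun q : Sig × ℝ => q.2) {q | q.1.2 ∈ c.source} :=
      contMDiff_snd.contMDiffOn
    exact (h2.prodMk_space h1).prodMk_space h3

theorem mfderiv_slabExt (hc : c ∈ IsManifold.maximalAtlas (𝓡 2) ∞ S2) {p : (ℝ × E2) × ℝ}
    (hp : p.1.2 ∈ c.target) (A : (ℝ × E2) × ℝ) :
    (mfderiv 𝓘(ℝ, (ℝ × E2) × ℝ) IN (slabExt hc) p A : (ℝ × E2) × ℝ) = (dslab c p.1 A.1, A.2) := by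
  have h1 : MDifferentiableAt 𝓘(ℝ, (ℝ × E2) × ℝ) 𝓘(ℝ, ℝ × E2) (fun z : (ℝ × E2) × ℝ => z.1) p :=
    differentiableAt_fst.mdifferentiableAt
  have h2 : MDifferentiableAt 𝓘(ℝ, (ℝ × E2) × ℝ) 𝓘(ℝ, ℝ) (fun z : (ℝ × E2) × ℝ => z.2) p :=
    differentiableAt_snd.mdifferentiableAt
  have h3 := mdifferentiableAt_slab hc hp
  have h4 := mfderiv_prodMk (x := p) (h3.comp p h1) h2
  have h5 : mfderiv 𝓘(ℝ, (ℝ × E2) × ℝ) 𝓘(ℝ, ℝ × E2) (fun z : (ℝ × E2) × ℝ => z.1) p A = A.1 := by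
    rw [mfderiv_eq_fderiv, fderiv_fst]
    rfl
  have h6 : mfderiv 𝓘(ℝ, (ℝ × E2) × ℝ) 𝓘(ℝ, ℝ) (fun z : (ℝ × E2) × ℝ => z.2) p A = A.2 := by
    rw [mfderiv_eq_fderiv, fderiv_snd]
    rfl
  have h7 := mfderiv_comp_apply p h3 h1 A
  rw [h5] at h7
  have h8 : mfderiv 𝓘(ℝ, (ℝ × E2) × ℝ) IN (slabExt hc) p A =
      (mfderiv 𝓘(ℝ, (ℝ × E2) × ℝ) IS (slab c ∘ fun z : (ℝ × E2) × ℝ => z.1) p A,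
       mfderiv 𝓘(ℝ, (ℝ × E2) × ℝ) 𝓘(ℝ, ℝ) (fun z : (ℝ × E2) × ℝ => z.2) p A) :=
    congrArg (fun L : ((ℝ × E2) × ℝ) →L[ℝ] ((ℝ × E2) × ℝ) => L A) h4
  exact h8.trans (congrArg₂ Prod.mk h7 h6)

variable {M : Type*} [TopologicalSpace M] [ChartedSpace E4 M]

/-- The spacetime coordinates `((u, y), r)` that a chart of the sphere gives. -/
def Coords.param (C : Coords M) (hc : c ∈ IsManifold.maximalAtlas (𝓡 2) ∞ S2) :
    PartialDiffeomorph 𝓘(ℝ, (ℝ × E2) × ℝ) (𝓡 4) ((ℝ × E2) × ℝ) M ∞ :=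
  (slabExt hc).trans C.ψ

variable {C : Coords M} {hc : c ∈ IsManifold.maximalAtlas (𝓡 2) ∞ S2}

theorem Coords.mem_param_source {z : ℝ × E2} (hz : z.2 ∈ c.target) {r : ℝ}
    (hr : (slab c z, r) ∈ C.ψ.source) : (z, r) ∈ (C.param hc).source :=
  ⟨hz, hr⟩

theorem Coords.mfderiv_param {p : (ℝ × E2) × ℝ} (hp : p ∈ (C.param hc).source)
    (A : (ℝ × E2) × ℝ) : (mfderiv 𝓘(ℝ, (ℝ × E2) × ℝ) (𝓡 4) (C.param hc) p A : E4) =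
      C.dψ (slab c p.1, p.2) (dslab c p.1 A.1, A.2) := by
  have h1 := mfderiv_comp_apply p (C.mdifferentiableAt_ψ (p := slabExt hc p) hp.2)
    ((slabExt hc).mdifferentiableAt (by simp) hp.1) A
  rw [mfderiv_slabExt hc hp.1] at h1
  exact h1

end Charts

/-! ### The gradient of f in coordinates -/

section Gradient

variable {M : Type*} [TopologicalSpace M] [ChartedSpace E4 M] [IsManifold (𝓡 4) ∞ M]
  {g : LorentzMetric M} {C : Coords M} {c : OpenPartialHomeomorph S2 E2}

theorem dslab_bijective (hc : c ∈ IsManifold.maximalAtlas (𝓡 2) ∞ S2) {z : ℝ × E2}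
    (hz : z.2 ∈ c.target) : Function.Bijective (dslab c z) := by
  have h := bijective_dchart hc hz
  constructor
  · intro A A' hA
    rw [dslab_apply hc hz, dslab_apply hc hz] at hA
    exact Prod.ext (Prod.mk.inj hA).1 (h.1 (Prod.mk.inj hA).2)
  · intro A
    obtain ⟨w, hw⟩ := h.2 A.2
    exact ⟨(A.1, w), by rw [dslab_apply hc hz]; exact Prod.ext rfl hw⟩

/-- A function on `Σ` in the coordinates of `slab c`. -/
theorem contDiffOn_comp_slab (hc : c ∈ IsManifold.maximalAtlas (𝓡 2) ∞ S2) {f : Sig → ℝ}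
    (hf : ContMDiff IS 𝓘(ℝ, ℝ) ∞ f) : ContDiffOn ℝ ∞ (fun z => f (slab c z)) (univ ×ˢ c.target) :=
  (hf.comp_contMDiffOn (contMDiffOn_slab hc)).contDiffOn

theorem fderiv_comp_slab (hc : c ∈ IsManifold.maximalAtlas (𝓡 2) ∞ S2) {f : Sig → ℝ}
    (hf : ContMDiff IS 𝓘(ℝ, ℝ) ∞ f) {z : ℝ × E2} (hz : z.2 ∈ c.target) (A : ℝ × E2) :
    fderiv ℝ (fun z => f (slab c z)) z A = dfun f (slab c z) (dslab c z A) := by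
  have h := mfderiv_comp_apply z ((hf (slab c z)).mdifferentiableAt (by simp))
    (mdifferentiableAt_slab hc hz) A
  rw [mfderiv_eq_fderiv] at h
  exact h

theorem fderiv_comp_slab' (hc : c ∈ IsManifold.maximalAtlas (𝓡 2) ∞ S2) {f : Sig → ℝ}
    (hf : ContMDiff IS 𝓘(ℝ, ℝ) ∞ f) {z : ℝ × E2} (hz : z.2 ∈ c.target) (A : ℝ × E2) :
    fderiv ℝ (fun z => f (slab c z)) z A =
      fu f (slab c z) * A.1 + dS f z.1 (c.symm z.2) (dchart c z.2 A.2) := by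
  rw [fderiv_comp_slab hc hf hz, dfun_apply ((hf _).mdifferentiableAt (by simp)),
    dslab_apply hc hz]
  rfl

theorem contMDiff_fu {f : Sig → ℝ} (hf : ContMDiff IS 𝓘(ℝ, ℝ) ∞ f) :
    ContMDiff IS 𝓘(ℝ, ℝ) ∞ (fu f) := by
  rintro ⟨u, x⟩
  obtain ⟨c, hc, y, hy, rfl⟩ := exists_chart x
  have h1 : ContDiffOn ℝ ∞ (fun z => fderiv ℝ (fun z => f (slab c z)) z (1, 0))
      (univ ×ˢ c.target) :=
    ((contDiffOn_comp_slab hc hf).fderiv_of_isOpen (isOpen_slab c) (by simp)).clm_apply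
      contDiffOn_const
  have h2 : ContMDiffAt IS 𝓘(ℝ, ℝ × E2) ∞ (fun σ : Sig => (σ.1, c σ.2)) (u, c.symm y) := by
    refine contMDiffAt_fst.prodMk_space ?_
    exact (contMDiffAt_of_mem_maximalAtlas hc (c.map_target hy)).comp (u, c.symm y) contMDiffAt_snd
  have h3 : ContMDiffAt 𝓘(ℝ, ℝ × E2) 𝓘(ℝ, ℝ) ∞
      (fun z => fderiv ℝ (fun z => f (slab c z)) z (1, 0)) (u, c (c.symm y)) := by
    rw [c.right_inv hy]
    exact (h1.contDiffAt ((isOpen_slab c).mem_nhds ⟨mem_univ _, hy⟩)).contMDiffAt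
  refine (h3.comp (u, c.symm y) h2).congr_of_eventuallyEq ?_
  have h4 : ∀ᶠ σ : Sig in nhds (u, c.symm y), σ.2 ∈ c.source :=
    continuousAt_snd.eventually (c.open_source.mem_nhds (c.map_target hy))
  filter_upwards [h4] with σ hσ
  have h5 : slab c (σ.1, c σ.2) = σ := Prod.ext rfl (c.left_inv hσ)
  rw [Function.comp, fderiv_comp_slab' hc hf (c.map_source hσ), h5]
  dsimp only
  rw [map_zero, dS_zero]
  ring

/-- The components of `q` in the coordinates of `slab c`, as a bilinear form. -/
def Coords.qHat (C : Coords M) (g : LorentzMetric M) (c : OpenPartialHomeomorph S2 E2)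
    (z : ℝ × E2) : E2 →L[ℝ] E2 →L[ℝ] ℝ :=
  (pullForm g (fun z => C.Φ (slab c z)) z).bilinearComp (ContinuousLinearMap.inr ℝ ℝ E2)
    (ContinuousLinearMap.inr ℝ ℝ E2)

theorem Coords.pullForm_slab_eq (hg : (C.data g.form).IsGaugeFixed)
    (hne : (C.data g.form).IsNonExpanding) (hc : c ∈ IsManifold.maximalAtlas (𝓡 2) ∞ S2)
    {z : ℝ × E2} (hz : z.2 ∈ c.target) (A A' : ℝ × E2) :
    pullForm g (fun z => C.Φ (slab c z)) z A A' =
      C.qForm g (c.symm z.2) (dchart c z.2 A.2) (dchart c z.2 A'.2) := by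
  rw [pullForm_slab_apply hc hz, gammaForm_eq_qForm hg hne, dslab_apply hc hz, dslab_apply hc hz]
  rfl

theorem Coords.qHat_apply (hg : (C.data g.form).IsGaugeFixed)
    (hne : (C.data g.form).IsNonExpanding) (hc : c ∈ IsManifold.maximalAtlas (𝓡 2) ∞ S2)
    {z : ℝ × E2} (hz : z.2 ∈ c.target) (v w : E2) :
    C.qHat g c z v w = C.qForm g (c.symm z.2) (dchart c z.2 v) (dchart c z.2 w) :=
  Coords.pullForm_slab_eq hg hne hc hz (0, v) (0, w)

theorem Coords.contDiffOn_qHat (hc : c ∈ IsManifold.maximalAtlas (𝓡 2) ∞ S2) :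
    ContDiffOn ℝ ∞ (C.qHat g c) (univ ×ˢ c.target) := by
  refine contDiffOn_clm_apply.2 fun v => contDiffOn_clm_apply.2 fun w => ?_
  exact ((Coords.contDiffOn_pullForm_slab (C := C) (g := g) hc).clm_apply
    contDiffOn_const).clm_apply contDiffOn_const

theorem Coords.bijective_qHat (hg : (C.data g.form).IsGaugeFixed)
    (hne : (C.data g.form).IsNonExpanding) (hc : c ∈ IsManifold.maximalAtlas (𝓡 2) ∞ S2)
    {z : ℝ × E2} (hz : z.2 ∈ c.target) : Function.Bijective (C.qHat g c z) := by
  have h := bijective_dchart hc hz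
  constructor
  · rw [injective_iff_map_eq_zero]
    intro v hv
    refine (injective_iff_map_eq_zero _).1 h.1 v
      (Coords.eq_zero_of_qForm hg (x := c.symm z.2) fun w => ?_)
    obtain ⟨w, rfl⟩ := h.2 w
    rw [← Coords.qHat_apply hg hne hc hz, hv]
    rfl
  · intro L
    let e : E2 ≃L[ℝ] E2 := ContinuousLinearEquiv.ofBijective (dchart c z.2)
      (LinearMap.ker_eq_bot.2 h.1) (LinearMap.range_eq_top.2 h.2)
    obtain ⟨G, hG⟩ := (Coords.qForm_bijective hg (c.symm z.2)).2 (L.comp (e.symm : E2 →L[ℝ] E2))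
    refine ⟨e.symm G, ContinuousLinearMap.ext fun w => ?_⟩
    rw [Coords.qHat_apply hg hne hc hz]
    have h1 : dchart c z.2 (e.symm G) = G := e.apply_symm_apply G
    rw [h1, hG]
    exact congrArg L (e.symm_apply_apply w)

/-- The components of the gradient of `f(u, ·)` in the coordinates of `slab c`. -/
def Coords.gradHat (C : Coords M) (g : LorentzMetric M) (c : OpenPartialHomeomorph S2 E2)
    (f : Sig → ℝ) (z : ℝ × E2) : E2 :=
  (C.qHat g c z).inverse
    ((fderiv ℝ (fun z => f (slab c z)) z).comp (ContinuousLinearMap.inr ℝ ℝ E2))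

theorem Coords.qHat_gradHat (hg : (C.data g.form).IsGaugeFixed)
    (hne : (C.data g.form).IsNonExpanding) (hc : c ∈ IsManifold.maximalAtlas (𝓡 2) ∞ S2)
    (f : Sig → ℝ) {z : ℝ × E2} (hz : z.2 ∈ c.target) (w : E2) :
    C.qHat g c z (C.gradHat g c f z) w = fderiv ℝ (fun z => f (slab c z)) z (0, w) := by
  have h := Coords.bijective_qHat hg hne hc hz
  let e : E2 ≃L[ℝ] (E2 →L[ℝ] ℝ) := ContinuousLinearEquiv.ofBijective (C.qHat g c z)
    (LinearMap.ker_eq_bot.2 h.1) (LinearMap.range_eq_top.2 h.2)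
  have he : C.qHat g c z = (e : E2 →L[ℝ] E2 →L[ℝ] ℝ) := rfl
  rw [Coords.gradHat, he, ContinuousLinearMap.inverse_equiv]
  exact congrArg (fun L : E2 →L[ℝ] ℝ => L w) (e.apply_symm_apply _)

/-- `Coords.grad` is chosen pointwise and has no visible regularity. This identifies it with an
expression in coordinates that is smooth. -/
theorem Coords.dchart_gradHat (hg : (C.data g.form).IsGaugeFixed)
    (hne : (C.data g.form).IsNonExpanding) (hc : c ∈ IsManifold.maximalAtlas (𝓡 2) ∞ S2)
    {f : Sig → ℝ} (hf : ContMDiff IS 𝓘(ℝ, ℝ) ∞ f) {z : ℝ × E2} (hz : z.2 ∈ c.target) :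
    dchart c z.2 (C.gradHat g c f z) = C.grad g f (slab c z) := by
  refine Coords.eq_grad hg fun v => ?_
  obtain ⟨w, rfl⟩ := (bijective_dchart hc hz).2 v
  refine (Coords.qHat_apply hg hne hc hz _ _).symm.trans ?_
  rw [Coords.qHat_gradHat hg hne hc f hz, fderiv_comp_slab' hc hf hz]
  dsimp only
  rw [mul_zero, zero_add]
  rfl

/-- Inversion of continuous linear maps is smooth at invertible ones, and q is invertible at each
point of the chart. -/
theorem Coords.contDiffOn_gradHat (hg : (C.data g.form).IsGaugeFixed)
    (hne : (C.data g.form).IsNonExpanding) (hc : c ∈ IsManifold.maximalAtlas (𝓡 2) ∞ S2)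
    {f : Sig → ℝ} (hf : ContMDiff IS 𝓘(ℝ, ℝ) ∞ f) :
    ContDiffOn ℝ ∞ (C.gradHat g c f) (univ ×ˢ c.target) := by
  have h1 : ContDiffOn ℝ ∞ (fderiv ℝ (fun z => f (slab c z))) (univ ×ˢ c.target) :=
    (contDiffOn_comp_slab hc hf).fderiv_of_isOpen (isOpen_slab c) (by simp)
  have h2 : ContDiffOn ℝ ∞ (fun z => (C.qHat g c z).inverse) (univ ×ˢ c.target) := by
    intro z hz
    have h := Coords.bijective_qHat hg hne hc hz.2
    let e : E2 ≃L[ℝ] (E2 →L[ℝ] ℝ) := ContinuousLinearEquiv.ofBijective (C.qHat g c z)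
      (LinearMap.ker_eq_bot.2 h.1) (LinearMap.range_eq_top.2 h.2)
    exact ContDiffAt.comp_contDiffWithinAt (g := ContinuousLinearMap.inverse) z
      (contDiffAt_map_inverse e) (Coords.contDiffOn_qHat hc z hz)
  exact h2.clm_apply (h1.clm_comp contDiffOn_const)

end Gradient

/-! ### The transverse derivative of the pulled-back metric -/

/-- The Lie derivative of a field of bilinear forms on a vector space. -/
def lieCoord {E : Type*} [NormedAddCommGroup E] [NormedSpace ℝ E] (B : E → E →L[ℝ] E →L[ℝ] ℝ)
    (W : E → E) (y X X' : E) : ℝ :=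
  fderiv ℝ (fun y => B y X X') y (W y) + B y (fderiv ℝ W y X) X' + B y X (fderiv ℝ W y X')

section Transformation

variable {M : Type*} [TopologicalSpace M] [ChartedSpace E4 M] [IsManifold (𝓡 4) ∞ M]
  {g : LorentzMetric M} {C : Coords M} {c : OpenPartialHomeomorph S2 E2} {f : Sig → ℝ}
  {Y : S2 ≃ₘ^∞⟮𝓡 2, 𝓡 2⟯ S2} {F : PartialDiffeomorph (𝓡 4) (𝓡 4) M M ∞}

/-- The tangential part of the change of rigging that a symmetry makes. -/
def Coords.shift (C : Coords M) (g : LorentzMetric M) (f : Sig → ℝ) (σ : Sig) : ℝ × E2 :=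
  (1 / fu f σ) •
    (1 / (2 * fu f σ) * C.qForm g σ.2 (C.grad g f σ) (C.grad g f σ), -C.grad g f σ)

/-- Moves the tangential part of the jet back through dζ, so that the condition on dF(ℓ) reads: dF
maps ℓ - W to ρℓ, with W the shift and ρ = 1/f_u. The sign of the n-component changes because dζ
adds -|grad f|² to it. -/
theorem IsAdmissible.jet_eq (hg : (C.data g.form).IsGaugeFixed)
    (hA : IsAdmissible (C.data g.form) f Y) (σ : Sig) :
    C.jet g f Y σ = (1 / fu f σ) • C.ell (pairMap f Y σ) +
      C.DΦ (pairMap f Y σ) (dmap (pairMap f Y) σ (C.shift g f σ)) := by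
  have h1 : dS f σ.1 σ.2 (-C.grad g f σ) = -C.qForm g σ.2 (C.grad g f σ) (C.grad g f σ) := by
    rw [← Coords.qForm_grad hg, map_neg]
  have h2 : dmap (pairMap f Y) σ (C.shift g f σ) = (1 / fu f σ) •
      -(1 / 2 * C.qForm g σ.2 (C.grad g f σ) (C.grad g f σ), dsph Y σ.2 (C.grad g f σ)) := by
    rw [Coords.shift, map_smul, hA.dmap_apply]
    congr 1
    refine Prod.ext ?_ (map_neg _ _)
    dsimp only
    rw [h1]
    have := hA.fu_ne_zero σ
    change _ = -(1 / 2 * C.qForm g σ.2 (C.grad g f σ) (C.grad g f σ))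
    field_simp
    ring
  rw [h2, Coords.jet, map_smul, map_neg, ← smul_add, ← sub_eq_add_neg]

/-- The components of `Coords.shift` in the coordinates of `slab c`. -/
def Coords.shiftHat (C : Coords M) (g : LorentzMetric M) (c : OpenPartialHomeomorph S2 E2)
    (f : Sig → ℝ) (z : ℝ × E2) : ℝ × E2 :=
  (1 / fu f (slab c z)) • (1 / (2 * fu f (slab c z)) *
    C.qHat g c z (C.gradHat g c f z) (C.gradHat g c f z), -C.gradHat g c f z)

theorem Coords.dslab_shiftHat (hg : (C.data g.form).IsGaugeFixed)
    (hne : (C.data g.form).IsNonExpanding) (hc : c ∈ IsManifold.maximalAtlas (𝓡 2) ∞ S2)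
    (hf : ContMDiff IS 𝓘(ℝ, ℝ) ∞ f) {z : ℝ × E2} (hz : z.2 ∈ c.target) :
    dslab c z (C.shiftHat g c f z) = C.shift g f (slab c z) := by
  rw [Coords.shiftHat, Coords.shift, map_smul, dslab_apply hc hz]
  dsimp only
  rw [map_neg, Coords.qHat_apply hg hne hc hz, Coords.dchart_gradHat hg hne hc hf hz]
  rfl

theorem contDiffOn_inv_fu (hc : c ∈ IsManifold.maximalAtlas (𝓡 2) ∞ S2)
    (hf : ContMDiff IS 𝓘(ℝ, ℝ) ∞ f) (h0 : ∀ σ, fu f σ ≠ 0) :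
    ContDiffOn ℝ ∞ (fun z => 1 / fu f (slab c z)) (univ ×ˢ c.target) :=
  contDiffOn_const.div (contDiffOn_comp_slab hc (contMDiff_fu hf)) (fun _ _ => h0 _)

theorem Coords.contDiffOn_shiftHat (hg : (C.data g.form).IsGaugeFixed)
    (hne : (C.data g.form).IsNonExpanding) (hc : c ∈ IsManifold.maximalAtlas (𝓡 2) ∞ S2)
    (hf : ContMDiff IS 𝓘(ℝ, ℝ) ∞ f) (h0 : ∀ σ, fu f σ ≠ 0) :
    ContDiffOn ℝ ∞ (C.shiftHat g c f) (univ ×ˢ c.target) := by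
  have h1 := contDiffOn_comp_slab hc (contMDiff_fu hf)
  have h2 := Coords.contDiffOn_gradHat hg hne hc hf
  refine (contDiffOn_inv_fu hc hf h0).smul (ContDiffOn.prodMk (ContDiffOn.mul ?_ ?_) h2.neg)
  · exact contDiffOn_const.div (contDiffOn_const.mul h1) fun z _ => mul_ne_zero two_ne_zero (h0 _)
  · exact ((Coords.contDiffOn_qHat hc).clm_apply h2).clm_apply h2

/-- `Y_ab` in the coordinates of `slab`. -/
theorem Coords.data_Y_slab (hc : c ∈ IsManifold.maximalAtlas (𝓡 2) ∞ S2) {z : ℝ × E2}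
    (hz : z.2 ∈ c.target) (a a' : ℝ × E2) :
    (C.data g.form).Y (slab c z) (dslab c z a) (dslab c z a') =
      1 / 2 * fderiv ℝ (pullForm g (C.param hc)) (z, 0) (0, 1) (a, 0) (a', 0) := by
  let S := C.param hc
  let B := pullForm g S
  have hS : (z, (0 : ℝ)) ∈ S.source := Coords.mem_param_source hz (C.zero_mem _)
  have hB : ContDiffOn ℝ ∞ B S.source := contDiffOn_pullForm g S.open_source S.contMDiffOn
  have hBd : DifferentiableAt ℝ B (z, 0) :=
    (hB.contDiffAt (S.open_source.mem_nhds hS)).differentiableAt (by simp)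
  have h1 : HasFDerivAt (fun r : ℝ => (z, r)) (ContinuousLinearMap.inr ℝ (ℝ × E2) ℝ) 0 :=
    hasFDerivAt_prodMk_right z 0
  have h2 : HasFDerivAt (fun r : ℝ => B (z, r)) _ 0 :=
    HasFDerivAt.comp (g := B) (0 : ℝ) hBd.hasFDerivAt h1
  have h3 := ((h2.clm_apply (hasFDerivAt_const (a, (0 : ℝ)) (0 : ℝ))).clm_apply
    (hasFDerivAt_const (a', (0 : ℝ)) (0 : ℝ))).hasDerivAt.deriv
  have h4 : deriv (fun r : ℝ => B (z, r) (a, 0) (a', 0)) 0 =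
      fderiv ℝ B (z, 0) (0, 1) (a, 0) (a', 0) := by
    rw [h3]
    simp
  have h5 : ∀ᶠ r in nhds (0 : ℝ), (z, r) ∈ S.source :=
    (Continuous.prodMk_right z).continuousAt.eventually (S.open_source.mem_nhds hS)
  have h6 : (fun r : ℝ => B (z, r) (a, 0) (a', 0)) =ᶠ[nhds 0] fun r =>
      g.form (C.ψ (slab c z, r))
        (mfderiv IS (𝓡 4) (fun τ : Sig => C.ψ (τ, r)) (slab c z) (dslab c z a))
        (mfderiv IS (𝓡 4) (fun τ : Sig => C.ψ (τ, r)) (slab c z) (dslab c z a')) := by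
    filter_upwards [h5] with r hr
    refine (congrArg₂ (fun a b : E4 => (g.val (C.ψ (slab c z, r)) : E4 →L[ℝ] E4 →L[ℝ] ℝ) a b)
      (Coords.mfderiv_param hr (a, 0)) (Coords.mfderiv_param hr (a', 0))).trans ?_
    exact (congrArg₂ (fun a b : E4 => (g.val (C.ψ (slab c z, r)) : E4 →L[ℝ] E4 →L[ℝ] ℝ) a b)
      (C.mfderiv_ψ_left hr.2 (dslab c z a)) (C.mfderiv_ψ_left hr.2 (dslab c z a'))).symm
  refine Eq.trans ?_ (congrArg (1 / 2 * ·) h4)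
  rw [h6.deriv_eq]
  rfl

/-- The transformation of `Y_ab` under a symmetry, in the coordinates of a chart of the sphere. -/
theorem IsHypersurfaceSymmetry.data_Y_eq (hg : (C.data g.form).IsGaugeFixed)
    (hne : (C.data g.form).IsNonExpanding) (hF : IsHypersurfaceSymmetry g.form C F)
    (hI : Induces C F f Y) (hc : c ∈ IsManifold.maximalAtlas (𝓡 2) ∞ S2) {z₀ : ℝ × E2}
    (hz₀ : z₀.2 ∈ c.target) (X X' : ℝ × E2) :
    (C.data (pullback F g.form)).Y (slab c z₀) (dslab c z₀ X) (dslab c z₀ X') =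
      1 / 2 * (lieCoord (pullForm g fun z => C.Φ (slab c z)) (C.shiftHat g c f) z₀ X X'
        + 1 / fu f (slab c z₀) * (2 * (C.data g.form).Y (pairMap f Y (slab c z₀))
          (dmap (pairMap f Y) (slab c z₀) (dslab c z₀ X))
          (dmap (pairMap f Y) (slab c z₀) (dslab c z₀ X')))
        + fderiv ℝ (fun z => 1 / fu f (slab c z)) z₀ X *
          (dmap (pairMap f Y) (slab c z₀) (dslab c z₀ X')).1
        + fderiv ℝ (fun z => 1 / fu f (slab c z)) z₀ X' *
          (dmap (pairMap f Y) (slab c z₀) (dslab c z₀ X)).1) := by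
  have hA := hF.isAdmissible hg hne hI
  have hζ := hI.intertwines
  have hs := hF.subset_source
  let gv : M → E4 →L[ℝ] E4 →L[ℝ] ℝ := fun p => g.val p
  obtain ⟨c', hc', y', hy', hx'⟩ := exists_chart (pairMap f Y (slab c z₀)).2
  let z₀' : ℝ × E2 := (f (slab c z₀), y')
  have hz₀' : slab c' z₀' = pairMap f Y (slab c z₀) := Prod.ext rfl hx'
  let S := C.param hc
  let S' := C.param hc'
  -- F in adapted charts around the point and around its image, so that the vector-space formula
  -- `hasDerivAt_bilin_pull` applies.
  let T := (S.trans F).trans S'.symm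
  have hS'0 : (z₀', (0 : ℝ)) ∈ S'.source := Coords.mem_param_source hy' (C.zero_mem _)
  have hFS : F (S (z₀, 0)) = S' (z₀', 0) := by
    refine (hζ (slab c z₀)).trans ?_
    rw [← hz₀']
    rfl
  have hp₀ : (z₀, (0 : ℝ)) ∈ T.source := by
    refine ⟨⟨Coords.mem_param_source hz₀ (C.zero_mem _), mem_source_of_subset hs _⟩, ?_⟩
    change F (S (z₀, 0)) ∈ S'.target
    rw [hFS]
    exact S'.map_source hS'0
  have hTp₀ : T (z₀, 0) = (z₀', 0) := by
    change S'.symm (F (S (z₀, 0))) = _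
    rw [hFS]
    exact S'.left_inv hS'0
  have hS'T : ∀ p ∈ T.source, S' (T p) = F (S p) := fun p hp => S'.right_inv hp.2
  have hTS' : ∀ p ∈ T.source, T p ∈ S'.source := fun p hp => S'.map_target hp.2
  have hmf : ∀ p ∈ T.source, ∀ A : (ℝ × E2) × ℝ,
      C.dψ (slab c' (T p).1, (T p).2) (dslab c' (T p).1 (fderiv ℝ T p A).1, (fderiv ℝ T p A).2) =
        dspt F (S p) (C.dψ (slab c p.1, p.2) (dslab c p.1 A.1, A.2)) := by
    intro p hp A
    have h1 := mfderiv_comp_apply p (S'.mdifferentiableAt (by simp) (hTS' p hp))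
      (T.mdifferentiableAt (by simp) hp) A
    have h2 := mfderiv_comp_apply p (F.mdifferentiableAt (by simp) hp.1.2)
      (S.mdifferentiableAt (by simp) hp.1.1) A
    have h3 : S' ∘ T =ᶠ[nhds p] F ∘ S :=
      Filter.eventually_of_mem (T.open_source.mem_nhds hp) hS'T
    rw [h3.mfderiv_eq, mfderiv_eq_fderiv] at h1
    refine (Coords.mfderiv_param (hTS' p hp) _).symm.trans ((h1.symm.trans h2).trans ?_)
    exact congrArg (dspt F (S p)) (Coords.mfderiv_param hp.1.1 A)
  let B := pullForm g S'
  have hB : ContDiffOn ℝ ∞ B S'.source := contDiffOn_pullForm g S'.open_source S'.contMDiffOn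
  have hBd : DifferentiableAt ℝ B (T (z₀, 0)) :=
    (hB.contDiffAt (S'.open_source.mem_nhds (hTS' _ hp₀))).differentiableAt (by simp)
  have hTd : ContDiffAt ℝ 2 T (z₀, 0) :=
    ((T.contMDiffOn.contDiffOn).contDiffAt (T.open_source.mem_nhds hp₀)).of_le
      (WithTop.coe_le_coe.2 le_top)
  have hBval : ∀ p ∈ S'.source, ∀ A A' : (ℝ × E2) × ℝ, B p A A' =
      gv (S' p) (C.dψ (slab c' p.1, p.2) (dslab c' p.1 A.1, A.2))
        (C.dψ (slab c' p.1, p.2) (dslab c' p.1 A'.1, A'.2)) := by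
    intro p hp A A'
    exact congrArg₂ (fun a b : E4 => gv (S' p) a b) (Coords.mfderiv_param hp A)
      (Coords.mfderiv_param hp A')
  have hpull : ∀ p ∈ T.source, ∀ A A' : (ℝ × E2) × ℝ,
      B (T p) (fderiv ℝ T p A) (fderiv ℝ T p A') =
        gv (F (S p)) (dspt F (S p) (C.dψ (slab c p.1, p.2) (dslab c p.1 A.1, A.2)))
          (dspt F (S p) (C.dψ (slab c p.1, p.2) (dslab c p.1 A'.1, A'.2))) := by
    intro p hp A A'
    rw [hBval _ (hTS' p hp), hmf p hp, hmf p hp, hS'T p hp]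
  -- On {r = 0} the symmetry condition replaces F^*g by g itself, so the tangential Lie derivative
  -- that appears below is that of γ.
  have hpull0 : ∀ y, (y, (0 : ℝ)) ∈ T.source → ∀ A A' : ℝ × E2,
      B (T (y, 0)) (fderiv ℝ T (y, 0) (A, 0)) (fderiv ℝ T (y, 0) (A', 0)) =
        pullForm g (fun z => C.Φ (slab c z)) y A A' := by
    intro y hy A A'
    have h1 : ∀ X X' : E4, gv (F (C.Φ (slab c y))) (dspt F (C.Φ (slab c y)) X)
        (dspt F (C.Φ (slab c y)) X') = C.gram g (slab c y) X X' := fun X X' =>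
      hF.metric_eq _ (mem_range_self _) X X'
    rw [hpull _ hy, Coords.pullForm_slab_apply hc hy.1.1.1]
    refine (h1 _ _).trans ?_
    dsimp only
    rw [← C.DΦ_apply, ← C.DΦ_apply]
    rfl
  have hloc : ∀ y, (y, (0 : ℝ)) ∈ T.source →
      (slab c' (T (y, 0)).1, (T (y, 0)).2) = (pairMap f Y (slab c y), (0 : ℝ)) := by
    intro y hy
    exact C.ψ.injOn (hTS' _ hy).2 (C.zero_mem _) ((hS'T _ hy).trans (hζ _))
  have hmem : ∀ᶠ y in nhds z₀, (y, (0 : ℝ)) ∈ T.source :=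
    (Continuous.prodMk_left (0 : ℝ)).continuousAt.eventually (T.open_source.mem_nhds hp₀)
  have hnhds : (univ : Set ℝ) ×ˢ c.target ∈ nhds z₀ := (isOpen_slab c).mem_nhds ⟨mem_univ _, hz₀⟩
  have hW : DifferentiableAt ℝ (C.shiftHat g c f) z₀ :=
    ((Coords.contDiffOn_shiftHat hg hne hc hA.smooth hA.fu_ne_zero).contDiffAt
      hnhds).differentiableAt (by simp)
  have hρ : DifferentiableAt ℝ (fun z => 1 / fu f (slab c z)) z₀ :=
    ((contDiffOn_inv_fu hc hA.smooth hA.fu_ne_zero).contDiffAt hnhds).differentiableAt (by simp)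
  -- The rule for dF(ℓ) in the form of `jet_eq`, at all points of {r = 0} near z₀, as it has to be
  -- differentiated along {r = 0}.
  have hZ : ∀ᶠ y in nhds z₀, fderiv ℝ T (y, 0) (-C.shiftHat g c f y, 1) =
      (0, 1 / fu f (slab c y)) := by
    filter_upwards [hmem] with y hy
    have hyt : y.2 ∈ c.target := hy.1.1.1
    refine (S'.bijective_mfderiv (hTS' _ hy)).1 ?_
    refine (Coords.mfderiv_param (hTS' _ hy) _).trans (Eq.trans ?_
      (Coords.mfderiv_param (hTS' _ hy) _).symm)
    rw [hmf _ hy, hloc y hy]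
    dsimp only
    rw [map_zero, map_neg, C.dψ_zero_apply, C.dψ_zero_apply, one_smul, map_zero, add_zero, map_add]
    refine (congrArg₂ (· + ·) (hF.dspt_ell hg hne hI (slab c y)) (dspt_DΦ hs hζ (slab c y) _)).trans
      ?_
    rw [Coords.dslab_shiftHat hg hne hc hA.smooth hyt, hA.jet_eq hg, map_neg, map_neg]
    abel
  have main := hasDerivAt_bilin_pull hBd hTd hW hρ hZ X X'
  have hT0 : ∀ X : ℝ × E2, dslab c' z₀' (fderiv ℝ T (z₀, 0) (X, 0)).1 =
      dmap (pairMap f Y) (slab c z₀) (dslab c z₀ X) ∧ (fderiv ℝ T (z₀, 0) (X, 0)).2 = 0 := by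
    intro X
    have h1 := hmf _ hp₀ (X, 0)
    rw [hTp₀] at h1
    dsimp only at h1
    rw [hz₀'] at h1
    have h2 : dspt F (S (z₀, 0)) (C.dψ (slab c z₀, 0) (dslab c z₀ X, 0)) =
        C.dψ (pairMap f Y (slab c z₀), 0) (dmap (pairMap f Y) (slab c z₀) (dslab c z₀ X), 0) := by
      rw [← C.DΦ_apply, ← C.DΦ_apply]
      exact dspt_DΦ hs hζ _ _
    have h3 := (C.bijective_dψ (C.zero_mem _)).1 (h1.trans h2)
    exact ⟨(Prod.mk.inj h3).1, (Prod.mk.inj h3).2⟩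
  have hY : ∀ a a' : ℝ × E2, fderiv ℝ B (z₀', 0) (0, 1) (a, 0) (a', 0) =
      2 * (C.data g.form).Y (pairMap f Y (slab c z₀)) (dslab c' z₀' a) (dslab c' z₀' a') := by
    intro a a'
    rw [← hz₀', Coords.data_Y_slab hc' (z := z₀') hy']
    ring
  have hY' : (C.data (pullback F g.form)).Y (slab c z₀) (dslab c z₀ X) (dslab c z₀ X') =
      1 / 2 * deriv (fun r => B (T (z₀, r)) (fderiv ℝ T (z₀, r) (X, 0))
        (fderiv ℝ T (z₀, r) (X', 0))) 0 := by
    have h5 : ∀ᶠ r in nhds (0 : ℝ), (z₀, r) ∈ T.source :=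
      (Continuous.prodMk_right z₀).continuousAt.eventually (T.open_source.mem_nhds hp₀)
    have h6 : (fun r => B (T (z₀, r)) (fderiv ℝ T (z₀, r) (X, 0))
        (fderiv ℝ T (z₀, r) (X', 0))) =ᶠ[nhds 0] fun r =>
        pullback F g.form (C.ψ (slab c z₀, r))
          (mfderiv IS (𝓡 4) (fun τ : Sig => C.ψ (τ, r)) (slab c z₀) (dslab c z₀ X))
          (mfderiv IS (𝓡 4) (fun τ : Sig => C.ψ (τ, r)) (slab c z₀) (dslab c z₀ X')) := by
      filter_upwards [h5] with r hr
      rw [hpull _ hr]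
      exact (congrArg₂ (fun a b : E4 => gv (F (C.ψ (slab c z₀, r)))
        (dspt F (C.ψ (slab c z₀, r)) a) (dspt F (C.ψ (slab c z₀, r)) b))
        (C.mfderiv_ψ_left hr.1.1.2 (dslab c z₀ X))
        (C.mfderiv_ψ_left hr.1.1.2 (dslab c z₀ X'))).symm
    rw [h6.deriv_eq]
    rfl
  have hform : ∀ X : ℝ × E2, B (z₀', 0) (0, 1) (fderiv ℝ T (z₀, 0) (X, 0)) =
      (dmap (pairMap f Y) (slab c z₀) (dslab c z₀ X)).1 := by
    intro X
    rw [hBval _ hS'0, (hT0 X).1, (hT0 X).2]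
    dsimp only
    rw [map_zero, ← C.ell_eq, ← C.DΦ_apply, hz₀', ← Coords.gram_ell_DΦ hg]
    have : S' (z₀', 0) = C.Φ (pairMap f Y (slab c z₀)) := by
      rw [← hz₀']
      rfl
    rw [this]
    rfl
  have hform' : ∀ X : ℝ × E2, B (z₀', 0) (fderiv ℝ T (z₀, 0) (X, 0)) (0, 1) =
      (dmap (pairMap f Y) (slab c z₀) (dslab c z₀ X)).1 := fun X =>
    (g.symm _ _ _).trans (hform X)
  have hterm : fderiv ℝ (fun y => B (T (y, 0)) (fderiv ℝ T (y, 0) (X, 0))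
      (fderiv ℝ T (y, 0) (X', 0))) z₀ =
      fderiv ℝ (fun y => pullForm g (fun z => C.Φ (slab c z)) y X X') z₀ := by
    refine Filter.EventuallyEq.fderiv_eq ?_
    filter_upwards [hmem] with y hy using hpull0 y hy X X'
  have hpair : ∀ X, fderiv ℝ T (z₀, 0) (X, 0) = ((fderiv ℝ T (z₀, 0) (X, 0)).1, 0) := fun X =>
    Prod.ext rfl (hT0 X).2
  have hY2 : fderiv ℝ B (z₀', 0) (0, 1) (fderiv ℝ T (z₀, 0) (X, 0))
      (fderiv ℝ T (z₀, 0) (X', 0)) = 2 * (C.data g.form).Y (pairMap f Y (slab c z₀))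
          (dmap (pairMap f Y) (slab c z₀) (dslab c z₀ X))
          (dmap (pairMap f Y) (slab c z₀) (dslab c z₀ X')) := by
    rw [hpair X, hpair X', hY, (hT0 X).1, (hT0 X').1]
  rw [hY', main.deriv, hpull0 _ hp₀, hpull0 _ hp₀, hterm, hTp₀, hY2, hform, hform']
  rfl

end Transformation

/-! ### The action on the data as a gauge transformation -/

section Gauge

variable {M : Type*} [TopologicalSpace M] [ChartedSpace E4 M] [IsManifold (𝓡 4) ∞ M]
  {g : LorentzMetric M} {C : Coords M} {f : Sig → ℝ}
  {Y : S2 ≃ₘ^∞⟮𝓡 2, 𝓡 2⟯ S2} {F : PartialDiffeomorph (𝓡 4) (𝓡 4) M M ∞}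

theorem IsAdmissible.bijective_dmap {D : HData} (hA : IsAdmissible D f Y) (σ : Sig) :
    Function.Bijective (dmap (pairMap f Y) σ) := by
  have h := hA.dmap_apply σ
  have hY : Function.Bijective (dsph Y σ.2) :=
    (Y.mfderivToContinuousLinearEquiv (by simp) σ.2).bijective
  have h0 := hA.fu_ne_zero σ
  constructor
  · intro X X' hX
    rw [h, h] at hX
    have h2 : X.2 = X'.2 := hY.1 (Prod.mk.inj hX).2
    refine Prod.ext ?_ h2
    have h3 := (Prod.mk.inj hX).1
    rw [h2] at h3
    exact mul_left_cancel₀ h0 (add_right_cancel h3)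
  · rintro ⟨a, w⟩
    obtain ⟨v, hv⟩ := hY.2 w
    refine ⟨((a - dS f σ.1 σ.2 v) / fu f σ, v), ?_⟩
    rw [h]
    refine Prod.ext ?_ hv
    dsimp only
    field_simp
    ring

theorem IsAdmissible.exists_diffeomorph {D : HData} (hA : IsAdmissible D f Y) :
    ∃ ζ : Sig ≃ₘ^∞⟮IS, IS⟯ Sig, ∀ σ, ζ σ = pairMap f Y σ := by
  have hl : IsLocalDiffeomorph IS IS ∞ (pairMap f Y) := fun σ =>
    isLocalDiffeomorphAt_of_mfderiv isOpen_univ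
      (contMDiff_pairMap hA.smooth Y.contMDiff).contMDiffOn (mem_univ σ) (hA.bijective_dmap σ)
  exact ⟨hl.diffeomorphOfBijective hA.bijective, fun σ => rfl⟩

/-- The coordinates at `σ` are those of `slab`. -/
theorem mfderiv_extChartAt_slab {σ : Sig} {y : ℝ × E2} (hy : y.2 ∈ (chartAt E2 σ.2).target)
    (A : ℝ × E2) : (mfderiv IS 𝓘(ℝ, ℝ × E2) (extChartAt IS σ) (slab (chartAt E2 σ.2) y)
      (dslab (chartAt E2 σ.2) y A) : ℝ × E2) = A := by
  have hc : chartAt E2 σ.2 ∈ IsManifold.maximalAtlas (𝓡 2) ∞ S2 :=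
    IsManifold.chart_mem_maximalAtlas σ.2
  have hs : slab (chartAt E2 σ.2) y ∈ (chartAt (ModelProd ℝ E2) σ).source :=
    ⟨mem_univ _, (chartAt E2 σ.2).map_target hy⟩
  have h1 := mfderiv_comp_apply y (mdifferentiableAt_extChartAt (I := IS) hs)
    (mdifferentiableAt_slab hc hy) A
  have h2 : extChartAt IS σ ∘ slab (chartAt E2 σ.2) =ᶠ[nhds y] id := by
    filter_upwards [(isOpen_slab (chartAt E2 σ.2)).mem_nhds ⟨mem_univ _, hy⟩] with z hz
    exact Prod.ext rfl ((chartAt E2 σ.2).right_inv hz.2)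
  rw [h2.mfderiv_eq, mfderiv_id] at h1
  exact h1.symm

/-- The tangent space at σ is modelled through the preferred chart at σ, whose own differential at σ
is therefore the identity. This lets coordinate formulas at σ be read as intrinsic ones. -/
theorem dslab_self (σ : Sig) (X : ℝ × E2) :
    dslab (chartAt E2 σ.2) (σ.1, chartAt E2 σ.2 σ.2) X = X := by
  have h1 := mfderiv_extChartAt_slab (σ := σ) (y := (σ.1, chartAt E2 σ.2 σ.2))
    (mem_chart_target E2 σ.2) X
  have h2 : slab (chartAt E2 σ.2) (σ.1, chartAt E2 σ.2 σ.2) = σ :=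
    Prod.ext rfl ((chartAt E2 σ.2).left_inv (mem_chart_source E2 σ.2))
  have h3 : ∀ τ, τ = σ → ∀ B : ℝ × E2,
      (mfderiv IS 𝓘(ℝ, ℝ × E2) (extChartAt IS σ) τ B : ℝ × E2) = B := by
    rintro τ rfl B
    exact congrArg (fun L : ℝ × E2 →L[ℝ] ℝ × E2 => L B) (mfderiv_extChartAt_self (I := IS))
  exact (h3 _ h2 _).symm.trans h1

theorem lieDeriv_gammaForm_shift (hg : (C.data g.form).IsGaugeFixed)
    (hne : (C.data g.form).IsNonExpanding) (hf : ContMDiff IS 𝓘(ℝ, ℝ) ∞ f) (σ : Sig)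
    (X X' : ℝ × E2) :
    lieDeriv (fun σ X X' => C.gammaForm g σ X X') (C.shift g f) σ X X' =
      lieCoord (pullForm g fun z => C.Φ (slab (chartAt E2 σ.2) z))
        (C.shiftHat g (chartAt E2 σ.2) f) (σ.1, chartAt E2 σ.2 σ.2) X X' := by
  have hc : chartAt E2 σ.2 ∈ IsManifold.maximalAtlas (𝓡 2) ∞ S2 :=
    IsManifold.chart_mem_maximalAtlas σ.2
  have hnhds : (univ : Set ℝ) ×ˢ (chartAt E2 σ.2).target ∈ nhds (σ.1, chartAt E2 σ.2 σ.2) :=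
    (isOpen_slab _).mem_nhds ⟨mem_univ _, mem_chart_target E2 σ.2⟩
  have hT : ∀ y ∈ (univ : Set ℝ) ×ˢ (chartAt E2 σ.2).target, ∀ A B : ℝ × E2,
      C.gammaForm g (slab (chartAt E2 σ.2) y) (dslab (chartAt E2 σ.2) y A)
        (dslab (chartAt E2 σ.2) y B) = pullForm g (fun z => C.Φ (slab (chartAt E2 σ.2) z)) y A B :=
    fun y hy A B => (Coords.pullForm_slab_apply hc hy.2 A B).symm
  have hW : (fun y => (mfderiv IS 𝓘(ℝ, ℝ × E2) (extChartAt IS σ) (slab (chartAt E2 σ.2) y)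
      (C.shift g f (slab (chartAt E2 σ.2) y)) : ℝ × E2)) =ᶠ[nhds (σ.1, chartAt E2 σ.2 σ.2)]
      C.shiftHat g (chartAt E2 σ.2) f := by
    filter_upwards [hnhds] with y hy
    rw [← Coords.dslab_shiftHat hg hne hc hf hy.2]
    exact mfderiv_extChartAt_slab hy.2 _
  have h1 : (fun y => C.gammaForm g (slab (chartAt E2 σ.2) y) (dslab (chartAt E2 σ.2) y X)
        (dslab (chartAt E2 σ.2) y X')) =ᶠ[nhds (σ.1, chartAt E2 σ.2 σ.2)]
      fun y => pullForm g (fun z => C.Φ (slab (chartAt E2 σ.2) z)) y X X' := by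
    filter_upwards [hnhds] with y hy using hT y hy X X'
  have h2 := mem_of_mem_nhds hnhds
  rw [lieCoord, ← h1.fderiv_eq, ← hW.fderiv_eq, ← hT _ h2, ← hT _ h2, ← hW.self_of_nhds]
  rfl

/-- Smoothness of a vector field on `Σ`, from its components in the coordinates of `slab`. -/
theorem contMDiff_section_of_slab {W : Sig → ℝ × E2}
    (h : ∀ c ∈ IsManifold.maximalAtlas (𝓡 2) ∞ S2, ∃ What : ℝ × E2 → ℝ × E2,
      ContDiffOn ℝ ∞ What (univ ×ˢ c.target) ∧
      ∀ z : ℝ × E2, z.2 ∈ c.target → dslab c z (What z) = W (slab c z)) :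
    ContMDiff IS IS.tangent ∞ (fun σ => (⟨σ, W σ⟩ : TangentBundle IS Sig)) := by
  rintro ⟨u, x⟩
  obtain ⟨c, hc, y, hy, rfl⟩ := exists_chart x
  obtain ⟨What, hs, hW⟩ := h c hc
  have h1 : ContMDiffOn 𝓘(ℝ, ℝ × E2) 𝓘(ℝ, ℝ × E2).tangent ∞
      (fun z => (⟨z, What z⟩ : TangentBundle 𝓘(ℝ, ℝ × E2) (ℝ × E2))) (univ ×ˢ c.target) :=
    contMDiffOn_vectorSpace_iff_contDiffOn.2 hs
  have h2 := (contMDiffOn_slab hc).contMDiffOn_tangentMapWithin (m := ∞) (by simp)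
    (isOpen_slab c).uniqueMDiffOn
  have h3 : ContMDiffOn 𝓘(ℝ, ℝ × E2) IS.tangent ∞
      (fun z => (⟨slab c z, dslab c z (What z)⟩ : TangentBundle IS Sig)) (univ ×ˢ c.target) := by
    refine (h2.comp h1 (fun z hz => hz)).congr (fun z hz => ?_)
    simp only [Function.comp, tangentMapWithin, mfderivWithin_of_isOpen (isOpen_slab c) hz]
    rfl
  have h4 : ContMDiffAt IS 𝓘(ℝ, ℝ × E2) ∞ (fun σ : Sig => (σ.1, c σ.2)) (u, c.symm y) := by
    refine contMDiffAt_fst.prodMk_space ?_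
    exact (contMDiffAt_of_mem_maximalAtlas hc (c.map_target hy)).comp (u, c.symm y) contMDiffAt_snd
  have h5 := (h3.contMDiffAt ((isOpen_slab c).mem_nhds
    (show (u, c (c.symm y)) ∈ _ from ⟨mem_univ _, c.map_source (c.map_target hy)⟩))).comp
    (u, c.symm y) h4
  refine h5.congr_of_eventuallyEq ?_
  have h6 : ∀ᶠ σ : Sig in nhds (u, c.symm y), σ.2 ∈ c.source :=
    continuousAt_snd.eventually (c.open_source.mem_nhds (c.map_target hy))
  filter_upwards [h6] with σ hσ
  have h7 : slab c (σ.1, c σ.2) = σ := Prod.ext rfl (c.left_inv hσ)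
  rw [Function.comp, hW (σ.1, c σ.2) (c.map_source hσ), h7]

/-- The shift of the rigging, before rescaling. -/
def Coords.shiftField (C : Coords M) (g : LorentzMetric M) (f : Sig → ℝ) (σ : Sig) :
    TangentSpace IS σ :=
  vec σ (1 / (2 * fu f σ) * C.qForm g σ.2 (C.grad g f σ) (C.grad g f σ)) (-C.grad g f σ : E2)

theorem contMDiff_shiftField (hg : (C.data g.form).IsGaugeFixed)
    (hne : (C.data g.form).IsNonExpanding) (hf : ContMDiff IS 𝓘(ℝ, ℝ) ∞ f)
    (h0 : ∀ σ, fu f σ ≠ 0) :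
    ContMDiff IS IS.tangent ∞
      (fun σ => (⟨σ, C.shiftField g f σ⟩ : TangentBundle IS Sig)) := by
  refine contMDiff_section_of_slab (W := C.shiftField g f) fun c hc =>
    ⟨fun z => fu f (slab c z) • C.shiftHat g c f z,
      (contDiffOn_comp_slab hc (contMDiff_fu hf)).smul
        (Coords.contDiffOn_shiftHat hg hne hc hf h0), fun z hz => ?_⟩
  dsimp only
  rw [map_smul, Coords.dslab_shiftHat hg hne hc hf hz, Coords.shift, smul_smul,
    mul_one_div_cancel (h0 _), one_smul]
  rfl

theorem IsHypersurfaceSymmetry.data_Y_eq_rig (hg : (C.data g.form).IsGaugeFixed)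
    (hne : (C.data g.form).IsNonExpanding) (hF : IsHypersurfaceSymmetry g.form C F)
    (hI : Induces C F f Y) (σ : Sig) (X X' : ℝ × E2) :
    (C.data (pullback F g.form)).Y σ X X' =
      1 / fu f σ * (C.data g.form).Y (pairMap f Y σ) (dmap (pairMap f Y) σ X)
        (dmap (pairMap f Y) σ X')
      + 1 / 2 * (dfun (fun σ => 1 / fu f σ) σ X * (dmap (pairMap f Y) σ X').1
        + dfun (fun σ => 1 / fu f σ) σ X' * (dmap (pairMap f Y) σ X).1)
      + 1 / 2 * lieDeriv (fun σ X X' => C.gammaForm g σ X X') (C.shift g f) σ X X' := by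
  have hA := hF.isAdmissible hg hne hI
  have hu : ContMDiff IS 𝓘(ℝ, ℝ) ∞ (fun σ => 1 / fu f σ) :=
    contMDiff_const.div₀ (contMDiff_fu hA.smooth) hA.fu_ne_zero
  -- The chart is kept arbitrary, so that σ can be replaced by `slab c z`; for the preferred chart
  -- itself, which depends on σ, this substitution would be circular.
  have key : ∀ c ∈ IsManifold.maximalAtlas (𝓡 2) ∞ S2, ∀ z : ℝ × E2, z.2 ∈ c.target →
      slab c z = σ → (∀ X, dslab c z X = X) →
      (C.data (pullback F g.form)).Y σ X X' =
      1 / fu f σ * (C.data g.form).Y (pairMap f Y σ) (dmap (pairMap f Y) σ X)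
        (dmap (pairMap f Y) σ X')
      + 1 / 2 * (dfun (fun σ => 1 / fu f σ) σ X * (dmap (pairMap f Y) σ X').1
        + dfun (fun σ => 1 / fu f σ) σ X' * (dmap (pairMap f Y) σ X).1)
      + 1 / 2 * lieCoord (pullForm g fun z => C.Φ (slab c z)) (C.shiftHat g c f) z X X' := by
    rintro c hc z hz rfl hd
    have h := hF.data_Y_eq hg hne hI hc hz X X'
    rw [fderiv_comp_slab hc hu hz, fderiv_comp_slab hc hu hz, hd, hd] at h
    rw [h]
    ring
  rw [lieDeriv_gammaForm_shift hg hne hA.smooth]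
  exact key _ (IsManifold.chart_mem_maximalAtlas σ.2) (σ.1, chartAt E2 σ.2 σ.2)
    (mem_chart_target E2 σ.2)
    (Prod.ext rfl ((chartAt E2 σ.2).left_inv (mem_chart_source E2 σ.2))) (dslab_self σ)

/-- The metric part is unchanged: ζ preserves γ; the one-form becomes (f_u X.1 + d_S f(X) - d_S
f(X))/f_u = X.1; the norm becomes (-2 · ½|grad f|² + |grad f|²)/f_u² = 0. As F^*g = g on the
hypersurface, this is also the metric part of the data of F^*g, and only `Y` needs the Lie
derivative formula. -/
theorem IsHypersurfaceSymmetry.isResidualGauge (hg : (C.data g.form).IsGaugeFixed)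
    (hne : (C.data g.form).IsNonExpanding) (hF : IsHypersurfaceSymmetry g.form C F)
    (hI : Induces C F f Y) (ζ : Sig ≃ₘ^∞⟮IS, IS⟯ Sig) (hζ : ∀ σ, ζ σ = pairMap f Y σ) :
    (C.data g.form).IsResidualGauge ζ (fun σ => 1 / fu f σ) (C.shiftField g f) ∧
      C.data (pullback F g.form) =
        (C.data g.form).gauge ζ (fun σ => 1 / fu f σ) (C.shiftField g f) := by
  have hA := hF.isAdmissible hg hne hI
  have hu : ContMDiff IS 𝓘(ℝ, ℝ) ∞ (fun σ => 1 / fu f σ) :=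
    contMDiff_const.div₀ (contMDiff_fu hA.smooth) hA.fu_ne_zero
  have hζ' : (ζ : Sig → Sig) = pairMap f Y := funext hζ
  rw [hζ']
  have hγ : ((C.data g.form).gauge (pairMap f Y) (fun σ => 1 / fu f σ) (C.shiftField g f)).γ =
      (C.data g.form).γ := by
    funext σ X X'
    exact hF.gammaForm_eq hI.intertwines σ X X'
  have hform : ((C.data g.form).gauge (pairMap f Y) (fun σ => 1 / fu f σ)
      (C.shiftField g f)).form = (C.data g.form).form := by
    funext σ X
    refine Eq.trans ?_ (Coords.form_eq hg σ X).symm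
    have h1 : (dmap (pairMap f Y) σ X).1 = fu f σ * X.1 + dS f σ.1 σ.2 X.2 :=
      congrArg Prod.fst (hA.dmap_apply σ X)
    have h2 : C.gammaForm g (pairMap f Y σ) (dmap (pairMap f Y) σ (C.shiftField g f σ))
        (dmap (pairMap f Y) σ X) = -dS f σ.1 σ.2 X.2 := by
      refine (hA.gammaForm_eq hg hne σ _ _).trans ((Coords.gammaForm_eq_qForm hg hne σ _ _).trans ?_)
      change C.qForm g σ.2 (-C.grad g f σ) X.2 = _
      rw [map_neg, _root_.neg_apply, Coords.qForm_grad hg]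
    have h3 : 1 / fu f σ * ((dmap (pairMap f Y) σ X).1 + C.gammaForm g (pairMap f Y σ)
        (dmap (pairMap f Y) σ (C.shiftField g f σ)) (dmap (pairMap f Y) σ X)) = X.1 := by
      rw [h1, h2, add_neg_cancel_right, ← mul_assoc, one_div_mul_cancel (hA.fu_ne_zero σ), one_mul]
    refine Eq.trans ?_ h3
    exact congrArg (fun t => 1 / fu f σ * (t + C.gammaForm g (pairMap f Y σ)
      (dmap (pairMap f Y) σ (C.shiftField g f σ)) (dmap (pairMap f Y) σ X)))
      (Coords.form_eq hg (pairMap f Y σ) _)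
  have hnorm : ((C.data g.form).gauge (pairMap f Y) (fun σ => 1 / fu f σ)
      (C.shiftField g f)).norm = (C.data g.form).norm := by
    funext σ
    refine Eq.trans ?_ (hg.norm_zero σ).symm
    have h1 : (dmap (pairMap f Y) σ (C.shiftField g f σ)).1 =
        -(1 / 2 * C.qForm g σ.2 (C.grad g f σ) (C.grad g f σ)) := by
      have h4 : dS f σ.1 σ.2 (-C.grad g f σ) = -C.qForm g σ.2 (C.grad g f σ) (C.grad g f σ) := by
        rw [← Coords.qForm_grad hg, map_neg]
      refine (congrArg Prod.fst (hA.dmap_apply σ (C.shiftField g f σ))).trans ?_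
      change fu f σ * (1 / (2 * fu f σ) * C.qForm g σ.2 (C.grad g f σ) (C.grad g f σ)) +
        dS f σ.1 σ.2 (-C.grad g f σ) = _
      have := hA.fu_ne_zero σ
      rw [h4]
      field_simp
      ring
    have h2 : C.gammaForm g (pairMap f Y σ) (dmap (pairMap f Y) σ (C.shiftField g f σ))
        (dmap (pairMap f Y) σ (C.shiftField g f σ)) =
        C.qForm g σ.2 (C.grad g f σ) (C.grad g f σ) := by
      refine (hA.gammaForm_eq hg hne σ _ _).trans ((Coords.gammaForm_eq_qForm hg hne σ _ _).trans ?_)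
      change C.qForm g σ.2 (-C.grad g f σ) (-C.grad g f σ) = _
      rw [map_neg, Coords.qForm_symm, map_neg, neg_neg]
    have h3 : ∀ a b c : ℝ, a = 0 → b = -(1 / 2 * c) →
        (1 / fu f σ) ^ 2 * (a + 2 * b + c) = 0 := by
      rintro _ _ c rfl rfl
      ring
    refine Eq.trans ?_ (h3 _ _ _ (hg.norm_zero (pairMap f Y σ))
      ((Coords.form_eq hg (pairMap f Y σ) _).trans h1))
    exact congrArg (fun t => (1 / fu f σ) ^ 2 * (_ + 2 * _ + t)) h2
  refine ⟨⟨hu, fun σ => one_div_ne_zero (hA.fu_ne_zero σ),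
    contMDiff_shiftField hg hne hA.smooth hA.fu_ne_zero, by rw [hζ', hγ], by rw [hζ', hform],
    by rw [hζ', hnorm]⟩, HData.ext ?_ ?_ ?_ ?_⟩
  · rw [hγ]
    funext σ X X'
    exact hF.metric_eq _ (mem_range_self _) _ _
  · rw [hform]
    funext σ X
    exact hF.metric_eq _ (mem_range_self _) _ _
  · rw [hnorm]
    funext σ
    exact hF.metric_eq _ (mem_range_self _) _ _
  · funext σ X X'
    refine (hF.data_Y_eq_rig hg hne hI σ X X').trans ?_
    -- The gauge transformation takes the Lie derivative of the pulled-back γ, the computation that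
    -- of γ; they agree because ζ preserves γ.
    have h1 : (fun σ X X' => C.gammaForm g σ X X') = ((C.data g.form).pull (pairMap f Y)).γ := by
      funext σ X X'
      exact (hF.gammaForm_eq hI.intertwines σ X X').symm
    have h2 : ∀ Z : ℝ × E2, (dmap (pairMap f Y) σ Z).1 =
        ((C.data g.form).pull (pairMap f Y)).form σ Z := fun Z =>
      (Coords.form_eq hg (pairMap f Y σ) _).symm
    refine congrArg₂ (· + ·) (congrArg₂ (· + ·) rfl (congrArg (1 / 2 * ·) ?_))
      (congrArg (fun T => 1 / 2 * lieDeriv T (C.shift g f) σ X X') h1)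
    exact congrArg₂ (· + ·) (congrArg (_ * ·) (h2 X')) (congrArg (_ * ·) (h2 X))

end Gauge

/-- Trades the derivatives of W for those of the one-form B(W, ·), at the cost of derivatives of B
with W frozen at y. For the shift this one-form is explicit, and the remaining terms are Christoffel
symbols of the first kind. -/
theorem lieCoord_eq {E : Type*} [NormedAddCommGroup E] [NormedSpace ℝ E]
    {B : E → E →L[ℝ] E →L[ℝ] ℝ} {W : E → E} {y : E} (hB : DifferentiableAt ℝ B y)
    (hW : DifferentiableAt ℝ W y) (X X' : E) :
    lieCoord B W y X X' =
      fderiv ℝ (fun z => B z (W z) X') y X + fderiv ℝ (fun z => B z X (W z)) y X'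
      - fderiv ℝ (fun z => B z (W y) X') y X - fderiv ℝ (fun z => B z X (W y)) y X'
      + fderiv ℝ (fun z => B z X X') y (W y) := by
  have hc : ∀ A : E, HasFDerivAt (fun _ : E => A) (0 : E →L[ℝ] E) y := fun A =>
    hasFDerivAt_const A y
  have h1 := ((hB.hasFDerivAt.clm_apply hW.hasFDerivAt).clm_apply (hc X')).fderiv
  have h2 := ((hB.hasFDerivAt.clm_apply (hc X)).clm_apply hW.hasFDerivAt).fderiv
  have h3 := ((hB.hasFDerivAt.clm_apply (hc (W y))).clm_apply (hc X')).fderiv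
  have h4 := ((hB.hasFDerivAt.clm_apply (hc X)).clm_apply (hc (W y))).fderiv
  have h5 := ((hB.hasFDerivAt.clm_apply (hc X)).clm_apply (hc X')).fderiv
  rw [lieCoord, h1, h2, h3, h4, h5]
  simp
  ring

/-! ### From the Lie derivative of γ to the Hessian of f -/

section Coordinates

variable {M : Type*} [TopologicalSpace M] [ChartedSpace E4 M] [IsManifold (𝓡 4) ∞ M]
  {g : LorentzMetric M} {C : Coords M} {c : OpenPartialHomeomorph S2 E2} {f : Sig → ℝ}
  {Y : S2 ≃ₘ^∞⟮𝓡 2, 𝓡 2⟯ S2} {F : PartialDiffeomorph (𝓡 4) (𝓡 4) M M ∞}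

/-- The component `Y_ab` of the data, on the model space. -/
def Coords.YForm (C : Coords M) (h : Form2 M) (σ : Sig) (X X' : ℝ × E2) : ℝ := (C.data h).Y σ X X'

/-- `Y_ab` is a symmetric bilinear form. -/
theorem Coords.exists_data_Y_eq (C : Coords M) (g : LorentzMetric M) (σ : Sig) :
    ∃ L : (ℝ × E2) →L[ℝ] (ℝ × E2) →L[ℝ] ℝ, (∀ X X', C.YForm g.form σ X X' = L X X') ∧
      ∀ X X', L X X' = L X' X := by
  obtain ⟨u, x⟩ := σ
  obtain ⟨c, hc, y, hy, rfl⟩ := exists_chart x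
  have hb := dslab_bijective hc (z := (u, y)) hy
  -- A definition by `deriv` is not visibly bilinear. In coordinates it is the derivative of a
  -- smooth family of bilinear forms, which is then carried back by e.
  let e : (ℝ × E2) ≃L[ℝ] (ℝ × E2) := ContinuousLinearEquiv.ofBijective (dslab c (u, y))
    (LinearMap.ker_eq_bot.2 hb.1) (LinearMap.range_eq_top.2 hb.2)
  let J : (ℝ × E2) →L[ℝ] (ℝ × E2) × ℝ :=
    (ContinuousLinearMap.inl ℝ (ℝ × E2) ℝ).comp (e.symm : (ℝ × E2) →L[ℝ] ℝ × E2)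
  let L := (1 / 2 : ℝ) • (fderiv ℝ (pullForm g (C.param hc)) ((u, y), 0) (0, 1)).bilinearComp J J
  have h : ∀ X X', C.YForm g.form (slab c (u, y)) X X' = L X X' := by
    intro X X'
    have h1 : ∀ Z, dslab c (u, y) (e.symm Z) = Z := fun Z => e.apply_symm_apply Z
    have h2 := Coords.data_Y_slab (C := C) (g := g) hc (z := (u, y)) hy (e.symm X) (e.symm X')
    rw [h1, h1] at h2
    exact h2
  refine ⟨L, h, fun X X' => (h X X').symm.trans (Eq.trans ?_ (h X' X))⟩
  refine congrArg (fun k : ℝ → ℝ => 1 / 2 * deriv k 0) (funext fun r => ?_)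
  exact g.symm _ _ _

theorem Coords.pullForm_slab_eq_qHat (hg : (C.data g.form).IsGaugeFixed)
    (hne : (C.data g.form).IsNonExpanding) (hc : c ∈ IsManifold.maximalAtlas (𝓡 2) ∞ S2)
    {z : ℝ × E2} (hz : z.2 ∈ c.target) (A A' : ℝ × E2) :
    pullForm g (fun z => C.Φ (slab c z)) z A A' = C.qHat g c z A.2 A'.2 := by
  rw [Coords.pullForm_slab_eq hg hne hc hz, Coords.qHat_apply hg hne hc hz]

/-- The derivative of `q(v, w)` in the direction `t`, in the coordinates of `slab`. -/
def Coords.dq (C : Coords M) (g : LorentzMetric M) (c : OpenPartialHomeomorph S2 E2)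
    (z : ℝ × E2) (v w t : E2) : ℝ :=
  fderiv ℝ (fun z => C.qHat g c z v w) z (0, t)

theorem Coords.differentiableAt_qHat (hc : c ∈ IsManifold.maximalAtlas (𝓡 2) ∞ S2)
    {z : ℝ × E2} (hz : z.2 ∈ c.target) : DifferentiableAt ℝ (C.qHat g c) z :=
  ((Coords.contDiffOn_qHat hc).contDiffAt
    ((isOpen_slab c).mem_nhds ⟨mem_univ _, hz⟩)).differentiableAt (by simp)

theorem Coords.fderiv_qHat (hc : c ∈ IsManifold.maximalAtlas (𝓡 2) ∞ S2)
    {z : ℝ × E2} (hz : z.2 ∈ c.target) (v w : E2) (X : ℝ × E2) :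
    fderiv ℝ (fun z => C.qHat g c z v w) z X = fderiv ℝ (C.qHat g c) z X v w := by
  have hk : ∀ A : E2, HasFDerivAt (fun _ : ℝ × E2 => A) (0 : ℝ × E2 →L[ℝ] E2) z := fun A =>
    hasFDerivAt_const A z
  rw [(((Coords.differentiableAt_qHat hc hz).hasFDerivAt.clm_apply (hk v)).clm_apply
    (hk w)).fderiv]
  simp

theorem Coords.dq_apply (hc : c ∈ IsManifold.maximalAtlas (𝓡 2) ∞ S2)
    {z : ℝ × E2} (hz : z.2 ∈ c.target) (v w t : E2) :
    C.dq g c z v w t = fderiv ℝ (C.qHat g c) z (0, t) v w :=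
  Coords.fderiv_qHat hc hz v w (0, t)

/-- The components of q do not depend on u, so only the sphere part of the direction counts. -/
theorem Coords.fderiv_qHat_eq_dq (hg : (C.data g.form).IsGaugeFixed)
    (hne : (C.data g.form).IsNonExpanding) (hc : c ∈ IsManifold.maximalAtlas (𝓡 2) ∞ S2)
    {z : ℝ × E2} (hz : z.2 ∈ c.target) (v w : E2) (X : ℝ × E2) :
    fderiv ℝ (fun z => C.qHat g c z v w) z X = C.dq g c z v w X.2 := by
  have hd : DifferentiableAt ℝ (fun z => C.qHat g c z v w) z :=
    ((Coords.differentiableAt_qHat hc hz).clm_apply (differentiableAt_const v)).clm_apply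
      (differentiableAt_const w)
  have h1 : fderiv ℝ (fun z => C.qHat g c z v w) z (1, 0) = 0 := by
    rw [← hd.lineDeriv_eq_fderiv, lineDeriv]
    have h2 : (fun t : ℝ => C.qHat g c (z + t • ((1 : ℝ), (0 : E2))) v w) =
        fun _ => C.qHat g c z v w := by
      funext t
      have h3 : (z + t • ((1 : ℝ), (0 : E2))).2 = z.2 := by simp
      rw [Coords.qHat_apply hg hne hc hz, Coords.qHat_apply hg hne hc (by rw [h3]; exact hz), h3]
    rw [h2, deriv_const]
  have h4 : X = X.1 • ((1 : ℝ), (0 : E2)) + (0, X.2) := by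
    ext <;> simp
  calc fderiv ℝ (fun z => C.qHat g c z v w) z X
      = fderiv ℝ (fun z => C.qHat g c z v w) z (X.1 • ((1 : ℝ), (0 : E2)) + (0, X.2)) :=
        congrArg _ h4
    _ = C.dq g c z v w X.2 := by rw [map_add, map_smul, h1, smul_zero, zero_add, Coords.dq]

/-- The second derivative of `f` in the coordinates of `slab`. -/
def hessHat (c : OpenPartialHomeomorph S2 E2) (f : Sig → ℝ) (z : ℝ × E2) :
    (ℝ × E2) →L[ℝ] (ℝ × E2) →L[ℝ] ℝ :=
  fderiv ℝ (fderiv ℝ fun z => f (slab c z)) z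

theorem differentiableAt_fderiv_comp_slab (hc : c ∈ IsManifold.maximalAtlas (𝓡 2) ∞ S2)
    (hf : ContMDiff IS 𝓘(ℝ, ℝ) ∞ f) {z : ℝ × E2} (hz : z.2 ∈ c.target) :
    DifferentiableAt ℝ (fderiv ℝ fun z => f (slab c z)) z :=
  (((contDiffOn_comp_slab hc hf).fderiv_of_isOpen (m := ∞) (isOpen_slab c) (by simp)).contDiffAt
    ((isOpen_slab c).mem_nhds ⟨mem_univ _, hz⟩)).differentiableAt (by simp)

theorem hasFDerivAt_fderiv_comp_slab (hc : c ∈ IsManifold.maximalAtlas (𝓡 2) ∞ S2)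
    (hf : ContMDiff IS 𝓘(ℝ, ℝ) ∞ f) {z : ℝ × E2} (hz : z.2 ∈ c.target) (A : ℝ × E2) :
    HasFDerivAt (fun z => fderiv ℝ (fun z => f (slab c z)) z A) ((hessHat c f z).flip A) z := by
  have h := (differentiableAt_fderiv_comp_slab hc hf hz).hasFDerivAt.clm_apply
    (hasFDerivAt_const A z)
  convert! h using 1
  ext <;> simp [hessHat]

theorem hessHat_symm (hc : c ∈ IsManifold.maximalAtlas (𝓡 2) ∞ S2)
    (hf : ContMDiff IS 𝓘(ℝ, ℝ) ∞ f) {z : ℝ × E2} (hz : z.2 ∈ c.target) (A A' : ℝ × E2) :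
    hessHat c f z A A' = hessHat c f z A' A := by
  have h : ContDiffAt ℝ ∞ (fun z => f (slab c z)) z :=
    (contDiffOn_comp_slab hc hf).contDiffAt ((isOpen_slab c).mem_nhds ⟨mem_univ _, hz⟩)
  have h2 : minSmoothness ℝ 2 ≤ ∞ := by
    rw [minSmoothness_of_isRCLikeNormedField]
    exact WithTop.coe_le_coe.2 le_top
  exact (h.isSymmSndFDerivAt h2).eq A A'

theorem hasFDerivAt_fu_comp_slab (hc : c ∈ IsManifold.maximalAtlas (𝓡 2) ∞ S2)
    (hf : ContMDiff IS 𝓘(ℝ, ℝ) ∞ f) {z : ℝ × E2} (hz : z.2 ∈ c.target) :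
    HasFDerivAt (fun z => fu f (slab c z)) ((hessHat c f z).flip (1, 0)) z := by
  refine (hasFDerivAt_fderiv_comp_slab hc hf hz (1, 0)).congr_of_eventuallyEq ?_
  filter_upwards [(isOpen_slab c).mem_nhds ⟨mem_univ z.1, hz⟩] with z hz
  rw [fderiv_comp_slab' hc hf hz.2]
  dsimp only
  rw [map_zero, dS_zero, mul_one, add_zero]

theorem hasFDerivAt_inv_fu_comp_slab (hc : c ∈ IsManifold.maximalAtlas (𝓡 2) ∞ S2)
    (hf : ContMDiff IS 𝓘(ℝ, ℝ) ∞ f) (h0 : ∀ σ, fu f σ ≠ 0) {z : ℝ × E2} (hz : z.2 ∈ c.target) :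
    HasFDerivAt (fun z => 1 / fu f (slab c z))
      (-(fu f (slab c z) ^ 2)⁻¹ • (hessHat c f z).flip (1, 0)) z := by
  simp only [one_div]
  exact (hasDerivAt_inv (h0 _)).comp_hasFDerivAt z (hasFDerivAt_fu_comp_slab hc hf hz)

/-- The one-form γ(W, ·) is -ρ d_S f, whose derivatives give the first two lines. The terms with W
frozen see only its sphere part -ρ grad f and give the Christoffel terms. -/
theorem Coords.lieCoord_shiftHat (hg : (C.data g.form).IsGaugeFixed)
    (hne : (C.data g.form).IsNonExpanding) (hc : c ∈ IsManifold.maximalAtlas (𝓡 2) ∞ S2)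
    (hf : ContMDiff IS 𝓘(ℝ, ℝ) ∞ f) (h0 : ∀ σ, fu f σ ≠ 0) {z₀ : ℝ × E2} (hz : z₀.2 ∈ c.target)
    (X X' : ℝ × E2) :
    lieCoord (pullForm g fun z => C.Φ (slab c z)) (C.shiftHat g c f) z₀ X X' =
      -(1 / fu f (slab c z₀) * hessHat c f z₀ X (0, X'.2)
        + fderiv ℝ (fun z => 1 / fu f (slab c z)) z₀ X *
          fderiv ℝ (fun z => f (slab c z)) z₀ (0, X'.2))
      - (1 / fu f (slab c z₀) * hessHat c f z₀ X' (0, X.2)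
        + fderiv ℝ (fun z => 1 / fu f (slab c z)) z₀ X' *
          fderiv ℝ (fun z => f (slab c z)) z₀ (0, X.2))
      + 1 / fu f (slab c z₀) * (C.dq g c z₀ (C.gradHat g c f z₀) X'.2 X.2
        + C.dq g c z₀ X.2 (C.gradHat g c f z₀) X'.2 - C.dq g c z₀ X.2 X'.2 (C.gradHat g c f z₀)) := by
  have hnhds : (univ : Set ℝ) ×ˢ c.target ∈ nhds z₀ := (isOpen_slab c).mem_nhds ⟨mem_univ _, hz⟩
  have hW : DifferentiableAt ℝ (C.shiftHat g c f) z₀ :=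
    ((Coords.contDiffOn_shiftHat hg hne hc hf h0).contDiffAt hnhds).differentiableAt (by simp)
  have hB : DifferentiableAt ℝ (pullForm g fun z => C.Φ (slab c z)) z₀ :=
    ((Coords.contDiffOn_pullForm_slab hc).contDiffAt hnhds).differentiableAt (by simp)
  have hW2 : ∀ z, (C.shiftHat g c f z).2 = -((1 / fu f (slab c z)) • C.gradHat g c f z) :=
    fun z => smul_neg _ _
  have hα : ∀ z : ℝ × E2, z.2 ∈ c.target → ∀ v, C.qHat g c z (C.shiftHat g c f z).2 v =
      -(1 / fu f (slab c z) * fderiv ℝ (fun z => f (slab c z)) z (0, v)) := by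
    intro z hz v
    rw [hW2, map_neg, map_smul, ← Coords.qHat_gradHat hg hne hc f hz]
    rfl
  have hsymm : ∀ z : ℝ × E2, z.2 ∈ c.target → ∀ v w, C.qHat g c z v w = C.qHat g c z w v := by
    intro z hz v w
    rw [Coords.qHat_apply hg hne hc hz, Coords.qHat_apply hg hne hc hz, Coords.qForm_symm]
  have hdα : ∀ v, HasFDerivAt
      (fun z => -(1 / fu f (slab c z) * fderiv ℝ (fun z => f (slab c z)) z (0, v))) _ z₀ := fun v =>
    ((hasFDerivAt_inv_fu_comp_slab hc hf h0 hz).mul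
      (hasFDerivAt_fderiv_comp_slab hc hf hz (0, v))).neg
  have h1 : ∀ X X' : ℝ × E2, fderiv ℝ (fun z => pullForm g (fun z => C.Φ (slab c z)) z
      (C.shiftHat g c f z) X') z₀ X = -(1 / fu f (slab c z₀) * hessHat c f z₀ X (0, X'.2)
        + fderiv ℝ (fun z => 1 / fu f (slab c z)) z₀ X *
          fderiv ℝ (fun z => f (slab c z)) z₀ (0, X'.2)) := by
    intro X X'
    rw [(hasFDerivAt_inv_fu_comp_slab hc hf h0 hz).fderiv]
    have h : (fun z => pullForm g (fun z => C.Φ (slab c z)) z (C.shiftHat g c f z) X') =ᶠ[nhds z₀]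
        fun z => -(1 / fu f (slab c z) * fderiv ℝ (fun z => f (slab c z)) z (0, X'.2)) := by
      filter_upwards [hnhds] with z hz
      rw [Coords.pullForm_slab_eq_qHat hg hne hc hz.2, hα z hz.2]
    rw [h.fderiv_eq, (hdα X'.2).fderiv]
    simp
    ring
  have h2 : ∀ X X' : ℝ × E2, fderiv ℝ (fun z => pullForm g (fun z => C.Φ (slab c z)) z
      X (C.shiftHat g c f z)) z₀ X' = fderiv ℝ (fun z => pullForm g (fun z => C.Φ (slab c z)) z
      (C.shiftHat g c f z) X) z₀ X' := by
    intro X X'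
    have h : (fun z => pullForm g (fun z => C.Φ (slab c z)) z X (C.shiftHat g c f z)) =ᶠ[nhds z₀]
        (fun z => pullForm g (fun z => C.Φ (slab c z)) z (C.shiftHat g c f z) X) := by
      filter_upwards [hnhds] with z hz
      rw [Coords.pullForm_slab_eq_qHat hg hne hc hz.2, Coords.pullForm_slab_eq_qHat hg hne hc hz.2,
        hsymm z hz.2]
    rw [h.fderiv_eq]
  have h3 : ∀ A A' X : ℝ × E2, fderiv ℝ (fun z => pullForm g (fun z => C.Φ (slab c z)) z
      A A') z₀ X = C.dq g c z₀ A.2 A'.2 X.2 := by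
    intro A A' X
    have h : (fun z => pullForm g (fun z => C.Φ (slab c z)) z A A') =ᶠ[nhds z₀]
        fun z => C.qHat g c z A.2 A'.2 := by
      filter_upwards [hnhds] with z hz
      rw [Coords.pullForm_slab_eq_qHat hg hne hc hz.2]
    rw [h.fderiv_eq, Coords.fderiv_qHat_eq_dq hg hne hc hz]
  have h4 : ∀ t : E2, ((0 : ℝ), -((1 / fu f (slab c z₀)) • t)) =
      -((1 / fu f (slab c z₀)) • ((0 : ℝ), t)) := fun t => by simp
  rw [lieCoord_eq hB hW, h1, h2, h1, h3, h3, h3, hW2]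
  simp only [Coords.dq_apply hc hz, h4, map_neg, map_smul, _root_.neg_apply, _root_.smul_apply,
    smul_eq_mul]
  ring

/-- The transformation of `Y_ab`: up to the factor `1 / f_u`, it is the pull-back minus the
Hessian of `f`. -/
theorem IsHypersurfaceSymmetry.data_Y_eq_hess (hg : (C.data g.form).IsGaugeFixed)
    (hne : (C.data g.form).IsNonExpanding) (hF : IsHypersurfaceSymmetry g.form C F)
    (hI : Induces C F f Y) (hc : c ∈ IsManifold.maximalAtlas (𝓡 2) ∞ S2) {z : ℝ × E2}
    (hz : z.2 ∈ c.target) (X X' : ℝ × E2) :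
    C.YForm (pullback F g.form) (slab c z) (dslab c z X) (dslab c z X') =
      1 / fu f (slab c z) * (C.YForm g.form (pairMap f Y (slab c z))
          (dmap (pairMap f Y) (slab c z) (dslab c z X))
          (dmap (pairMap f Y) (slab c z) (dslab c z X'))
        - hessHat c f z X X'
        + 1 / 2 * (C.dq g c z (C.gradHat g c f z) X'.2 X.2
          + C.dq g c z X.2 (C.gradHat g c f z) X'.2 - C.dq g c z X.2 X'.2 (C.gradHat g c f z))) := by
  have hA := hF.isAdmissible hg hne hI
  have hf := hA.smooth
  have h0 := hA.fu_ne_zero (slab c z)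
  have h1 : ∀ X : ℝ × E2, (dmap (pairMap f Y) (slab c z) (dslab c z X)).1 =
      fu f (slab c z) * X.1 + fderiv ℝ (fun z => f (slab c z)) z (0, X.2) := by
    intro X
    rw [hA.dmap_apply, fderiv_comp_slab' hc hf hz, dslab_apply hc hz]
    dsimp only
    rw [mul_zero, zero_add]
    rfl
  have h2 : ∀ X X' : ℝ × E2, hessHat c f z X X' =
      X'.1 * hessHat c f z X (1, 0) + hessHat c f z X (0, X'.2) := by
    intro X X'
    rw [← smul_eq_mul, ← map_smul, ← map_add]
    simp
  -- Completes the sphere-only second derivatives of f to full ones. The leftover u-terms cancel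
  -- against f_u dρ = -(df_u)/f_u, and the terms dρ ⊗ d_S f cancel between the Lie derivative and
  -- the one-form part.
  have h3 : hessHat c f z X' (0, X.2) = hessHat c f z X X' - X.1 * hessHat c f z X' (1, 0) := by
    rw [hessHat_symm hc hf hz X X', h2 X' X]
    ring
  have h4 : hessHat c f z X (0, X'.2) = hessHat c f z X X' - X'.1 * hessHat c f z X (1, 0) := by
    rw [h2 X X']
    ring
  refine (hF.data_Y_eq hg hne hI hc hz X X').trans ?_
  rw [Coords.lieCoord_shiftHat hg hne hc hf hA.fu_ne_zero hz, h1, h1,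
    (hasFDerivAt_inv_fu_comp_slab hc hf hA.fu_ne_zero hz).fderiv, h3, h4]
  simp only [_root_.smul_apply, ContinuousLinearMap.flip_apply, smul_eq_mul, Coords.YForm]
  field_simp
  ring

end Coordinates

theorem pd_slice {h : ℝ × E2 → ℝ} {h' : ℝ × E2 →L[ℝ] ℝ} {u : ℝ} {y : E2}
    (hh : HasFDerivAt h h' (u, y)) (K : Fin 2) :
    pd K (fun z => h (u, z)) y = h' (0, EuclideanSpace.single K 1) := by
  have h1 : HasFDerivAt (fun z : E2 => (u, z)) (ContinuousLinearMap.inr ℝ ℝ E2) y :=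
    hasFDerivAt_prodMk_right u y
  have h2 := (HasFDerivAt.comp (g := h) y hh h1).fderiv
  exact congrArg (fun T : E2 →L[ℝ] ℝ => T (EuclideanSpace.single K 1)) h2

theorem deriv_slice {h : ℝ × E2 → ℝ} {h' : ℝ × E2 →L[ℝ] ℝ} {u : ℝ} {y : E2}
    (hh : HasFDerivAt h h' (u, y)) : deriv (fun s => h (s, y)) u = h' (1, 0) := by
  have h1 : HasFDerivAt (fun s : ℝ => (s, y)) (ContinuousLinearMap.inl ℝ ℝ E2) u :=
    hasFDerivAt_prodMk_left u y
  exact (HasFDerivAt.comp (g := h) u hh h1).hasDerivAt.deriv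

/-! ### The laws for κ, Ω and Ξ in components -/

section Coordinates

variable {M : Type*} [TopologicalSpace M] [ChartedSpace E4 M] [IsManifold (𝓡 4) ∞ M]
  {g : LorentzMetric M} {C : Coords M} {c : OpenPartialHomeomorph S2 E2} {f : Sig → ℝ}
  {Y : S2 ≃ₘ^∞⟮𝓡 2, 𝓡 2⟯ S2} {F : PartialDiffeomorph (𝓡 4) (𝓡 4) M M ∞}

theorem hasFDerivAt_log_fu (hc : c ∈ IsManifold.maximalAtlas (𝓡 2) ∞ S2)
    (hf : ContMDiff IS 𝓘(ℝ, ℝ) ∞ f) (h0 : ∀ σ, fu f σ ≠ 0) {z : ℝ × E2} (hz : z.2 ∈ c.target) :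
    HasFDerivAt (fun z => Real.log |fu f (slab c z)|)
      ((fu f (slab c z))⁻¹ • (hessHat c f z).flip (1, 0)) z := by
  simp only [Real.log_abs]
  exact (hasFDerivAt_fu_comp_slab hc hf hz).log (h0 _)

theorem hasFDerivAt_comp_slab (hc : c ∈ IsManifold.maximalAtlas (𝓡 2) ∞ S2)
    (hf : ContMDiff IS 𝓘(ℝ, ℝ) ∞ f) {z : ℝ × E2} (hz : z.2 ∈ c.target) :
    HasFDerivAt (fun z => f (slab c z)) (fderiv ℝ (fun z => f (slab c z)) z) z :=
  (((contDiffOn_comp_slab hc hf).contDiffAt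
    ((isOpen_slab c).mem_nhds ⟨mem_univ _, hz⟩)).differentiableAt (by simp)).hasFDerivAt

theorem pd_pd_slab (hc : c ∈ IsManifold.maximalAtlas (𝓡 2) ∞ S2)
    (hf : ContMDiff IS 𝓘(ℝ, ℝ) ∞ f) {u : ℝ} {y : E2} (hy : y ∈ c.target) (K N : Fin 2) :
    pd K (pd N fun z => f (u, c.symm z)) y =
      hessHat c f (u, y) (0, EuclideanSpace.single K 1) (0, EuclideanSpace.single N 1) := by
  have h1 : (pd N fun z => f (u, c.symm z)) =ᶠ[nhds y] fun z =>
      fderiv ℝ (fun z => f (slab c z)) (u, z) (0, EuclideanSpace.single N 1) := by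
    filter_upwards [c.open_target.mem_nhds hy] with z hz
    exact pd_slice (hasFDerivAt_comp_slab hc hf (z := (u, z)) hz) N
  rw [pd, h1.fderiv_eq]
  exact pd_slice (h := fun z => fderiv ℝ (fun z => f (slab c z)) z (0, EuclideanSpace.single N 1))
    (hasFDerivAt_fderiv_comp_slab hc hf (z := (u, y)) hy _) K

theorem Coords.qMat_eq (hg : (C.data g.form).IsGaugeFixed)
    (hne : (C.data g.form).IsNonExpanding) (hc : c ∈ IsManifold.maximalAtlas (𝓡 2) ∞ S2)
    (u : ℝ) {y : E2} (hy : y ∈ c.target) (K N : Fin 2) :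
    (C.data g.form).qMat c y K N =
      C.qHat g c (u, y) (EuclideanSpace.single K 1) (EuclideanSpace.single N 1) :=
  (Coords.qHat_apply hg hne hc (z := (u, y)) hy _ _).symm

theorem Coords.pd_qMat (hg : (C.data g.form).IsGaugeFixed)
    (hne : (C.data g.form).IsNonExpanding) (hc : c ∈ IsManifold.maximalAtlas (𝓡 2) ∞ S2)
    (u : ℝ) {y : E2} (hy : y ∈ c.target) (P K N : Fin 2) :
    pd P (fun z => (C.data g.form).qMat c z K N) y =
      C.dq g c (u, y) (EuclideanSpace.single K 1) (EuclideanSpace.single N 1)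
        (EuclideanSpace.single P 1) := by
  have h1 : (fun z => (C.data g.form).qMat c z K N) =ᶠ[nhds y] fun z =>
      C.qHat g c (u, z) (EuclideanSpace.single K 1) (EuclideanSpace.single N 1) := by
    filter_upwards [c.open_target.mem_nhds hy] with z hz
    exact Coords.qMat_eq hg hne hc u hz K N
  have hd : DifferentiableAt ℝ (fun z => C.qHat g c z (EuclideanSpace.single K 1)
      (EuclideanSpace.single N 1)) (u, y) :=
    ((Coords.differentiableAt_qHat hc (z := (u, y)) hy).clm_apply
      (differentiableAt_const _)).clm_apply (differentiableAt_const _)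
  rw [pd, h1.fderiv_eq]
  exact pd_slice hd.hasFDerivAt P

theorem eq_sum_single (v : E2) : v = ∑ P : Fin 2, v P • (EuclideanSpace.single P 1 : E2) := by
  ext i
  fin_cases i <;> simp

/-- The components of the gradient, from those of the differential. -/
theorem Coords.gradHat_apply (hg : (C.data g.form).IsGaugeFixed)
    (hne : (C.data g.form).IsNonExpanding) (hc : c ∈ IsManifold.maximalAtlas (𝓡 2) ∞ S2)
    {u : ℝ} {y : E2} (hy : y ∈ c.target) (P : Fin 2) :
    C.gradHat g c f (u, y) P = ∑ L : Fin 2, fderiv ℝ (fun z => f (slab c z)) (u, y)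
      (0, EuclideanSpace.single L 1) * ((C.data g.form).qMat c y)⁻¹ L P := by
  have h1 : ∀ (v : E2) (N : Fin 2), Matrix.vecMul (fun P => v P) ((C.data g.form).qMat c y) N =
      C.qHat g c (u, y) v (EuclideanSpace.single N 1) := by
    intro v N
    conv_rhs => rw [eq_sum_single v]
    rw [map_sum, sum_apply]
    simp only [map_smul, _root_.smul_apply, smul_eq_mul, Matrix.vecMul, dotProduct]
    refine Finset.sum_congr rfl fun P _ => ?_
    rw [Coords.qMat_eq hg hne hc u hy]
  -- The matrix inverse in the Christoffel symbols is a genuine inverse only if the determinant is a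
  -- unit. A null vector of the matrix would contradict the nondegeneracy of q.
  have hdet : IsUnit ((C.data g.form).qMat c y).det := by
    rw [isUnit_iff_ne_zero]
    intro h0
    obtain ⟨v, hv, hv0⟩ := Matrix.exists_vecMul_eq_zero_iff.2 h0
    have h2 : C.qHat g c (u, y) (WithLp.toLp 2 v) = 0 := by
      ext w
      rw [eq_sum_single w, map_sum]
      refine Finset.sum_eq_zero fun N _ => ?_
      rw [map_smul, ← h1]
      have h3 : Matrix.vecMul v ((C.data g.form).qMat c y) N = 0 := congrFun hv0 N
      change w N • Matrix.vecMul v ((C.data g.form).qMat c y) N = 0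
      rw [h3, smul_zero]
    have h4 : (WithLp.toLp 2 v : E2) = 0 :=
      (Coords.bijective_qHat hg hne hc (z := (u, y)) hy).1 (h2.trans (map_zero _).symm)
    exact hv (funext fun i => congrFun (congrArg (fun w : E2 => (w : Fin 2 → ℝ)) h4) i)
  have h5 : Matrix.vecMul (fun P => C.gradHat g c f (u, y) P) ((C.data g.form).qMat c y) =
      fun L => fderiv ℝ (fun z => f (slab c z)) (u, y) (0, EuclideanSpace.single L 1) := by
    funext N
    rw [h1, Coords.qHat_gradHat hg hne hc f (z := (u, y)) hy]
  have h6 := congrArg (fun w => Matrix.vecMul w ((C.data g.form).qMat c y)⁻¹ P) h5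
  dsimp only at h6
  rw [Matrix.vecMul_vecMul, Matrix.mul_nonsing_inv _ hdet, Matrix.vecMul_one] at h6
  exact h6

/-- Contracting the inverse metric of the Christoffel symbols with df gives the components of the
gradient, so the correction is the first-kind symbol evaluated on it. This is the combination that
the Lie derivative of γ produces. -/
theorem Coords.hess_eq (hg : (C.data g.form).IsGaugeFixed)
    (hne : (C.data g.form).IsNonExpanding) (hc : c ∈ IsManifold.maximalAtlas (𝓡 2) ∞ S2)
    (hf : ContMDiff IS 𝓘(ℝ, ℝ) ∞ f) {u : ℝ} {y : E2} (hy : y ∈ c.target) (K N : Fin 2) :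
    (C.data g.form).hess (fun z => f (u, z)) c y K N =
      hessHat c f (u, y) (0, EuclideanSpace.single K 1) (0, EuclideanSpace.single N 1)
      - 1 / 2 * (C.dq g c (u, y) (C.gradHat g c f (u, y)) (EuclideanSpace.single N 1)
            (EuclideanSpace.single K 1)
          + C.dq g c (u, y) (EuclideanSpace.single K 1) (C.gradHat g c f (u, y))
            (EuclideanSpace.single N 1)
          - C.dq g c (u, y) (EuclideanSpace.single K 1) (EuclideanSpace.single N 1)
            (C.gradHat g c f (u, y))) := by
  have hpd : ∀ L, pd L (fun z => f (u, c.symm z)) y =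
      fderiv ℝ (fun z => f (slab c z)) (u, y) (0, EuclideanSpace.single L 1) := fun L =>
    pd_slice (hasFDerivAt_comp_slab hc hf (z := (u, y)) hy) L
  have hsymm : ∀ v w t, C.dq g c (u, y) v w t = C.dq g c (u, y) w v t := by
    intro v w t
    have h : (fun z => C.qHat g c z v w) =ᶠ[nhds (u, y)] fun z => C.qHat g c z w v := by
      filter_upwards [(isOpen_slab c).mem_nhds ⟨mem_univ u, hy⟩] with z hz
      rw [Coords.qHat_apply hg hne hc hz.2, Coords.qHat_apply hg hne hc hz.2, Coords.qForm_symm]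
    rw [Coords.dq, h.fderiv_eq, Coords.dq]
  have hsum : ∀ v w G : E2, C.dq g c (u, y) G w v + C.dq g c (u, y) v G w
      - C.dq g c (u, y) v w G = ∑ P : Fin 2, G P *
        (C.dq g c (u, y) w (EuclideanSpace.single P 1) v
        + C.dq g c (u, y) v (EuclideanSpace.single P 1) w
        - C.dq g c (u, y) v w (EuclideanSpace.single P 1)) := by
    intro v w G
    have h1 : ∀ L : E2 →L[ℝ] ℝ, L G = ∑ P : Fin 2, G P * L (EuclideanSpace.single P 1) := by
      intro L
      conv_lhs => rw [eq_sum_single G]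
      simp only [map_sum, map_smul, smul_eq_mul]
    have h2 := h1 (((fderiv ℝ (C.qHat g c) (u, y)).comp
      (ContinuousLinearMap.inr ℝ ℝ E2)).flip v |>.flip w)
    simp only [ContinuousLinearMap.flip_apply, ContinuousLinearMap.comp_apply,
      ContinuousLinearMap.inr_apply] at h2
    rw [hsymm G w v]
    simp only [Coords.dq_apply hc (z := (u, y)) hy]
    rw [h2, h1 (fderiv ℝ (C.qHat g c) (u, y) (0, v) w),
      h1 (fderiv ℝ (C.qHat g c) (u, y) (0, w) v)]
    simp only [Fin.sum_univ_two]
    ring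
  rw [HData.hess, pd_pd_slab hc hf hy, hsum]
  simp only [Coords.gradHat_apply hg hne hc hy, HData.christoffel, hpd,
    Coords.pd_qMat hg hne hc u hy]
  simp only [Fin.sum_univ_two]
  ring

theorem dslab_one (hc : c ∈ IsManifold.maximalAtlas (𝓡 2) ∞ S2) {z : ℝ × E2}
    (hz : z.2 ∈ c.target) : dslab c z (1, 0) = (1, 0) := by
  rw [dslab_apply hc hz]
  exact Prod.ext rfl (map_zero _)

theorem IsAdmissible.dmap_one (hA : IsAdmissible (C.data g.form) f Y) (σ : Sig) :
    dmap (pairMap f Y) σ (1, 0) = fu f σ • ((1 : ℝ), (0 : E2)) := by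
  rw [hA.dmap_apply, dS_zero, map_zero]
  simp

theorem IsAdmissible.dmap_slab_single (hA : IsAdmissible (C.data g.form) f Y)
    (hc : c ∈ IsManifold.maximalAtlas (𝓡 2) ∞ S2) {u : ℝ} {y : E2} (hy : y ∈ c.target)
    (K : Fin 2) :
    dmap (pairMap f Y) (slab c (u, y)) (dslab c (u, y) (0, EuclideanSpace.single K 1)) =
      pd K (fun z => f (u, c.symm z)) y • ((1 : ℝ), (0 : E2)) +
        (0, dsph Y (c.symm y) (dchart c y (EuclideanSpace.single K 1))) := by
  have h1 := fderiv_comp_slab' hc hA.smooth (z := (u, y)) hy (0, EuclideanSpace.single K 1)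
  have h2 : pd K (fun z => f (u, c.symm z)) y =
      fderiv ℝ (fun z => f (slab c z)) (u, y) (0, EuclideanSpace.single K 1) :=
    pd_slice (hasFDerivAt_comp_slab hc hA.smooth (z := (u, y)) hy) K
  rw [dslab_apply (z := (u, y)) hc hy, hA.dmap_apply, h2, h1]
  ext <;> simp [slab]

/-- The component (n, n) of `data_Y_eq_hess`: the Christoffel terms vanish as n has no sphere part,
dζ(n) = f_u n, and f_uu/f_u is the derivative of log |f_u|. -/
theorem IsHypersurfaceSymmetry.kappa_eq (hg : (C.data g.form).IsGaugeFixed)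
    (hne : (C.data g.form).IsNonExpanding) (hF : IsHypersurfaceSymmetry g.form C F)
    (hI : Induces C F f Y) (u : ℝ) (x : S2) :
    (C.data (pullback F g.form)).κ u x =
      (C.data g.form).κ (f (u, x)) (Y x) * fu f (u, x)
        + deriv (fun s : ℝ => Real.log |fu f (s, x)|) u := by
  obtain ⟨c, hc, y, hy, rfl⟩ := exists_chart x
  have hA := hF.isAdmissible hg hne hI
  have h0 := hA.fu_ne_zero (slab c (u, y))
  obtain ⟨L, hL, -⟩ := C.exists_data_Y_eq g (pairMap f Y (slab c (u, y)))
  have h1 := hF.data_Y_eq_hess hg hne hI hc (z := (u, y)) hy (1, 0) (1, 0)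
  have h2 := deriv_slice (hasFDerivAt_log_fu hc hA.smooth hA.fu_ne_zero (z := (u, y)) hy)
  have h3 : ∀ w t, C.dq g c (u, y) 0 w t = 0 := fun w t => by
    rw [Coords.dq_apply hc (z := (u, y)) hy, map_zero, _root_.zero_apply]
  have h4 : ∀ v w, C.dq g c (u, y) v w 0 = 0 := fun v w =>
    map_zero (fderiv ℝ (fun z => C.qHat g c z v w) (u, y))
  have h5 : (C.data g.form).κ (f (u, c.symm y)) (Y (c.symm y)) = -L (1, 0) (1, 0) :=
    congrArg (- ·) (hL (1, 0) (1, 0))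
  rw [dslab_one hc (z := (u, y)) hy, hL, hA.dmap_one, h3, h3, h4] at h1
  simp only [map_smul, _root_.smul_apply, smul_eq_mul] at h1
  refine (congrArg (- ·) h1).trans ?_
  rw [h5]
  refine Eq.trans ?_ (congrArg (-L (1, 0) (1, 0) * fu f (u, c.symm y) + ·) h2.symm)
  change _ = -L (1, 0) (1, 0) * fu f (slab c (u, y)) + _
  simp only [_root_.smul_apply, ContinuousLinearMap.flip_apply, smul_eq_mul]
  field_simp
  ring

/-- The component (n, e_M). The factor f_u of dζ(n) cancels 1/f_u, and the f_M n part of dζ(e_M)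
contributes κ f_M. -/
theorem IsHypersurfaceSymmetry.omega_eq (hg : (C.data g.form).IsGaugeFixed)
    (hne : (C.data g.form).IsNonExpanding) (hF : IsHypersurfaceSymmetry g.form C F)
    (hI : Induces C F f Y) (hc : c ∈ IsManifold.maximalAtlas (𝓡 2) ∞ S2) (u : ℝ) {y : E2}
    (hy : y ∈ c.target) (K : Fin 2) :
    (C.data (pullback F g.form)).Ω u (c.symm y) (cvec c y K) =
      (C.data g.form).Ω (f (u, c.symm y)) (Y (c.symm y))
        (mfderiv (𝓡 2) (𝓡 2) Y (c.symm y) (cvec c y K))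
      + (C.data g.form).κ (f (u, c.symm y)) (Y (c.symm y)) * pd K (fun z => f (u, c.symm z)) y
      + pd K (fun z => Real.log |fu f (u, c.symm z)|) y := by
  have hA := hF.isAdmissible hg hne hI
  have h0 := hA.fu_ne_zero (slab c (u, y))
  obtain ⟨L, hL, -⟩ := C.exists_data_Y_eq g (pairMap f Y (slab c (u, y)))
  have h1 := hF.data_Y_eq_hess hg hne hI hc (z := (u, y)) hy (1, 0) (0, EuclideanSpace.single K 1)
  have h2 := pd_slice (hasFDerivAt_log_fu hc hA.smooth hA.fu_ne_zero (z := (u, y)) hy) K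
  have h3 : ∀ w t, C.dq g c (u, y) 0 w t = 0 := fun w t => by
    rw [Coords.dq_apply hc (z := (u, y)) hy, map_zero, _root_.zero_apply]
  have h4 : ∀ v w, C.dq g c (u, y) v w 0 = 0 := fun v w =>
    map_zero (fderiv ℝ (fun z => C.qHat g c z v w) (u, y))
  have h5 : (C.data g.form).κ (f (u, c.symm y)) (Y (c.symm y)) = -L (1, 0) (1, 0) :=
    congrArg (- ·) (hL (1, 0) (1, 0))
  have h6 : (C.data g.form).Ω (f (u, c.symm y)) (Y (c.symm y))
      (mfderiv (𝓡 2) (𝓡 2) Y (c.symm y) (cvec c y K)) =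
      -L (1, 0) (0, dsph Y (c.symm y) (dchart c y (EuclideanSpace.single K 1))) :=
    congrArg (- ·) (hL (1, 0) (0, dsph Y (c.symm y) (dchart c y (EuclideanSpace.single K 1))))
  rw [hL, hA.dmap_slab_single hc hy, dslab_one hc (z := (u, y)) hy, hA.dmap_one, h3, h3, h4,
    dslab_apply (z := (u, y)) hc hy, hessHat_symm hc hA.smooth (z := (u, y)) hy] at h1
  simp only [map_smul, map_add, _root_.smul_apply, smul_eq_mul] at h1
  refine (congrArg (- ·) h1).trans ?_
  rw [h5, h6]
  refine Eq.trans ?_ (congrArg (_ + _ * _ + ·) h2.symm)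
  simp only [_root_.smul_apply, ContinuousLinearMap.flip_apply, smul_eq_mul]
  field_simp
  ring

theorem IsHypersurfaceSymmetry.xi_eq (hg : (C.data g.form).IsGaugeFixed)
    (hne : (C.data g.form).IsNonExpanding) (hF : IsHypersurfaceSymmetry g.form C F)
    (hI : Induces C F f Y) (hc : c ∈ IsManifold.maximalAtlas (𝓡 2) ∞ S2) (u : ℝ) {y : E2}
    (hy : y ∈ c.target) (K N : Fin 2) :
    (C.data (pullback F g.form)).Ξ u (c.symm y) (cvec c y K) (cvec c y N) =
      1 / fu f (u, c.symm y) * ((C.data g.form).Ξ (f (u, c.symm y)) (Y (c.symm y))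
          (mfderiv (𝓡 2) (𝓡 2) Y (c.symm y) (cvec c y K))
          (mfderiv (𝓡 2) (𝓡 2) Y (c.symm y) (cvec c y N))
        - ((C.data g.form).Ω (f (u, c.symm y)) (Y (c.symm y))
            (mfderiv (𝓡 2) (𝓡 2) Y (c.symm y) (cvec c y K)) * pd N (fun z => f (u, c.symm z)) y
          + (C.data g.form).Ω (f (u, c.symm y)) (Y (c.symm y))
            (mfderiv (𝓡 2) (𝓡 2) Y (c.symm y) (cvec c y N)) * pd K (fun z => f (u, c.symm z)) y)
        - (C.data g.form).κ (f (u, c.symm y)) (Y (c.symm y)) * pd K (fun z => f (u, c.symm z)) y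
          * pd N (fun z => f (u, c.symm z)) y
        - (C.data g.form).hess (fun z => f (u, z)) c y K N) := by
  have hA := hF.isAdmissible hg hne hI
  obtain ⟨L, hL, hLs⟩ := C.exists_data_Y_eq g (pairMap f Y (slab c (u, y)))
  have h1 := hF.data_Y_eq_hess hg hne hI hc (z := (u, y)) hy (0, EuclideanSpace.single K 1)
    (0, EuclideanSpace.single N 1)
  have h5 : (C.data g.form).κ (f (u, c.symm y)) (Y (c.symm y)) = -L (1, 0) (1, 0) :=
    congrArg (- ·) (hL (1, 0) (1, 0))
  have h6 : ∀ K, (C.data g.form).Ω (f (u, c.symm y)) (Y (c.symm y))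
      (mfderiv (𝓡 2) (𝓡 2) Y (c.symm y) (cvec c y K)) =
      -L (1, 0) (0, dsph Y (c.symm y) (dchart c y (EuclideanSpace.single K 1))) := fun K =>
    congrArg (- ·) (hL (1, 0) (0, dsph Y (c.symm y) (dchart c y (EuclideanSpace.single K 1))))
  have h7 : (C.data g.form).Ξ (f (u, c.symm y)) (Y (c.symm y))
      (mfderiv (𝓡 2) (𝓡 2) Y (c.symm y) (cvec c y K))
      (mfderiv (𝓡 2) (𝓡 2) Y (c.symm y) (cvec c y N)) =
      L (0, dsph Y (c.symm y) (dchart c y (EuclideanSpace.single K 1)))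
        (0, dsph Y (c.symm y) (dchart c y (EuclideanSpace.single N 1))) :=
    hL (0, dsph Y (c.symm y) (dchart c y (EuclideanSpace.single K 1)))
      (0, dsph Y (c.symm y) (dchart c y (EuclideanSpace.single N 1)))
  rw [hL, hA.dmap_slab_single hc hy, hA.dmap_slab_single hc hy,
    dslab_apply (z := (u, y)) hc hy, dslab_apply (z := (u, y)) hc hy] at h1
  refine Eq.trans h1 ?_
  rw [h5, h6, h6, h7, Coords.hess_eq hg hne hc hA.smooth hy]
  simp only [map_smul, map_add, _root_.smul_apply, _root_.add_apply, smul_eq_mul]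
  rw [hLs (0, dsph Y (c.symm y) (dchart c y (EuclideanSpace.single K 1))) (1, 0)]
  refine congrArg₂ (· * ·) rfl ?_
  ring

end Coordinates

/-! ### Supertranslations -/

section Supertranslation

theorem fu_add (A : S2 → ℝ) (σ : Sig) : fu (fun σ => σ.1 + A σ.2) σ = 1 := by
  have h : deriv (fun s : ℝ => s + A σ.2) σ.1 = 1 := by rw [deriv_add_const, deriv_id'']
  exact h

theorem pd_const_add (K : Fin 2) (a : ℝ) (h : E2 → ℝ) : pd K (fun z => a + h z) = pd K h := by
  funext y
  rw [pd, fderiv_const_add, pd]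

theorem HData.hess_const_add (D : HData) (a : ℝ) (h : S2 → ℝ) (c : OpenPartialHomeomorph S2 E2)
    (y : E2) (K N : Fin 2) : D.hess (fun z => a + h z) c y K N = D.hess h c y K N := by
  simp only [HData.hess, pd_const_add]

variable {M : Type*} [TopologicalSpace M] [ChartedSpace E4 M] [IsManifold (𝓡 4) ∞ M]
  {g : LorentzMetric M} {C : Coords M} {c : OpenPartialHomeomorph S2 E2} {A : S2 → ℝ}
  {F : PartialDiffeomorph (𝓡 4) (𝓡 4) M M ∞}

theorem mfderiv_refl_apply (x : S2) (v : TangentSpace (𝓡 2) x) :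
    mfderiv (𝓡 2) (𝓡 2) (Diffeomorph.refl (𝓡 2) S2 ∞) x v = v :=
  congrArg (fun L : E2 →L[ℝ] E2 => L v) (mfderiv_id (I := 𝓡 2) (x := x))

theorem IsHypersurfaceSymmetry.kappa_eq_of_supertranslation (hg : (C.data g.form).IsGaugeFixed)
    (hne : (C.data g.form).IsNonExpanding) (hF : IsHypersurfaceSymmetry g.form C F)
    (hI : Induces C F (fun σ => σ.1 + A σ.2) id) (u : ℝ) (x : S2) :
    (C.data (pullback F g.form)).κ u x = (C.data g.form).κ (u + A x) x := by
  have h := hF.kappa_eq (Y := Diffeomorph.refl (𝓡 2) S2 ∞) hg hne hI u x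
  simp only [fu_add, abs_one, Real.log_one, deriv_const, mul_one, add_zero] at h
  exact h

theorem IsHypersurfaceSymmetry.omega_eq_of_supertranslation (hg : (C.data g.form).IsGaugeFixed)
    (hne : (C.data g.form).IsNonExpanding) (hF : IsHypersurfaceSymmetry g.form C F)
    (hI : Induces C F (fun σ => σ.1 + A σ.2) id) (hc : c ∈ IsManifold.maximalAtlas (𝓡 2) ∞ S2)
    (u : ℝ) {y : E2} (hy : y ∈ c.target) (K : Fin 2) :
    (C.data (pullback F g.form)).Ω u (c.symm y) (cvec c y K) =
      (C.data g.form).Ω (u + A (c.symm y)) (c.symm y) (cvec c y K) +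
        (C.data g.form).κ (u + A (c.symm y)) (c.symm y) * pd K (fun z => A (c.symm z)) y := by
  have h := hF.omega_eq (Y := Diffeomorph.refl (𝓡 2) S2 ∞) hg hne hI hc u hy K
  have h0 : pd K (fun _ : E2 => (0 : ℝ)) y = 0 := by simp [pd]
  simp only [fu_add, abs_one, Real.log_one, h0, add_zero, pd_const_add, mfderiv_refl_apply] at h
  exact h

theorem IsHypersurfaceSymmetry.xi_eq_of_supertranslation (hg : (C.data g.form).IsGaugeFixed)
    (hne : (C.data g.form).IsNonExpanding) (hF : IsHypersurfaceSymmetry g.form C F)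
    (hI : Induces C F (fun σ => σ.1 + A σ.2) id) (hc : c ∈ IsManifold.maximalAtlas (𝓡 2) ∞ S2)
    (u : ℝ) {y : E2} (hy : y ∈ c.target) (K N : Fin 2) :
    (C.data (pullback F g.form)).Ξ u (c.symm y) (cvec c y K) (cvec c y N) =
      (C.data g.form).Ξ (u + A (c.symm y)) (c.symm y) (cvec c y K) (cvec c y N)
        - ((C.data g.form).Ω (u + A (c.symm y)) (c.symm y) (cvec c y K)
            * pd N (fun z => A (c.symm z)) y
          + (C.data g.form).Ω (u + A (c.symm y)) (c.symm y) (cvec c y N)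
            * pd K (fun z => A (c.symm z)) y)
        - (C.data g.form).κ (u + A (c.symm y)) (c.symm y) * pd K (fun z => A (c.symm z)) y
          * pd N (fun z => A (c.symm z)) y
        - (C.data g.form).hess A c y K N := by
  have h := hF.xi_eq (Y := Diffeomorph.refl (𝓡 2) S2 ∞) hg hne hI hc u hy K N
  simp only [fu_add, div_one, one_mul, pd_const_add, HData.hess_const_add, mfderiv_refl_apply] at h
  exact h

end Supertranslation

/-! ### Curves of the sphere with prescribed velocity -/

/-- The ambient space of the sphere. -/
abbrev E3 := EuclideanSpace ℝ (Fin 3)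

section Flow

/-- The differential of the inclusion of the sphere. -/
def dcoe (x : S2) : E2 →L[ℝ] E3 := mfderiv (𝓡 2) 𝓘(ℝ, E3) (fun x : S2 => (x : E3)) x

theorem mdifferentiableAt_coe (x : S2) :
    MDifferentiableAt (𝓡 2) 𝓘(ℝ, E3) (fun x : S2 => (x : E3)) x :=
  ((contMDiff_coe_sphere (m := ∞)) x).mdifferentiableAt (by simp)

theorem dcoe_injective (x : S2) : Function.Injective (dcoe x) := injective_mvfderiv_subtypeVal_sphere x

theorem inner_dcoe (x : S2) (v : E2) : inner ℝ (x : E3) (dcoe x v) = 0 := by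
  have h : dcoe x v ∈ (ℝ ∙ (x : E3))ᗮ := by
    rw [← range_mvfderiv_subtypeVal (n := 2) x]
    exact ⟨v, rfl⟩
  exact Submodule.mem_orthogonal_singleton_iff_inner_right.1 h

/-- The derivative of a vector-valued function along a smooth vector field. -/
theorem contMDiff_mfderiv_section {E : Type*} [NormedAddCommGroup E] [NormedSpace ℝ E]
    {j : Sig → E} (hj : ContMDiff IS 𝓘(ℝ, E) ∞ j) {W : Sig → ℝ × E2}
    (hW : ContMDiff IS IS.tangent ∞ (fun σ => (⟨σ, W σ⟩ : TangentBundle IS Sig))) :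
    ContMDiff IS 𝓘(ℝ, E) ∞ (fun σ => (mfderiv IS 𝓘(ℝ, E) j σ (W σ) : E)) := by
  have h1 := (hj.contMDiff_tangentMap (m := ∞) (by simp)).comp hW
  exact (contMDiff_snd_tangentBundle_modelSpace E 𝓘(ℝ, E)).comp h1

/-- The point at parameter `w` of a curve of the sphere that starts at `x` with velocity `w`,
for `w` orthogonal to `x`. -/
def sphPt (x w : E3) : E3 :=
  (1 + ‖w‖ ^ 2 / 4)⁻¹ • ((1 - ‖w‖ ^ 2 / 4) • x + w)

/-- For w orthogonal to x, `sphPt x w` is the inverse stereographic projection from -x of the point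
w/2. With s = ‖w‖²/4, the identity is (1 - s)² + 4s = (1 + s)². -/
theorem norm_sphPt {x w : E3} (hx : ‖x‖ = 1) (h : inner ℝ x w = 0) : ‖sphPt x w‖ = 1 := by
  have h0 : (0 : ℝ) < 1 + ‖w‖ ^ 2 / 4 := by positivity
  have h1 : ‖(1 - ‖w‖ ^ 2 / 4) • x + w‖ ^ 2 = (1 + ‖w‖ ^ 2 / 4) ^ 2 := by
    rw [norm_add_sq_real, inner_smul_left, h, norm_smul, hx, mul_one, Real.norm_eq_abs, sq_abs]
    simp
    ring
  have h2 : ‖(1 - ‖w‖ ^ 2 / 4) • x + w‖ = 1 + ‖w‖ ^ 2 / 4 :=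
    (sq_eq_sq₀ (norm_nonneg _) h0.le).1 h1
  rw [sphPt, norm_smul, h2, norm_inv, Real.norm_eq_abs, abs_of_pos h0, inv_mul_cancel₀ h0.ne']

theorem contDiff_sphPt : ContDiff ℝ ∞ (fun p : E3 × E3 => sphPt p.1 p.2) := by
  have h : ContDiff ℝ ∞ (fun p : E3 × E3 => ‖p.2‖ ^ 2 / 4) :=
    ((contDiff_norm_sq ℝ).comp contDiff_snd).div_const 4
  refine ContDiff.smul (ContDiff.inv (contDiff_const.add h) fun p => ?_) ?_
  · positivity
  · exact ((contDiff_const.sub h).smul contDiff_fst).add contDiff_snd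

theorem contMDiff_sphPt {E H N : Type*} [NormedAddCommGroup E] [NormedSpace ℝ E]
    [TopologicalSpace H] {J : ModelWithCorners ℝ E H} [TopologicalSpace N] [ChartedSpace H N]
    {a b : N → E3} (ha : ContMDiff J 𝓘(ℝ, E3) ∞ a) (hb : ContMDiff J 𝓘(ℝ, E3) ∞ b) :
    ContMDiff J 𝓘(ℝ, E3) ∞ (fun p => sphPt (a p) (b p)) := by
  have h : ContMDiff J 𝓘(ℝ, E3 × E3) ∞ (fun p => (a p, b p)) := ha.prodMk_space hb
  exact ContDiff.comp_contMDiff (g := fun p : E3 × E3 => sphPt p.1 p.2)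
    (f := fun p => (a p, b p)) contDiff_sphPt h

theorem hasDerivAt_sphPt (x w : E3) : HasDerivAt (fun r : ℝ => sphPt x (r • w)) w 0 := by
  have h1 : HasDerivAt (fun r : ℝ => ‖r • w‖ ^ 2 / 4) 0 0 := by
    have h2 : (fun r : ℝ => ‖r • w‖ ^ 2 / 4) = fun r => r ^ 2 * (‖w‖ ^ 2 / 4) := by
      funext r
      rw [norm_smul, mul_pow, Real.norm_eq_abs, sq_abs, mul_div_assoc]
    rw [h2]
    simpa using (hasDerivAt_pow 2 (0 : ℝ)).mul_const (‖w‖ ^ 2 / 4)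
  have h3 := (h1.const_add 1).fun_inv (by simp)
  have h4 := ((h1.const_sub 1).smul_const x).fun_add ((hasDerivAt_id' (0 : ℝ)).smul_const w)
  have h5 := h3.fun_smul h4
  convert! h5 using 1
  simp

end Flow

/-! ### A map with prescribed transverse derivative along {r = 0} -/

section Shear

variable {W : Sig → ℝ × E2} {ρ : Sig → ℝ}

/-- The ambient components of a vector field on `Σ`. -/
def ambient (W : Sig → ℝ × E2) (σ : Sig) : E3 := dcoe σ.2 (W σ).2

/-- A curve of the sphere through `x` at `r = 0`, with the velocity of a vector field there. -/
def sphCurve (W : Sig → ℝ × E2) : Sig × ℝ → S2 :=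
  Set.codRestrict (fun p : Sig × ℝ => sphPt p.1.2 (p.2 • ambient W p.1)) _ fun p => by
    rw [mem_sphere_zero_iff_norm]
    refine norm_sphPt (mem_sphere_zero_iff_norm.1 p.1.2.2) ?_
    rw [inner_smul_right, ambient, inner_dcoe, mul_zero]

/-- A map of `Σ × ℝ` that fixes `Σ × {0}`, with transverse derivative `W + ρ ∂_r` there. -/
def shear (W : Sig → ℝ × E2) (ρ : Sig → ℝ) (p : Sig × ℝ) : Sig × ℝ :=
  ((p.1.1 + p.2 * (W p.1).1, sphCurve W p), p.2 * ρ p.1)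

theorem sphCurve_zero (σ : Sig) : sphCurve W (σ, 0) = σ.2 :=
  Subtype.ext (by simp [sphCurve, sphPt])

theorem shear_zero (σ : Sig) : shear W ρ (σ, 0) = (σ, 0) := by
  refine Prod.ext (Prod.ext ?_ (sphCurve_zero σ)) ?_
  · simp [shear]
  · simp [shear]

theorem contMDiff_ambient
    (hW : ContMDiff IS IS.tangent ∞ (fun σ => (⟨σ, W σ⟩ : TangentBundle IS Sig))) :
    ContMDiff IS 𝓘(ℝ, E3) ∞ (ambient W) := by
  have h1 := contMDiff_mfderiv_section (j := fun σ : Sig => (σ.2 : E3))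
    (contMDiff_coe_sphere.comp contMDiff_snd) hW
  have h2 : ambient W = fun σ => mfderiv IS 𝓘(ℝ, E3) (fun σ : Sig => (σ.2 : E3)) σ (W σ) := by
    funext σ
    have h3 : MDifferentiableAt IS (𝓡 2) (fun σ : Sig => σ.2) σ := mdifferentiableAt_snd
    have h4 := mfderiv_comp_apply σ (mdifferentiableAt_coe σ.2) h3 (W σ : TangentSpace IS σ)
    have h5 : mfderiv IS (𝓡 2) (fun σ : Sig => σ.2) σ (W σ) = (W σ).2 := by
      rw [mfderiv_snd]
      rfl
    exact ((congrArg (dcoe σ.2) h5).symm).trans h4.symm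
  rw [h2]
  exact h1

theorem contMDiff_fst_section
    (hW : ContMDiff IS IS.tangent ∞ (fun σ => (⟨σ, W σ⟩ : TangentBundle IS Sig))) :
    ContMDiff IS 𝓘(ℝ, ℝ) ∞ (fun σ => (W σ).1) := by
  have h1 := contMDiff_mfderiv_section (j := fun σ : Sig => σ.1) contMDiff_fst hW
  have h2 : (fun σ => (W σ).1) = fun σ => mfderiv IS 𝓘(ℝ, ℝ) (fun σ : Sig => σ.1) σ (W σ) := by
    funext σ
    rw [mfderiv_fst]
    rfl
  rw [h2]
  exact h1

theorem contMDiff_sphCurve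
    (hW : ContMDiff IS IS.tangent ∞ (fun σ => (⟨σ, W σ⟩ : TangentBundle IS Sig))) :
    ContMDiff IN (𝓡 2) ∞ (sphCurve W) := by
  have h1 : ContMDiff IN 𝓘(ℝ, E3) ∞ (fun p : Sig × ℝ => ambient W p.1) :=
    (contMDiff_ambient hW).comp contMDiff_fst
  have h2 : ContMDiff IN 𝓘(ℝ, ℝ) ∞ (fun p : Sig × ℝ => p.2) := contMDiff_snd
  have h3 : ContMDiff IN 𝓘(ℝ, E3) ∞ (fun p : Sig × ℝ => p.2 • ambient W p.1) := h2.smul h1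
  have h4 : ContMDiff IN 𝓘(ℝ, E3) ∞ (fun p : Sig × ℝ => (p.1.2 : E3)) :=
    contMDiff_coe_sphere.comp (contMDiff_snd.comp contMDiff_fst)
  have h5 : ContMDiff IN 𝓘(ℝ, E3) ∞ (fun p : Sig × ℝ => sphPt p.1.2 (p.2 • ambient W p.1)) :=
    contMDiff_sphPt h4 h3
  exact ContMDiff.codRestrict_sphere (n := 2) h5 _

theorem contMDiff_shear
    (hW : ContMDiff IS IS.tangent ∞ (fun σ => (⟨σ, W σ⟩ : TangentBundle IS Sig)))
    (hρ : ContMDiff IS 𝓘(ℝ, ℝ) ∞ ρ) : ContMDiff IN IN ∞ (shear W ρ) := by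
  have h1 : ContMDiff IN 𝓘(ℝ, ℝ) ∞ (fun p : Sig × ℝ => (W p.1).1) :=
    (contMDiff_fst_section hW).comp contMDiff_fst
  have h2 : ContMDiff IN 𝓘(ℝ, ℝ) ∞ (fun p : Sig × ℝ => p.2) := contMDiff_snd
  have h3 : ContMDiff IN 𝓘(ℝ, ℝ) ∞ (fun p : Sig × ℝ => ρ p.1) := hρ.comp contMDiff_fst
  have h4 : ContMDiff IN 𝓘(ℝ, ℝ) ∞ (fun p : Sig × ℝ => p.1.1) := contMDiff_fst.comp contMDiff_fst
  have h5 : ContMDiff IN 𝓘(ℝ, ℝ) ∞ (fun p : Sig × ℝ => p.1.1 + p.2 * (W p.1).1) :=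
    h4.add (h2.mul h1)
  exact (h5.prodMk (contMDiff_sphCurve hW)).prodMk (h2.mul h3)

theorem mfderiv_shear_one
    (hW : ContMDiff IS IS.tangent ∞ (fun σ => (⟨σ, W σ⟩ : TangentBundle IS Sig)))
    (hρ : ContMDiff IS 𝓘(ℝ, ℝ) ∞ ρ) (σ : Sig) :
    (mfderiv IN IN (shear W ρ) (σ, 0) ((0, 1) : (ℝ × E2) × ℝ) : (ℝ × E2) × ℝ) = (W σ, ρ σ) := by
  have hl : MDifferentiableAt 𝓘(ℝ, ℝ) IN (fun r : ℝ => (σ, r)) 0 :=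
    mdifferentiableAt_const.prodMk mdifferentiableAt_id
  have hd : MDifferentiableAt IN IN (shear W ρ) (σ, 0) :=
    (contMDiff_shear hW hρ (σ, 0)).mdifferentiableAt (by simp)
  have hs : MDifferentiableAt 𝓘(ℝ, ℝ) (𝓡 2) (fun r : ℝ => sphCurve W (σ, r)) 0 :=
    ((contMDiff_sphCurve hW (σ, 0)).mdifferentiableAt (by simp)).comp (0 : ℝ) hl
  let v : E2 := mfderiv 𝓘(ℝ, ℝ) (𝓡 2) (fun r : ℝ => sphCurve W (σ, r)) 0 (1 : ℝ)
  have hv : dcoe (sphCurve W (σ, 0)) v = ambient W σ := by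
    refine (mfderiv_comp_apply (0 : ℝ) (mdifferentiableAt_coe _) hs (1 : ℝ)).symm.trans ?_
    have h := (hasDerivAt_sphPt (σ.2 : E3) (ambient W σ)).hasFDerivAt.fderiv
    rw [mfderiv_eq_fderiv]
    refine (congrArg (fun L : ℝ →L[ℝ] E3 => L 1) h).trans ?_
    simp
  have hv' : ∀ x : S2, x = σ.2 → dcoe x v = ambient W σ → v = (W σ).2 := by
    rintro _ rfl h
    exact dcoe_injective _ h
  have h1 : HasDerivAt (fun r : ℝ => σ.1 + r * (W σ).1) (W σ).1 0 := by
    simpa using ((hasDerivAt_id (0 : ℝ)).mul_const (W σ).1).const_add σ.1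
  have h2 : HasDerivAt (fun r : ℝ => r * ρ σ) (ρ σ) 0 := by
    simpa using (hasDerivAt_id (0 : ℝ)).mul_const (ρ σ)
  have h1' : MDifferentiableAt 𝓘(ℝ, ℝ) 𝓘(ℝ, ℝ) (fun r : ℝ => σ.1 + r * (W σ).1) 0 :=
    h1.differentiableAt.mdifferentiableAt
  have h2' : MDifferentiableAt 𝓘(ℝ, ℝ) 𝓘(ℝ, ℝ) (fun r : ℝ => r * ρ σ) 0 :=
    h2.differentiableAt.mdifferentiableAt
  have h3 := mfderiv_prodMk (h1'.prodMk hs) h2'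
  have h4 := mfderiv_prodMk h1' hs
  have h5 := mfderiv_comp_apply (0 : ℝ) hd hl (1 : ℝ)
  rw [mfderiv_prod_right] at h5
  have h6 : mfderiv 𝓘(ℝ, ℝ) 𝓘(ℝ, ℝ) (fun r : ℝ => σ.1 + r * (W σ).1) 0 (1 : ℝ) = (W σ).1 := by
    rw [mfderiv_eq_fderiv]
    exact h1.deriv
  have h7 : mfderiv 𝓘(ℝ, ℝ) 𝓘(ℝ, ℝ) (fun r : ℝ => r * ρ σ) 0 (1 : ℝ) = ρ σ := by
    rw [mfderiv_eq_fderiv]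
    exact h2.deriv
  refine h5.symm.trans ((congrArg (fun L : ℝ →L[ℝ] (ℝ × E2) × ℝ => L 1) h3).trans ?_)
  refine congrArg₂ Prod.mk ((congrArg (fun L : ℝ →L[ℝ] (ℝ × E2) => L 1) h4).trans ?_) h7
  exact congrArg₂ Prod.mk h6 (hv' _ (sphCurve_zero σ) hv)

theorem mfderiv_shear
    (hW : ContMDiff IS IS.tangent ∞ (fun σ => (⟨σ, W σ⟩ : TangentBundle IS Sig)))
    (hρ : ContMDiff IS 𝓘(ℝ, ℝ) ∞ ρ) (σ : Sig) (X : ℝ × E2) (t : ℝ) :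
    (mfderiv IN IN (shear W ρ) (σ, 0) (X, t) : (ℝ × E2) × ℝ) = (X + t • W σ, t * ρ σ) := by
  let D : (ℝ × E2) × ℝ →L[ℝ] (ℝ × E2) × ℝ := mfderiv IN IN (shear W ρ) (σ, 0)
  have hd : MDifferentiableAt IN IN (shear W ρ) (σ, 0) :=
    (contMDiff_shear hW hρ (σ, 0)).mdifferentiableAt (by simp)
  have h1 : D (X, 0) = (X, 0) := by
    have hl : MDifferentiableAt IS IN (fun τ : Sig => (τ, (0 : ℝ))) σ :=
      mdifferentiableAt_id.prodMk mdifferentiableAt_const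
    have h2 := mfderiv_comp_apply σ hd hl X
    have h3 : shear W ρ ∘ (fun τ : Sig => (τ, (0 : ℝ))) = fun τ => (τ, 0) := funext shear_zero
    rw [h3, mfderiv_prod_left] at h2
    exact h2.symm
  have h4 : D (0, 1) = (W σ, ρ σ) := mfderiv_shear_one hW hρ σ
  have h9 : ((X, t) : (ℝ × E2) × ℝ) = (X, 0) + t • (0, 1) := by simp
  have h10 : D (X, t) = (X + t • W σ, t * ρ σ) := by
    rw [h9, map_add, map_smul, h1, h4]
    simp
  exact h10

/-- On {r = 0} the differential is triangular, the identity on TΣ and ρ on ∂_r, hence invertible.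
The shear fixes {r = 0} pointwise, so local injectivity there becomes injectivity on one
neighbourhood. -/
theorem exists_partialDiffeomorph_shear
    (hW : ContMDiff IS IS.tangent ∞ (fun σ => (⟨σ, W σ⟩ : TangentBundle IS Sig)))
    (hρ : ContMDiff IS 𝓘(ℝ, ℝ) ∞ ρ) (h0 : ∀ σ, ρ σ ≠ 0) :
    ∃ φ : PartialDiffeomorph IN IN (Sig × ℝ) (Sig × ℝ) ∞,
      (∀ σ, (σ, (0 : ℝ)) ∈ φ.source) ∧ ∀ p, φ p = shear W ρ p := by
  let U : Set (Sig × ℝ) := {p | IsLocalDiffeomorphAt IN IN ∞ (shear W ρ) p}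
  have hU : IsOpen U := isOpen_iff_mem_nhds.2 fun p hp => by
    obtain ⟨φ, hφ, he⟩ := hp
    exact Filter.mem_of_superset (φ.open_source.mem_nhds hφ) fun q hq => ⟨φ, hq, he⟩
  have hU0 : ∀ σ, (σ, (0 : ℝ)) ∈ U := fun σ => by
    refine isLocalDiffeomorphAt_of_mfderiv isOpen_univ (contMDiff_shear hW hρ).contMDiffOn
      (mem_univ _) ?_
    constructor
    · rintro ⟨X, t⟩ ⟨X', t'⟩ h
      have h2 := (mfderiv_shear hW hρ σ X t).symm.trans (h.trans (mfderiv_shear hW hρ σ X' t'))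
      obtain rfl : t = t' := mul_right_cancel₀ (h0 σ) (Prod.mk.inj h2).2
      exact Prod.ext (add_right_cancel (Prod.mk.inj h2).1) rfl
    · rintro ⟨X, t⟩
      refine ⟨(X - (t / ρ σ) • W σ, t / ρ σ), (mfderiv_shear hW hρ σ _ _).trans ?_⟩
      exact Prod.ext (sub_add_cancel _ _) (div_mul_cancel₀ _ (h0 σ))
  obtain ⟨V, hVU, hV, hV0, hinj⟩ := exists_isOpen_injOn hU hU0 (shear_zero (W := W) (ρ := ρ))
    (contMDiff_shear hW hρ).continuous.continuousOn fun σ => by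
      obtain ⟨φ, hφ, he⟩ := hU0 σ
      exact ⟨φ.source, φ.open_source.mem_nhds hφ, fun p hp q hq h =>
        φ.injOn hp hq ((he hp).symm.trans (h.trans (he hq)))⟩
  have : Nonempty (Sig × ℝ) := ⟨((0, ⟨EuclideanSpace.single 0 1, by simp⟩), 0)⟩
  obtain ⟨φ, hφ, he⟩ := exists_partialDiffeomorph_of_injOn hV (fun p hp => hVU hp) hinj
  exact ⟨φ, fun σ => hφ ▸ hV0 σ, he⟩

end Shear

/-! ### Existence of symmetries -/

section Existence

variable {M : Type*} [TopologicalSpace M] [ChartedSpace E4 M] [IsManifold (𝓡 4) ∞ M]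
  {g : LorentzMetric M} {C : Coords M} {f : Sig → ℝ} {Y : S2 ≃ₘ^∞⟮𝓡 2, 𝓡 2⟯ S2}

theorem contMDiff_shift (hg : (C.data g.form).IsGaugeFixed)
    (hne : (C.data g.form).IsNonExpanding) (hf : ContMDiff IS 𝓘(ℝ, ℝ) ∞ f)
    (h0 : ∀ σ, fu f σ ≠ 0) :
    ContMDiff IS IS.tangent ∞ (fun σ => (⟨σ, C.shift g f σ⟩ : TangentBundle IS Sig)) :=
  contMDiff_section_of_slab fun _ hc => ⟨C.shiftHat g _ f,
    Coords.contDiffOn_shiftHat hg hne hc hf h0, fun _ hz => Coords.dslab_shiftHat hg hne hc hf hz⟩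

/-- Every admissible pair is induced by a hypersurface symmetry. -/
theorem IsAdmissible.exists_isHypersurfaceSymmetry (hg : (C.data g.form).IsGaugeFixed)
    (hne : (C.data g.form).IsNonExpanding) (hA : IsAdmissible (C.data g.form) f Y) :
    ∃ F : PartialDiffeomorph (𝓡 4) (𝓡 4) M M ∞,
      IsHypersurfaceSymmetry g.form C F ∧ Induces C F f Y := by
  have hu : ContMDiff IS 𝓘(ℝ, ℝ) ∞ (fun σ => 1 / fu f σ) :=
    contMDiff_const.div₀ (contMDiff_fu hA.smooth) hA.fu_ne_zero
  have hW := contMDiff_shift hg hne hA.smooth hA.fu_ne_zero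
  obtain ⟨φ, hφ0, hφ⟩ := exists_partialDiffeomorph_shear hW hu
    fun σ => one_div_ne_zero (hA.fu_ne_zero σ)
  obtain ⟨ζ, hζ⟩ := hA.exists_diffeomorph
  let Z : PartialDiffeomorph IN IN (Sig × ℝ) (Sig × ℝ) ∞ :=
    (ζ.prodCongr (Diffeomorph.refl 𝓘(ℝ, ℝ) ℝ ∞)).toPartialDiffeomorph
  have hZ : ∀ p, Z p = (pairMap f Y p.1, p.2) := fun p => Prod.ext (hζ p.1) rfl
  have hφz : ∀ σ, φ (σ, 0) = (σ, 0) := fun σ => (hφ _).trans (shear_zero σ)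
  -- The shear produces the tangential shift W and the factor ρ; ζ × id then carries W to dζ(W) and
  -- fixes ∂_r. Hence dF(ℓ) = ρℓ + dζ(W), which is the jet.
  let F := (C.ψ.symm.trans (φ.trans Z)).trans C.ψ
  have hF : ∀ p ∈ C.ψ.source, F (C.ψ p) = C.ψ (Z (φ p)) := fun p hp =>
    congrArg (fun q => C.ψ (Z (φ q))) (C.ψ.left_inv hp)
  have hsrc : ∀ σ, C.Φ σ ∈ F.source := by
    intro σ
    refine ⟨⟨C.Φ_mem_target σ, ?_⟩, ?_⟩
    · change C.ψ.symm (C.Φ σ) ∈ (φ.trans Z).source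
      rw [C.ψ_symm_Φ]
      exact ⟨hφ0 σ, mem_univ _⟩
    · change Z (φ (C.ψ.symm (C.Φ σ))) ∈ C.ψ.source
      rw [C.ψ_symm_Φ, hφz, hZ]
      exact C.zero_mem _
  have hs : C.H ⊆ F.source := by
    rintro _ ⟨σ, rfl⟩
    exact hsrc σ
  have hI : Induces C F f Y := by
    intro u x
    refine (hF _ (C.zero_mem (u, x))).trans ?_
    rw [hφz, hZ]
    rfl
  refine ⟨F, (isHypersurfaceSymmetry_iff_jet hg hne hs hA hI).2 fun σ => ?_, hI⟩
  have hn : ∀ᶠ p in nhds (σ, (0 : ℝ)), F (C.ψ p) = C.ψ (Z (φ p)) :=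
    Filter.eventually_of_mem (C.ψ.open_source.mem_nhds (C.zero_mem σ)) hF
  have h1 := mfderiv_comp_apply (σ, (0 : ℝ)) (F.mdifferentiableAt (by simp) (hsrc σ))
    (C.mdifferentiableAt_ψ (C.zero_mem σ)) ((0, 1) : (ℝ × E2) × ℝ)
  have hs0 : MDifferentiableAt IN IN (shear (C.shift g f) fun σ => 1 / fu f σ) (σ, 0) :=
    (contMDiff_shear hW hu (σ, 0)).mdifferentiableAt (by simp)
  have hp : ∀ σ, MDifferentiableAt IS IS (pairMap f Y) σ := fun σ =>
    (contMDiff_pairMap hA.smooth Y.contMDiff σ).mdifferentiableAt (by simp)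
  have hP : ∀ σ : Sig, MDifferentiableAt IN IN (Prod.map (pairMap f Y) (id : ℝ → ℝ)) (σ, 0) :=
    fun σ => (hp σ).prodMap' mdifferentiableAt_id
  have hP' : MDifferentiableAt IN IN (Prod.map (pairMap f Y) (id : ℝ → ℝ))
      (shear (C.shift g f) (fun σ => 1 / fu f σ) (σ, 0)) := by
    rw [shear_zero]
    exact hP σ
  have hC : MDifferentiableAt IN (𝓡 4) C.ψ ((Prod.map (pairMap f Y) (id : ℝ → ℝ))
      (shear (C.shift g f) (fun σ => 1 / fu f σ) (σ, 0))) := by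
    rw [shear_zero]
    exact C.mdifferentiableAt_ψ (C.zero_mem _)
  have h2 := mfderiv_comp_apply (σ, (0 : ℝ)) hC (hP'.comp _ hs0) ((0, 1) : (ℝ × E2) × ℝ)
  have h3 := mfderiv_comp_apply (σ, (0 : ℝ)) hP' hs0 ((0, 1) : (ℝ × E2) × ℝ)
  have h4 : F ∘ C.ψ =ᶠ[nhds (σ, (0 : ℝ))] C.ψ ∘ (Prod.map (pairMap f Y) (id : ℝ → ℝ)) ∘
      shear (C.shift g f) (fun σ => 1 / fu f σ) := by
    filter_upwards [hn] with p hp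
    refine hp.trans (congrArg C.ψ ?_)
    rw [hZ, hφ]
    rfl
  -- The base point in the chain rule is the image under the shear, equal to (σ, 0) only
  -- propositionally. It is generalized because the type of the differential depends on it.
  have h5 : ∀ q, q = (σ, (0 : ℝ)) → ∀ A : (ℝ × E2) × ℝ,
      (mfderiv IN IN (Prod.map (pairMap f Y) (id : ℝ → ℝ)) q A : (ℝ × E2) × ℝ) =
        (dmap (pairMap f Y) σ A.1, A.2) := by
    rintro _ rfl A
    have h6 := mfderiv_prodMap (p := (σ, (0 : ℝ))) (hp σ)
      (mdifferentiableAt_id : MDifferentiableAt 𝓘(ℝ, ℝ) 𝓘(ℝ, ℝ) (id : ℝ → ℝ) 0)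
    rw [mfderiv_id] at h6
    exact congrArg (fun L : (ℝ × E2) × ℝ →L[ℝ] (ℝ × E2) × ℝ => L A) h6
  have h7 : ∀ q, q = (pairMap f Y σ, (0 : ℝ)) → ∀ A : (ℝ × E2) × ℝ,
      (mfderiv IN (𝓡 4) C.ψ q A : E4) = C.dψ (pairMap f Y σ, 0) A := by
    rintro _ rfl A
    rfl
  have h8 : dspt F (C.Φ σ) (C.dψ (σ, 0) (0, 1)) =
      C.dψ (pairMap f Y σ, 0) (dmap (pairMap f Y) σ (C.shift g f σ), 1 / fu f σ) := by
    refine h1.symm.trans ?_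
    rw [h4.mfderiv_eq]
    refine h2.trans ((h7 _ (by rw [Function.comp, shear_zero]; rfl) _).trans
      (congrArg (C.dψ (pairMap f Y σ, 0)) (h3.trans ((h5 _ (shear_zero σ) _).trans ?_))))
    exact congrArg (fun A : (ℝ × E2) × ℝ => (dmap (pairMap f Y) σ A.1, A.2))
      (mfderiv_shear_one hW hu σ)
  rw [C.ell_eq, h8, C.dψ_zero_apply, hA.jet_eq hg]

end Existence

end NullHyp

end

/-! ### The main theorem -/

open NullHyp in
theorem mainTheorem2 {M : Type*} [TopologicalSpace M] [ChartedSpace E4 M] [IsManifold (𝓡 4) ∞ M]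
    (g : LorentzMetric M) (C : Coords M)
    (hgauge : (C.data g.form).IsGaugeFixed) (hne : (C.data g.form).IsNonExpanding) :
    -- every hypersurface symmetry acts on the hypersurface by a pair `(f, Y)`
    (∀ F, IsHypersurfaceSymmetry g.form C F →
      ∃ (f : Sig → ℝ) (Y : S2 ≃ₘ^∞⟮𝓡 2, 𝓡 2⟯ S2),
        IsAdmissible (C.data g.form) f Y ∧ Induces C F f Y) ∧
    -- among the maps acting so, the symmetries are those with a certain transverse derivative
    (∀ (F : PartialDiffeomorph (𝓡 4) (𝓡 4) M M ∞) (f : Sig → ℝ) (Y : S2 ≃ₘ^∞⟮𝓡 2, 𝓡 2⟯ S2),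
      C.H ⊆ F.source → IsAdmissible (C.data g.form) f Y → Induces C F f Y →
        (IsHypersurfaceSymmetry g.form C F ↔ HasTransverseJet (C.data g.form) C F f Y)) ∧
    -- every pair `(f, Y)` occurs
    (∀ (f : Sig → ℝ) (Y : S2 ≃ₘ^∞⟮𝓡 2, 𝓡 2⟯ S2), IsAdmissible (C.data g.form) f Y →
      ∃ F, IsHypersurfaceSymmetry g.form C F ∧ Induces C F f Y) ∧
    -- `(f, Y)` fixes `F` and its first derivatives on the hypersurface
    (∀ F₁ F₂ (f : Sig → ℝ) (Y : S2 → S2), IsHypersurfaceSymmetry g.form C F₁ →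
      IsHypersurfaceSymmetry g.form C F₂ → Induces C F₁ f Y → Induces C F₂ f Y →
      ∀ (σ : Sig) (X : TangentSpace (𝓡 4) (C.Φ σ)),
        (mfderiv (𝓡 4) (𝓡 4) F₁ (C.Φ σ) X : E4) = mfderiv (𝓡 4) (𝓡 4) F₂ (C.Φ σ) X) ∧
    -- the normal one-form `g(n, ·)` is preserved iff `f_u = 1`, iff `f = u + A`
    (∀ F (f : Sig → ℝ) (Y : S2 ≃ₘ^∞⟮𝓡 2, 𝓡 2⟯ S2),
      IsHypersurfaceSymmetry g.form C F → Induces C F f Y →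
        ((∀ u x, ∀ X : TangentSpace (𝓡 4) (C.Φ (u, x)),
            g.form (C.Φ (f (u, x), Y x)) (C.n (f (u, x), Y x))
              (mfderiv (𝓡 4) (𝓡 4) F (C.Φ (u, x)) X) = g.form (C.Φ (u, x)) (C.n (u, x)) X) ↔
          ∀ σ, fu f σ = 1) ∧
        ((∀ σ, fu f σ = 1) ↔
          ∃ A : S2 → ℝ, ContMDiff (𝓡 2) 𝓘(ℝ, ℝ) ∞ A ∧ ∀ u x, f (u, x) = u + A x)) ∧
    -- the action `g ↦ F^* g` on all the data is a residual gauge transformation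
    (∀ F (f : Sig → ℝ) (Y : S2 ≃ₘ^∞⟮𝓡 2, 𝓡 2⟯ S2),
      IsHypersurfaceSymmetry g.form C F → Induces C F f Y →
      ∃ (ζ : Sig ≃ₘ^∞⟮IS, IS⟯ Sig) (û : Sig → ℝ) (V : ∀ σ : Sig, TangentSpace IS σ),
        (∀ u x, ζ (u, x) = (f (u, x), Y x)) ∧
        (∀ σ, û σ = 1 / fu f σ) ∧
        (∀ u x, ∃ G : TangentSpace (𝓡 2) x, (∀ v, (C.data g.form).q x G v = dS f u x v) ∧
          V (u, x) = vec (u, x) (1 / (2 * fu f (u, x)) * (C.data g.form).q x G G) (-G)) ∧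
        (C.data g.form).IsResidualGauge ζ û V ∧
        C.data (pullback F g.form) = (C.data g.form).gauge ζ û V) ∧
    -- the transformed `κ`, `Ω_M`, `Ξ_MN`, in any local coordinates `y` of the sphere
    (∀ F (f : Sig → ℝ) (Y : S2 ≃ₘ^∞⟮𝓡 2, 𝓡 2⟯ S2),
      IsHypersurfaceSymmetry g.form C F → Induces C F f Y →
      (∀ u x, (C.data (pullback F g.form)).κ u x =
        (C.data g.form).κ (f (u, x)) (Y x) * fu f (u, x)
          + deriv (fun s : ℝ => Real.log |fu f (s, x)|) u) ∧
      ∀ c ∈ IsManifold.maximalAtlas (𝓡 2) ∞ S2, ∀ (u : ℝ), ∀ y ∈ c.target, ∀ K N : Fin 2,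
        let x : S2 := c.symm y
        let e : Fin 2 → TangentSpace (𝓡 2) x := cvec c y
        let e' : Fin 2 → TangentSpace (𝓡 2) (Y x) := fun J => mfderiv (𝓡 2) (𝓡 2) Y x (e J)
        let df : Fin 2 → ℝ := fun J => pd J (fun z => f (u, c.symm z)) y
        let κ₀ := (C.data g.form).κ (f (u, x)) (Y x)
        let Ω₀ : Fin 2 → ℝ := fun J => (C.data g.form).Ω (f (u, x)) (Y x) (e' J)
        let Ξ₀ : ℝ := (C.data g.form).Ξ (f (u, x)) (Y x) (e' K) (e' N)
        (C.data (pullback F g.form)).Ω u x (e K) =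
          Ω₀ K + κ₀ * df K + pd K (fun z => Real.log |fu f (u, c.symm z)|) y ∧
        (C.data (pullback F g.form)).Ξ u x (e K) (e N) =
          1 / fu f (u, x) * (Ξ₀ - (Ω₀ K * df N + Ω₀ N * df K) - κ₀ * df K * df N
            - (C.data g.form).hess (fun z => f (u, z)) c y K N)) ∧
    -- supertranslations: `f = u + A(x)` and `Y = id`
    (∀ F (A : S2 → ℝ), IsHypersurfaceSymmetry g.form C F →
      Induces C F (fun σ => σ.1 + A σ.2) id →
      (∀ u x, (C.data (pullback F g.form)).κ u x = (C.data g.form).κ (u + A x) x) ∧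
      ∀ c ∈ IsManifold.maximalAtlas (𝓡 2) ∞ S2, ∀ (u : ℝ), ∀ y ∈ c.target, ∀ K N : Fin 2,
        let x : S2 := c.symm y
        let e : Fin 2 → TangentSpace (𝓡 2) x := cvec c y
        let dA : Fin 2 → ℝ := fun J => pd J (fun z => A (c.symm z)) y
        let κ₀ := (C.data g.form).κ (u + A x) x
        let Ω₀ : Fin 2 → ℝ := fun J => (C.data g.form).Ω (u + A x) x (e J)
        (C.data (pullback F g.form)).Ω u x (e K) = Ω₀ K + κ₀ * dA K ∧
        (C.data (pullback F g.form)).Ξ u x (e K) (e N) =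
          (C.data g.form).Ξ (u + A x) x (e K) (e N)
            - (Ω₀ K * dA N + Ω₀ N * dA K) - κ₀ * dA K * dA N
            - (C.data g.form).hess A c y K N) := by
  refine ⟨fun F hF => ?_, fun F f Y hs hA hI => ?_, fun f Y hA => ?_,
    fun F₁ F₂ f Y hF₁ hF₂ hI₁ hI₂ σ X => ?_, fun F f Y hF hI => ⟨?_, ?_⟩, fun F f Y hF hI => ?_,
    fun F f Y hF hI => ?_, fun F A hF hI => ?_⟩
  · obtain ⟨ζ, hζ, -⟩ := hF.exists_map
    obtain ⟨Y, hY⟩ := hF.exists_diffeomorph hgauge hζ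
    have hI : Induces C F (fun σ => (ζ σ).1) Y := fun u x =>
      (hζ (u, x)).trans (congrArg C.Φ (Prod.ext rfl (hY (u, x))))
    exact ⟨_, Y, hF.isAdmissible hgauge hne hI, hI⟩
  · rw [hasTransverseJet_iff hgauge]
    exact isHypersurfaceSymmetry_iff_jet hgauge hne hs hA hI
  · exact hA.exists_isHypersurfaceSymmetry hgauge hne
  · exact hF₁.dspt_eq hgauge hne hF₂ hI₁ hI₂ σ X
  · exact ⟨fun h σ => (hF.normal_eq_iff hgauge hne hI σ).1 (h σ.1 σ.2),
      fun h u x => (hF.normal_eq_iff hgauge hne hI (u, x)).2 (h (u, x))⟩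
  · exact fu_eq_one_iff (hF.isAdmissible hgauge hne hI).smooth
  · obtain ⟨ζ, hζ⟩ := (hF.isAdmissible hgauge hne hI).exists_diffeomorph
    exact ⟨ζ, _, C.shiftField g f, fun u x => hζ (u, x), fun σ => rfl, fun u x =>
      ⟨C.grad g f (u, x), Coords.qForm_grad hgauge f (u, x), rfl⟩,
      hF.isResidualGauge hgauge hne hI ζ hζ⟩
  · exact ⟨hF.kappa_eq hgauge hne hI, fun c hc u y hy K N =>
      ⟨hF.omega_eq hgauge hne hI hc u hy K, hF.xi_eq hgauge hne hI hc u hy K N⟩⟩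
  · exact ⟨hF.kappa_eq_of_supertranslation hgauge hne hI, fun c hc u y hy K N =>
      ⟨hF.omega_eq_of_supertranslation hgauge hne hI hc u hy K,
        hF.xi_eq_of_supertranslation hgauge hne hI hc u hy K N⟩⟩
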